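/- Let $m\ge 2$, let $\phi\colon \mathbb{S}^{m+1}\times\mathbb{R}\to\mathbb{R}^{m+2}\setminus\{0\}$, $\phi(x,t)=e^t x$, and fix $\bar x\in\mathbb{R}^{m+1}$, $\bar x\neq 0$, $d=|\bar x|$. For $r>0$ and $h\ge 0$ let $\mathbb{S}^m_{r,h}$ be the $m$-dimensional sphere of radius $r$ centered at $(\bar x,h)$ in the affine hyperplane $\mathbb{R}^{m+1}\times\{h\}$ of $\mathbb{R}^{m+2}=\mathbb{R}^{m+1}\times\mathbb{R}$, and let $M^m_{r,h}=\phi^{-1}(\mathbb{S}^m_{r,h})$ (the origin being removed from $\mathbb{S}^m_{r,h}$ if $(r,h)=(d,0)$). All products $\mathbb{S}^k\times\mathbb{R}$ carry the product metric. An immersion with its induced metric is umbilical if its second fundamental form satisfies $\alpha(X,Y)=\langle X,Y\rangle\zeta$ for a normal vector field $\zeta$, and totally geodesic if $\alpha=0$. The totally geodesic submanifolds $\mathbb{S}^k\times\mathbb{R}$ of $\mathbb{S}^n\times\mathbb{R}$ meant below are the products of a great $k$-sphere of $\mathbb{S}^n$ with $\mathbb{R}$. An $m$-dimensional submanifold of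 $\mathbb{S}^n\times\mathbb{R}\subset\mathbb{R}^{n+2}$ is rotational with profile $\alpha$ if it is the orbit of a smooth regular curve $\alpha$ in $\mathbb{S}^n\times\mathbb{R}$ under the group of isometries of $\mathbb{R}^{n+2}$ that fix pointwise a linear subspace $P^{n-m+2}$ containing the direction of the factor $\mathbb{R}$, where $\alpha$ lies in one of the two closed half-spaces determined by $P^{n-m+2}$ in a linear subspace $P^{n-m+3}\supset P^{n-m+2}$. For all $r>0$ and $h\ge 0$, $M^m_{r,h}$ is a complete umbilical embedded submanifold of $\mathbb{S}^{m+1}\times\mathbb{R}$, and: (i) it is diffeomorphic to $\mathbb{S}^m$ if $(r,h)\ne(d,0)$ and to $\mathbb{R}^m$ if $(r,h)=(d,0)$; (ii) it lies in a totally geodesic hypersurface $\mathbb{S}^m\times\mathbb{R}$ of $\mathbb{S}^{m+1}\times\mathbb{R}$ if and only if $h=0$; (iii) in a totally geodesic hypersurface $\mathbb{S}^m\times\mathbb{R}$ that contains it, $M^m_{r,0}$ is homologous to zero if $r<d$ and not homologous to zero if $r>d$ (singular homology with integer coefficients); (iv) it is a rotational submanifold whose profile is a curve in a totally geodesic $\mathbb{S}^2\times\mathbb{R}$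 if $h\neq 0$, and in a totally geodesic $\mathbb{S}^1\times\mathbb{R}$ if $h=0$; (v) if $(r,h)\ne(r',h')$ then no isometry of $\mathbb{S}^{m+1}\times\mathbb{R}$ carries $M^m_{r,h}$ onto $M^m_{r',h'}$. Conversely, let $M^m$ be a connected smooth manifold of dimension $m$ and $f\colon M^m\to\mathbb{S}^n\times\mathbb{R}$ an umbilical immersion that is not totally geodesic. Then, up to an isometry of $\mathbb{S}^n\times\mathbb{R}$, $f(M^m)$ is an open subset of one of the following: an $m$-dimensional small sphere in $\mathbb{S}^n\times\{0\}$; $M^m_{r,0}\subset\mathbb{S}^m\times\mathbb{R}$ for some $r>0$, if $n=m$ (where $\mathbb{S}^m\subset\mathbb{S}^{m+1}$ is the great sphere in $\mathbb{R}^{m+1}\times\{0\}$); $M^m_{r,h}$ for some $r>0$ and $h\ge 0$, if $n=m+1$; $M^m_{r,h}$ in a totally geodesic $\mathbb{S}^{m+1}\times\mathbb{R}$ for some $r>0$ and $h\ge 0$, if $n>m+1$. -/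

import Mathlib

open Set Filter Topology MeasureTheory Module
open scoped Manifold ContDiff EuclideanSpace RealInnerProductSpace ENNReal

noncomputable section

/-! ### The ambient space `𝕊ⁿ × ℝ` -/

/-- The unit sphere `𝕊ⁿ` of `ℝⁿ⁺¹`. -/
abbrev Sph (n : ℕ) : Type := Metric.sphere (0 : EuclideanSpace ℝ (Fin (n + 1))) 1

/-- The product `𝕊ⁿ × ℝ`. -/
abbrev SphR (n : ℕ) : Type := Sph n × ℝ

/-- The product model of the manifold `𝕊ⁿ × ℝ`. -/
abbrev modelSphR (n : ℕ) :
    ModelWithCorners ℝ (EuclideanSpace ℝ (Fin n) × ℝ) (ModelProd (EuclideanSpace ℝ (Fin n)) ℝ) :=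
  (𝓡 n).prod 𝓘(ℝ, ℝ)

/-- The Euclidean space `ℝⁿ⁺² = ℝⁿ⁺¹ × ℝ` (with the `ℓ²` product norm) containing `𝕊ⁿ × ℝ`. -/
abbrev Amb (n : ℕ) : Type := WithLp 2 (EuclideanSpace ℝ (Fin (n + 1)) × ℝ)

/-- The canonical inclusion `𝕊ⁿ × ℝ → ℝⁿ⁺²`. -/
def toAmb {n : ℕ} (p : SphR n) : Amb n :=
  WithLp.toLp 2 ((p.1 : EuclideanSpace ℝ (Fin (n + 1))), p.2)

/-- The unit vector `∂/∂t` tangent to the factor `ℝ`. -/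
def ddt (n : ℕ) : Amb n := WithLp.toLp 2 ((0 : EuclideanSpace ℝ (Fin (n + 1))), (1 : ℝ))

/-- The unit normal vector of `𝕊ⁿ × ℝ` in `ℝⁿ⁺²` at `p = (x, t)`, namely `(x, 0)`. -/
def nuAmb {n : ℕ} (p : SphR n) : Amb n :=
  WithLp.toLp 2 ((p.1 : EuclideanSpace ℝ (Fin (n + 1))), (0 : ℝ))

/-- The Riemannian distance of the product metric on `𝕊ⁿ × ℝ`: the distance on `𝕊ⁿ` is the angle. -/
def riemDist {n : ℕ} (p q : SphR n) : ℝ :=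
  Real.sqrt (InnerProductGeometry.angle (p.1 : EuclideanSpace ℝ (Fin (n + 1))) q.1 ^ 2
    + (p.2 - q.2) ^ 2)

/-- The isometries of `𝕊ⁿ × ℝ` are the bijections that preserve the Riemannian distance. -/
def IsAmbientIsometry {n : ℕ} (Ψ : SphR n ≃ SphR n) : Prop :=
  ∀ p q, riemDist (Ψ p) (Ψ q) = riemDist p q

/-- Two subsets are congruent if an isometry of the ambient space carries one onto the other. -/
def AreCongruent {n : ℕ} (A B : Set (SphR n)) : Prop :=
  ∃ Ψ : SphR n ≃ SphR n, IsAmbientIsometry Ψ ∧ Ψ '' A = B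

/-- The totally geodesic submanifold `𝕊(W) × ℝ` of `𝕊ⁿ × ℝ`, where `𝕊(W)` is the unit sphere of a
linear subspace `W` of `ℝⁿ⁺¹`; it is an `𝕊ᵏ × ℝ` if `dim W = k + 1`. -/
def totGeodCyl {n : ℕ} (W : Submodule ℝ (EuclideanSpace ℝ (Fin (n + 1)))) : Set (SphR n) :=
  {p | (p.1 : EuclideanSpace ℝ (Fin (n + 1))) ∈ W}

/-- The small `m`-spheres of `𝕊ⁿ × {0}`: the sections of `𝕊ⁿ` by affine subspaces `c + W` with
`dim W = m + 1`, `c ⊥ W` and `0 < |c| < 1`. -/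
def IsSmallSphere {n : ℕ} (m : ℕ) (S : Set (SphR n)) : Prop :=
  ∃ (W : Submodule ℝ (EuclideanSpace ℝ (Fin (n + 1)))) (c : EuclideanSpace ℝ (Fin (n + 1))),
    finrank ℝ W = m + 1 ∧ c ∈ Wᗮ ∧ 0 < ‖c‖ ∧ ‖c‖ < 1 ∧
    S = {p | (p.1 : EuclideanSpace ℝ (Fin (n + 1))) - c ∈ W ∧ p.2 = 0}

/-- `A` is a (relatively) open subset of `B`. -/
def IsOpenSubsetOf {X : Type*} [TopologicalSpace X] (A B : Set X) : Prop :=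
  ∃ U : Set X, IsOpen U ∧ A = B ∩ U

/-! ### Immersions into `𝕊ⁿ × ℝ`

An immersed manifold always carries the metric induced by the immersion. -/

section Immersions

variable (m : ℕ) {n : ℕ} {M : Type*} [TopologicalSpace M] [ChartedSpace (EuclideanSpace ℝ (Fin m)) M]

/-- Smooth immersions `M^m → 𝕊ⁿ × ℝ`. -/
structure IsSmoothImmersion (f : M → SphR n) : Prop where
  contMDiff : ContMDiff (𝓡 m) (modelSphR n) ∞ f
  injective_mfderiv : ∀ p : M, Function.Injective (mfderiv (𝓡 m) (modelSphR n) f p)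

/-- `f` is a smooth embedding with image `S`, that is, a diffeomorphism of `M` onto the embedded
submanifold `S` of `𝕊ⁿ × ℝ`. -/
structure IsSmoothEmbeddingOnto (f : M → SphR n) (S : Set (SphR n)) : Prop where
  immersion : IsSmoothImmersion m f
  isEmbedding : IsEmbedding f
  range_eq : range f = S

/-- The immersion, seen in `ℝⁿ⁺²` and read in the preferred chart at `p`. -/
def localRep (f : M → SphR n) (p : M) : EuclideanSpace ℝ (Fin m) → Amb n :=
  fun y => toAmb (f ((extChartAt (𝓡 m) p).symm y))

/-- The differential of `f` at `p`, with values in `ℝⁿ⁺²`. The tangent space of `M` at `p` is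
`ℝᵐ` through the preferred chart at `p`. -/
def dImm (f : M → SphR n) (p : M) : EuclideanSpace ℝ (Fin m) →L[ℝ] Amb n :=
  fderiv ℝ (localRep m f p) (extChartAt (𝓡 m) p p)

/-- The normal space of `f` at `p`: the vectors of `ℝⁿ⁺²` tangent to `𝕊ⁿ × ℝ` at `f p` and
orthogonal to the image of the differential of `f`. -/
def normalSpace (f : M → SphR n) (p : M) : Submodule ℝ (Amb n) :=
  ((dImm m f p).toLinearMap.range ⊔ Submodule.span ℝ {nuAmb (f p)})ᗮ

/-- The second fundamental form of `f : M → 𝕊ⁿ × ℝ` at `p`: by the Gauss formula, the component of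
the second derivative of `f` in the normal space. -/
def secondFundamentalForm (f : M → SphR n) (p : M) (v w : EuclideanSpace ℝ (Fin m)) : Amb n :=
  (normalSpace m f p).starProjection
    (fderiv ℝ (fderiv ℝ (localRep m f p)) (extChartAt (𝓡 m) p p) v w)

/-- `f` is umbilical: `α(X, Y) = ⟨X, Y⟩ ζ` for a normal vector field `ζ`. -/
def IsUmbilical (f : M → SphR n) : Prop :=
  ∃ ζ : M → Amb n, ∀ p : M, ζ p ∈ normalSpace m f p ∧
    ∀ v w : EuclideanSpace ℝ (Fin m),
      secondFundamentalForm m f p v w = ⟪dImm m f p v, dImm m f p w⟫ • ζ p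

/-- `f` is totally geodesic: its second fundamental form vanishes identically. -/
def IsTotallyGeodesic (f : M → SphR n) : Prop :=
  ∀ (p : M) (v w : EuclideanSpace ℝ (Fin m)), secondFundamentalForm m f p v w = 0

/-- The Riemannian distance of the metric induced by `f`: the infimum of the lengths of the
`C¹` paths of `M` joining `p` to `q`. -/
def inducedEDist (f : M → SphR n) (p q : M) : ℝ≥0∞ :=
  ⨅ (γ : ℝ → M) (_ : ContMDiffOn 𝓘(ℝ, ℝ) (𝓡 m) 1 γ (Icc 0 1)) (_ : γ 0 = p) (_ : γ 1 = q),
    ∫⁻ t in Icc (0 : ℝ) 1, ‖derivWithin (fun s => toAmb (f (γ s))) (Icc 0 1) t‖ₑ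

/-- The metric induced by `f` is complete: Cauchy sequences for its Riemannian distance converge. -/
def IsCompleteImmersion (f : M → SphR n) : Prop :=
  ∀ u : ℕ → M,
    (∀ ε : ℝ≥0∞, 0 < ε → ∃ N : ℕ, ∀ i j : ℕ, N ≤ i → N ≤ j → inducedEDist m f (u i) (u j) < ε) →
    ∃ p : M, Tendsto (fun k => inducedEDist m f (u k) p) atTop (𝓝 0)

end Immersions

/-! ### The submanifolds `M^m_{r,h}` -/

/-- The map `φ(x, t) = eᵗ x`. -/
def conformalMap {n : ℕ} (p : SphR n) : EuclideanSpace ℝ (Fin (n + 1)) :=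
  Real.exp p.2 • (p.1 : EuclideanSpace ℝ (Fin (n + 1)))

/-- The point `(x, h)` of `ℝᵐ⁺² = ℝᵐ⁺¹ × ℝ`. -/
def halfLinePoint {m : ℕ} (xbar : EuclideanSpace ℝ (Fin (m + 1))) (h : ℝ) :
    EuclideanSpace ℝ (Fin (m + 1 + 1)) :=
  WithLp.toLp 2 (Fin.snoc (α := fun _ => ℝ) (fun i => xbar i) h)

/-- The `m`-sphere of radius `r` and centre `(x, h)` in the hyperplane `ℝᵐ⁺¹ × {h}`. -/
def sphereRH {m : ℕ} (xbar : EuclideanSpace ℝ (Fin (m + 1))) (r h : ℝ) :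
    Set (EuclideanSpace ℝ (Fin (m + 1 + 1))) :=
  {y | ‖y - halfLinePoint xbar h‖ = r ∧ y (Fin.last (m + 1)) = h}

/-- `M^m_{r,h}`: the inverse image of the sphere by `φ`. The origin, which is not in the image of
`φ`, is thereby discarded. -/
def MRH {m : ℕ} (xbar : EuclideanSpace ℝ (Fin (m + 1))) (r h : ℝ) : Set (SphR (m + 1)) :=
  {p | conformalMap p ∈ sphereRH xbar r h}

/-- A vector of `ℝᵏ`, extended by zero to a sequence; this identifies `ℝᵏ` with the subspace
`ℝᵏ × {0}` of `ℝˡ` for `k ≤ l`. -/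
def zeroExt {k : ℕ} (x : EuclideanSpace ℝ (Fin k)) (i : ℕ) : ℝ :=
  if hi : i < k then x ⟨i, hi⟩ else 0

/-- A subset `A` of `𝕊ᵏ × ℝ`, seen in `𝕊ⁿ × ℝ`. The smaller of the two products is a totally
geodesic submanifold of the larger one, through the standard inclusion of `ℝᵏ⁺¹` in `ℝⁿ⁺¹` or of
`ℝⁿ⁺¹` in `ℝᵏ⁺¹`. -/
def inSphR {k : ℕ} (n : ℕ) (A : Set (SphR k)) : Set (SphR n) :=
  {p | ∃ q ∈ A, q.2 = p.2 ∧ zeroExt (q.1 : EuclideanSpace ℝ (Fin (k + 1))) =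
    zeroExt (p.1 : EuclideanSpace ℝ (Fin (n + 1)))}

theorem inSphR_self {k : ℕ} (A : Set (SphR k)) : inSphR k A = A := by
  ext p
  constructor
  · rintro ⟨q, hq, h2, h1⟩
    have : q = p := by
      refine Prod.ext (Subtype.ext ?_) h2
      ext i
      have := congrFun h1 i.1
      simpa [zeroExt, i.2] using this
    exact this ▸ hq
  · intro hp
    exact ⟨p, hp, rfl, rfl⟩

/-! ### Rotational submanifolds -/

/-- `M` is an `m`-dimensional rotational submanifold of `𝕊ⁿ × ℝ` whose profile is a curve in a
totally geodesic `𝕊ˢ × ℝ`: there are subspaces `P₂ ⊆ P₃` of `ℝⁿ⁺²`, of dimensions `n - m + 2` and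
`n - m + 3`, containing the direction `∂/∂t`, and a smooth regular curve `α : J → 𝕊ⁿ × ℝ`, lying in
one of the two half-spaces of `P₃` determined by `P₂` and in an `𝕊ˢ × ℝ = (𝕊ⁿ × ℝ) ∩ Q` with
`Q ⊆ P₃`, such that `M` is the orbit of `α` under the isometries of `ℝⁿ⁺²` that fix `P₂`
pointwise. -/
def IsRotational {n : ℕ} (m s : ℕ) (M : Set (SphR n)) : Prop :=
  ∃ P₂ P₃ Q : Submodule ℝ (Amb n),
    P₂ ≤ P₃ ∧ ddt n ∈ P₂ ∧ finrank ℝ P₂ + m = n + 2 ∧ finrank ℝ P₃ + m = n + 3 ∧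
    Q ≤ P₃ ∧ ddt n ∈ Q ∧ finrank ℝ Q = s + 2 ∧
    ∃ u ∈ P₃, u ≠ 0 ∧ u ∈ P₂ᗮ ∧
    ∃ (J : Set ℝ) (α : ℝ → Amb n),
      J.OrdConnected ∧ (interior J).Nonempty ∧ ContDiffOn ℝ ∞ α J ∧
      (∀ τ ∈ J, derivWithin α J τ ≠ 0) ∧
      (∀ τ ∈ J, α τ ∈ range (toAmb (n := n)) ∧ α τ ∈ Q ∧ 0 ≤ ⟪α τ, u⟫) ∧
      toAmb '' M = {y | ∃ T : Amb n ≃ₗᵢ[ℝ] Amb n, (∀ z ∈ P₂, T z = z) ∧ ∃ τ ∈ J, y = T (α τ)}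

/-! ### Homology -/

/-- The inclusion `A ⊆ B` of subspaces induces the zero map on singular homology with integer
coefficients in degree `k`. If `A` is a closed connected oriented `k`-manifold, then its fundamental
class generates `H_k(A; ℤ)`, so that this says that `A` is homologous to zero in `B`. -/
def IsNullHomologous {X : Type} [TopologicalSpace X] (k : ℕ) {A B : Set X} (hAB : A ⊆ B) : Prop :=
  ((AlgebraicTopology.singularHomologyFunctor (ModuleCat.{0} ℤ) k).obj (ModuleCat.of ℤ ℤ)).map
    (TopCat.ofHom ⟨Set.inclusion hAB, continuous_inclusion hAB⟩ : TopCat.of A ⟶ TopCat.of B) = 0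

end

/-! ### The augmented complex of tuples and its barycentric subdivision -/

section Tuples

variable {X Y V V' : Type*} {n : ℕ}

/-- Integral chains of `n`-tuples of elements of `X`. -/
abbrev TupleChain (n : ℕ) (X : Type*) : Type _ := (Fin n → X) →₀ ℤ

/-- The boundary map of the augmented complex of tuples. -/
noncomputable def tupleBoundary : TupleChain (n + 1) X →ₗ[ℤ] TupleChain n X :=
  Finsupp.linearCombination ℤ fun v : Fin (n + 1) → X =>
    ∑ i : Fin (n + 1), (-1 : ℤ) ^ (i : ℕ) • Finsupp.single (v ∘ i.succAbove) (1 : ℤ)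

/-- The cone with apex `b`. -/
noncomputable def tupleCone (b : X) : TupleChain n X →ₗ[ℤ] TupleChain (n + 1) X :=
  Finsupp.lmapDomain ℤ ℤ (Fin.cons (α := fun _ => X) b)

/-- The map of chains of tuples induced by a map of sets. -/
noncomputable def tupleMap (g : X → Y) : TupleChain n X →ₗ[ℤ] TupleChain n Y :=
  Finsupp.lmapDomain ℤ ℤ (fun v => g ∘ v)

theorem tupleBoundary_single (v : Fin (n + 1) → X) :
    tupleBoundary (Finsupp.single v 1) =
      ∑ i : Fin (n + 1), (-1 : ℤ) ^ (i : ℕ) • Finsupp.single (v ∘ i.succAbove) (1 : ℤ) := by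
  simp [tupleBoundary]

theorem tupleCone_single (b : X) (v : Fin n → X) :
    tupleCone b (Finsupp.single v 1) = Finsupp.single (Fin.cons (α := fun _ => X) b v) 1 := by
  simp [tupleCone]

theorem tupleMap_single (g : X → Y) (v : Fin n → X) :
    tupleMap g (Finsupp.single v 1) = Finsupp.single (g ∘ v) 1 := by
  simp [tupleMap]

theorem tupleChain_hom_ext {A : Type*} [AddCommGroup A] {f g : TupleChain n X →ₗ[ℤ] A}
    (h : ∀ v, f (Finsupp.single v 1) = g (Finsupp.single v 1)) : f = g :=
  Finsupp.lhom_ext' fun v => LinearMap.ext_ring (h v)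

theorem tupleMap_boundary (g : X → Y) (c : TupleChain (n + 1) X) :
    tupleMap g (tupleBoundary c) = tupleBoundary (tupleMap g c) := by
  suffices h : (tupleMap g).comp tupleBoundary = tupleBoundary.comp (tupleMap (n := n + 1) g) from
    LinearMap.congr_fun h c
  refine tupleChain_hom_ext fun v => ?_
  simp only [LinearMap.comp_apply, tupleMap_single, tupleBoundary_single, map_sum, map_smul]
  rfl

theorem tupleMap_cone (g : X → Y) (b : X) (c : TupleChain n X) :
    tupleMap g (tupleCone b c) = tupleCone (g b) (tupleMap g c) := by
  suffices h : (tupleMap g).comp (tupleCone b) = (tupleCone (g b)).comp (tupleMap (n := n) g) from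
    LinearMap.congr_fun h c
  refine tupleChain_hom_ext fun v => ?_
  simp only [LinearMap.comp_apply, tupleMap_single, tupleCone_single]
  congr 1
  funext i
  refine Fin.cases ?_ (fun i => ?_) i <;> simp

theorem tupleMap_comp {Z : Type*} (g : X → Y) (k : Y → Z) (c : TupleChain n X) :
    tupleMap k (tupleMap g c) = tupleMap (k ∘ g) c := by
  suffices h : (tupleMap k).comp (tupleMap g) = tupleMap (n := n) (k ∘ g) from
    LinearMap.congr_fun h c
  refine tupleChain_hom_ext fun v => ?_
  simp only [LinearMap.comp_apply, tupleMap_single]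
  rfl

theorem tupleBoundary_cone_zero (b : X) (c : TupleChain 0 X) :
    tupleBoundary (tupleCone b c) = c := by
  suffices h : tupleBoundary.comp (tupleCone b) = (LinearMap.id : TupleChain 0 X →ₗ[ℤ] _) from
    LinearMap.congr_fun h c
  refine tupleChain_hom_ext fun v => ?_
  simp only [LinearMap.comp_apply, tupleCone_single, tupleBoundary_single]
  simp [Subsingleton.elim _ v]

theorem tupleBoundary_cone (b : X) (c : TupleChain (n + 1) X) :
    tupleBoundary (tupleCone b c) = c - tupleCone b (tupleBoundary c) := by
  suffices h : tupleBoundary.comp (tupleCone b) =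
      (LinearMap.id : TupleChain (n + 1) X →ₗ[ℤ] _) - (tupleCone b).comp tupleBoundary from
    LinearMap.congr_fun h c
  refine tupleChain_hom_ext fun v => ?_
  simp only [LinearMap.comp_apply, LinearMap.sub_apply, LinearMap.id_apply, tupleCone_single,
    tupleBoundary_single, map_sum, map_smul]
  rw [Fin.sum_univ_succ, sub_eq_add_neg, ← Finset.sum_neg_distrib]
  congr 1
  · simp
  · refine Finset.sum_congr rfl fun i _ => ?_
    have : (Fin.cons (α := fun _ => X) b v) ∘ i.succ.succAbove =
        Fin.cons (α := fun _ => X) b (v ∘ i.succAbove) := by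
      funext j
      refine Fin.cases ?_ (fun j => ?_) j <;> simp
    rw [this]
    simp [pow_succ]

theorem tuple_eq_cone (v : Fin (n + 1) → X) :
    Finsupp.single v (1 : ℤ) = tupleCone (v 0) (Finsupp.single (Fin.tail v) 1) := by
  rw [tupleCone_single, Fin.cons_self_tail]

theorem tupleBoundary_boundary (c : TupleChain (n + 2) X) :
    tupleBoundary (tupleBoundary c) = 0 := by
  induction n with
  | zero =>
    suffices h : tupleBoundary.comp tupleBoundary = (0 : TupleChain 2 X →ₗ[ℤ] _) from
      LinearMap.congr_fun h c
    refine tupleChain_hom_ext fun v => ?_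
    rw [tuple_eq_cone, LinearMap.comp_apply, tupleBoundary_cone, map_sub, tupleBoundary_cone_zero,
      sub_self, LinearMap.zero_apply]
  | succ n ih =>
    suffices h : tupleBoundary.comp tupleBoundary = (0 : TupleChain (n + 1 + 2) X →ₗ[ℤ] _) from
      LinearMap.congr_fun h c
    refine tupleChain_hom_ext fun v => ?_
    rw [tuple_eq_cone, LinearMap.comp_apply, tupleBoundary_cone, map_sub, tupleBoundary_cone, ih]
    simp

variable [AddCommGroup V] [Module ℝ V] [AddCommGroup V'] [Module ℝ V']

/-- The barycentre of a tuple of points. -/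
noncomputable def tupleBary (v : Fin n → V) : V := (n : ℝ)⁻¹ • ∑ i, v i

/-- Barycentric subdivision. -/
noncomputable def tupleSd : ∀ n : ℕ, TupleChain n V →ₗ[ℤ] TupleChain n V
  | 0 => LinearMap.id
  | n + 1 => Finsupp.linearCombination ℤ fun v =>
      tupleCone (tupleBary v) (tupleSd n (tupleBoundary (Finsupp.single v 1)))

/-- The chain homotopy between the identity and barycentric subdivision. -/
noncomputable def tupleHtpy : ∀ n : ℕ, TupleChain n V →ₗ[ℤ] TupleChain (n + 1) V
  | 0 => 0
  | n + 1 => Finsupp.linearCombination ℤ fun v =>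
      tupleCone (tupleBary v)
        (Finsupp.single v 1 - tupleHtpy n (tupleBoundary (Finsupp.single v 1)))

theorem tupleSd_single (v : Fin (n + 1) → V) : tupleSd (n + 1) (Finsupp.single v 1) =
    tupleCone (tupleBary v) (tupleSd n (tupleBoundary (Finsupp.single v 1))) := by
  simp [tupleSd]

theorem tupleHtpy_single (v : Fin (n + 1) → V) : tupleHtpy (n + 1) (Finsupp.single v 1) =
    tupleCone (tupleBary v)
      (Finsupp.single v 1 - tupleHtpy n (tupleBoundary (Finsupp.single v 1))) := by
  simp [tupleHtpy]

theorem tupleBoundary_sd (c : TupleChain (n + 1) V) :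
    tupleBoundary (tupleSd (n + 1) c) = tupleSd n (tupleBoundary c) := by
  induction n with
  | zero =>
    suffices h : tupleBoundary.comp (tupleSd 1) = (tupleSd (V := V) 0).comp tupleBoundary from
      LinearMap.congr_fun h c
    refine tupleChain_hom_ext fun v => ?_
    rw [LinearMap.comp_apply, tupleSd_single, tupleBoundary_cone_zero, LinearMap.comp_apply]
  | succ n ih =>
    suffices h : tupleBoundary.comp (tupleSd (n + 1 + 1)) =
        (tupleSd (V := V) (n + 1)).comp tupleBoundary from LinearMap.congr_fun h c
    refine tupleChain_hom_ext fun v => ?_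
    rw [LinearMap.comp_apply, tupleSd_single, tupleBoundary_cone, ih, tupleBoundary_boundary]
    simp

theorem tupleBoundary_htpy (c : TupleChain (n + 1) V) :
    tupleBoundary (tupleHtpy (n + 1) c) =
      c - tupleSd (n + 1) c - tupleHtpy n (tupleBoundary c) := by
  induction n with
  | zero =>
    suffices h : tupleBoundary.comp (tupleHtpy 1) = LinearMap.id - tupleSd (V := V) 1 -
        (tupleHtpy 0).comp tupleBoundary from LinearMap.congr_fun h c
    refine tupleChain_hom_ext fun v => ?_
    simp only [LinearMap.comp_apply, LinearMap.sub_apply, LinearMap.id_apply, tupleSd_single,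
      tupleHtpy_single, tupleBoundary_cone]
    simp [tupleHtpy, tupleSd]
  | succ n ih =>
    suffices h : tupleBoundary.comp (tupleHtpy (n + 1 + 1)) = LinearMap.id -
        tupleSd (V := V) (n + 1 + 1) - (tupleHtpy (n + 1)).comp tupleBoundary from
      LinearMap.congr_fun h c
    refine tupleChain_hom_ext fun v => ?_
    simp only [LinearMap.comp_apply, LinearMap.sub_apply, LinearMap.id_apply, tupleSd_single,
      tupleHtpy_single, tupleBoundary_cone, map_sub, ih, tupleBoundary_boundary, map_zero]
    abel

theorem tupleMap_sd (A : V →ₗ[ℝ] V') (c : TupleChain n V) :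
    tupleMap A (tupleSd n c) = tupleSd n (tupleMap A c) := by
  induction n with
  | zero => rfl
  | succ n ih =>
    suffices h : (tupleMap A).comp (tupleSd (n + 1)) = (tupleSd (n + 1)).comp (tupleMap A) from
      LinearMap.congr_fun h c
    refine tupleChain_hom_ext fun v => ?_
    rw [LinearMap.comp_apply, LinearMap.comp_apply, tupleSd_single, tupleMap_single, tupleSd_single,
      tupleMap_cone, ih, tupleMap_boundary, tupleMap_single]
    simp [tupleBary, map_sum]

/-- Chains all of whose tuples have the property `P`. -/
noncomputable abbrev tupleSupported (P : (Fin n → X) → Prop) : Submodule ℤ (TupleChain n X) :=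
  Finsupp.supported ℤ ℤ {v | P v}

theorem map_mem_of_tupleSupported {A : Type*} [AddCommGroup A] {P : (Fin n → X) → Prop}
    {f : TupleChain n X →ₗ[ℤ] A} {Q : Submodule ℤ A}
    (h : ∀ v, P v → f (Finsupp.single v 1) ∈ Q) {c : TupleChain n X} (hc : c ∈ tupleSupported P) :
    f c ∈ Q := by
  rw [tupleSupported, Finsupp.supported_eq_span_single] at hc
  have : Submodule.span ℤ ((fun i => Finsupp.single i (1 : ℤ)) '' {v | P v}) ≤ Q.comap f := by
    rw [Submodule.span_le]
    rintro _ ⟨v, hv, rfl⟩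
    exact h v hv
  exact this hc

theorem single_mem_tupleSupported {P : (Fin n → X) → Prop} {v : Fin n → X} (hv : P v) :
    Finsupp.single v (1 : ℤ) ∈ tupleSupported P :=
  Finsupp.single_mem_supported ℤ _ hv

theorem tupleSupported_mono {P Q : (Fin n → X) → Prop} (h : ∀ v, P v → Q v) :
    tupleSupported P ≤ tupleSupported Q :=
  Finsupp.supported_mono h

theorem tupleBoundary_mem_supported {S : Set X} {v : Fin (n + 1) → X} (hv : ∀ i, v i ∈ S) :
    tupleBoundary (Finsupp.single v 1) ∈ tupleSupported fun t : Fin n → X => ∀ i, t i ∈ S := by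
  rw [tupleBoundary_single]
  refine Submodule.sum_mem _ fun i _ => Submodule.smul_mem _ _ (single_mem_tupleSupported ?_)
  exact fun j => hv _

theorem tupleCone_mem_supported {S : Set X} {b : X} (hb : b ∈ S) {c : TupleChain n X}
    (hc : c ∈ tupleSupported fun t => ∀ i, t i ∈ S) :
    tupleCone b c ∈ tupleSupported fun t => ∀ i, t i ∈ S := by
  refine map_mem_of_tupleSupported (fun v hv => ?_) hc
  rw [tupleCone_single]
  refine single_mem_tupleSupported fun i => ?_
  refine Fin.cases ?_ (fun i => ?_) i
  · simpa using hb
  · simpa using hv i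

theorem tupleBary_mem {S : Set V} (hS : Convex ℝ S) {v : Fin (n + 1) → V} (hv : ∀ i, v i ∈ S) :
    tupleBary v ∈ S := by
  rw [tupleBary, Finset.smul_sum]
  refine hS.sum_mem (fun i _ => by positivity) ?_ (fun i _ => hv i)
  simp
  field_simp

theorem tupleSd_mem_supported {S : Set V} (hS : Convex ℝ S) {c : TupleChain n V}
    (hc : c ∈ tupleSupported fun t => ∀ i, t i ∈ S) :
    tupleSd n c ∈ tupleSupported fun t => ∀ i, t i ∈ S := by
  induction n with
  | zero => exact hc
  | succ n ih =>
    refine map_mem_of_tupleSupported (fun v hv => ?_) hc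
    rw [tupleSd_single]
    exact tupleCone_mem_supported (tupleBary_mem hS hv) (ih (tupleBoundary_mem_supported hv))

theorem tupleHtpy_mem_supported {S : Set V} (hS : Convex ℝ S) {c : TupleChain n V}
    (hc : c ∈ tupleSupported fun t => ∀ i, t i ∈ S) :
    tupleHtpy n c ∈ tupleSupported fun t => ∀ i, t i ∈ S := by
  induction n with
  | zero => simp [tupleHtpy]
  | succ n ih =>
    refine map_mem_of_tupleSupported (fun v hv => ?_) hc
    rw [tupleHtpy_single]
    exact tupleCone_mem_supported (tupleBary_mem hS hv)
      (Submodule.sub_mem _ (single_mem_tupleSupported hv) (ih (tupleBoundary_mem_supported hv)))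

end Tuples

section Mesh

variable {V : Type*} [NormedAddCommGroup V] [NormedSpace ℝ V] {n : ℕ}

theorem dist_tupleBary_le {v : Fin (n + 1) → V} {D : ℝ} (hv : ∀ i j, dist (v i) (v j) ≤ D)
    (i : Fin (n + 1)) : dist (v i) (tupleBary v) ≤ (1 - ((n + 1 : ℕ) : ℝ)⁻¹) * D := by
  have hpos : (0 : ℝ) < ((n + 1 : ℕ) : ℝ) := by positivity
  have h1 : v i - tupleBary v = ((n + 1 : ℕ) : ℝ)⁻¹ • ∑ j, (v i - v j) := by
    rw [tupleBary, Finset.sum_sub_distrib, smul_sub]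
    congr 1
    rw [Finset.sum_const, Finset.card_univ, Fintype.card_fin, ← Nat.cast_smul_eq_nsmul ℝ,
      smul_smul, inv_mul_cancel₀ hpos.ne', one_smul]
  rw [dist_eq_norm, h1, norm_smul, Real.norm_of_nonneg (by positivity)]
  have h2 : ‖∑ j, (v i - v j)‖ ≤ n * D := by
    rw [← Finset.sum_erase_add _ _ (Finset.mem_univ i), sub_self, add_zero]
    refine (norm_sum_le_of_le _ (fun j _ => ?_) : _ ≤ ∑ j ∈ Finset.univ.erase i, D).trans ?_
    · rw [← dist_eq_norm]; exact hv i j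
    · rw [Finset.sum_const, Finset.card_erase_of_mem (Finset.mem_univ i), Finset.card_univ,
        Fintype.card_fin]
      simp
  calc ((n + 1 : ℕ) : ℝ)⁻¹ * ‖∑ j, (v i - v j)‖ ≤ ((n + 1 : ℕ) : ℝ)⁻¹ * (n * D) := by gcongr
    _ = _ := by push_cast at hpos ⊢; field_simp; ring

theorem tupleSd_single_mesh (v : Fin n → V) {D : ℝ} (hv : ∀ i j, dist (v i) (v j) ≤ D) :
    tupleSd n (Finsupp.single v 1) ∈ tupleSupported fun t : Fin n → V =>
      (∀ i, t i ∈ convexHull ℝ (range v)) ∧ ∀ i j, dist (t i) (t j) ≤ (1 - (n : ℝ)⁻¹) * D := by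
  induction n with
  | zero => exact single_mem_tupleSupported ⟨fun i => i.elim0, fun i => i.elim0⟩
  | succ n ih =>
    have hD : 0 ≤ D := dist_nonneg.trans (hv 0 0)
    rw [tupleSd_single]
    have hcone : ∀ c ∈ tupleSupported (fun t : Fin n → V =>
        (∀ i, t i ∈ convexHull ℝ (range v)) ∧
          ∀ i j, dist (t i) (t j) ≤ (1 - ((n + 1 : ℕ) : ℝ)⁻¹) * D),
        tupleCone (tupleBary v) c ∈ tupleSupported fun t : Fin (n + 1) → V =>
        (∀ i, t i ∈ convexHull ℝ (range v)) ∧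
          ∀ i j, dist (t i) (t j) ≤ (1 - ((n + 1 : ℕ) : ℝ)⁻¹) * D := by
      intro c hc
      refine map_mem_of_tupleSupported (fun t ht => ?_) hc
      rw [tupleCone_single]
      have hb : tupleBary v ∈ convexHull ℝ (range v) :=
        tupleBary_mem (convex_convexHull ℝ _) fun i => subset_convexHull ℝ _ (mem_range_self i)
      have hball : convexHull ℝ (range v) ⊆
          Metric.closedBall (tupleBary v) ((1 - ((n + 1 : ℕ) : ℝ)⁻¹) * D) := by
        refine convexHull_min ?_ (convex_closedBall _ _)
        rintro _ ⟨i, rfl⟩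
        exact dist_tupleBary_le hv i
      refine single_mem_tupleSupported ⟨fun i => ?_, fun i j => ?_⟩
      · refine Fin.cases ?_ (fun i => ?_) i
        · simpa using hb
        · simpa using ht.1 i
      · have key : ∀ k, dist (t k) (tupleBary v) ≤ (1 - ((n + 1 : ℕ) : ℝ)⁻¹) * D :=
          fun k => hball (ht.1 k)
        refine Fin.cases ?_ (fun i => ?_) i <;> refine Fin.cases ?_ (fun j => ?_) j
        · simp only [dist_self]
          exact dist_nonneg.trans (hball hb)
        · simpa [dist_comm] using key j
        · simpa using key i
        · simpa using ht.2 i j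
    refine hcone _ ?_
    rw [tupleBoundary_single, map_sum]
    refine Submodule.sum_mem _ fun i _ => ?_
    rw [map_smul]
    refine Submodule.smul_mem _ _ (tupleSupported_mono ?_ (ih (v ∘ i.succAbove) fun a b => hv _ _))
    rintro t ⟨h1, h2⟩
    refine ⟨fun j => convexHull_mono (range_comp_subset_range _ _) (h1 j), fun a b =>
      (h2 a b).trans ?_⟩
    have hn : 0 < n := a.pos
    gcongr
    omega

theorem tupleSd_iterate_mesh {S : Set V} (hS : Convex ℝ S) {v : Fin n → V} (hvS : ∀ i, v i ∈ S)
    {D : ℝ} (hv : ∀ i j, dist (v i) (v j) ≤ D) (N : ℕ) :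
    (tupleSd n)^[N] (Finsupp.single v 1) ∈ tupleSupported fun t : Fin n → V =>
      (∀ i, t i ∈ S) ∧ ∀ i j, dist (t i) (t j) ≤ (1 - (n : ℝ)⁻¹) ^ N * D := by
  induction N with
  | zero => exact single_mem_tupleSupported ⟨hvS, by simpa using hv⟩
  | succ N ih =>
    rw [Function.iterate_succ_apply']
    refine map_mem_of_tupleSupported (fun t ht => ?_) ih
    refine tupleSupported_mono ?_ (tupleSd_single_mesh t ht.2)
    rintro u ⟨h1, h2⟩
    refine ⟨fun i => convexHull_min ?_ hS (h1 i), fun i j => (h2 i j).trans_eq (by ring)⟩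
    rintro _ ⟨i, rfl⟩
    exact ht.1 i

end Mesh

/-! ### The determinant cochain -/

section DetCochain

variable {m : ℕ}

/-- The cochain which evaluates to the sign of the tuple on permutations of the first `m + 1`
labels and to zero on the other tuples. -/
noncomputable def detCochain (m : ℕ) : TupleChain (m + 1) (Fin (m + 2)) →ₗ[ℤ] ℤ :=
  Finsupp.linearCombination ℤ fun t =>
    (Matrix.of fun a b : Fin (m + 1) => if t a = b.castSucc then (1 : ℤ) else 0).det

/-- The indicator matrix of a labelling, with the last column replaced by ones. -/
def labelMatrix (t : Fin (m + 2) → Fin (m + 2)) : Matrix (Fin (m + 2)) (Fin (m + 2)) ℤ :=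
  Matrix.of fun a b => if b = Fin.last (m + 1) then 1 else if t a = b then 1 else 0

theorem detCochain_boundary_single (t : Fin (m + 2) → Fin (m + 2)) :
    detCochain m (tupleBoundary (Finsupp.single t 1)) = (-1) ^ (m + 1) * (labelMatrix t).det := by
  rw [Matrix.det_succ_column _ (Fin.last (m + 1)), tupleBoundary_single, map_sum, Finset.mul_sum]
  refine Finset.sum_congr rfl fun i _ => ?_
  rw [map_smul, detCochain, Finsupp.linearCombination_single, one_smul, smul_eq_mul]
  have h1 : (labelMatrix t).submatrix i.succAbove (Fin.last (m + 1)).succAbove =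
      Matrix.of fun a b : Fin (m + 1) =>
        if (t ∘ i.succAbove) a = b.castSucc then (1 : ℤ) else 0 := by
    ext a b
    simp [labelMatrix, Fin.castSucc_ne_last]
  rw [h1]
  have h2 : labelMatrix t i (Fin.last (m + 1)) = 1 := by simp [labelMatrix]
  rw [h2, Fin.val_last, mul_one, ← mul_assoc, ← pow_add]
  congr 1
  rw [show m + 1 + (i.1 + (m + 1)) = i.1 + 2 * (m + 1) by ring, pow_add, pow_mul]
  simp

theorem detCochain_boundary_of_missing {t : Fin (m + 2) → Fin (m + 2)} {j : Fin (m + 2)}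
    (hj : ∀ a, t a ≠ j) : detCochain m (tupleBoundary (Finsupp.single t 1)) = 0 := by
  rw [detCochain_boundary_single]
  suffices h : (labelMatrix t).det = 0 by rw [h, mul_zero]
  by_cases hl : j = Fin.last (m + 1)
  · rw [← Matrix.exists_mulVec_eq_zero_iff]
    refine ⟨fun b => if b = Fin.last (m + 1) then -1 else 1, fun h => ?_, ?_⟩
    · have := congrFun h (Fin.last (m + 1))
      simp at this
    · funext a
      have ha : t a ≠ Fin.last (m + 1) := hl ▸ hj a
      obtain ⟨b, hb⟩ := Fin.exists_castSucc_eq.2 ha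
      simp only [Matrix.mulVec, dotProduct, labelMatrix, Matrix.of_apply, Pi.zero_apply]
      rw [Fin.sum_univ_castSucc]
      simp [Fin.castSucc_ne_last, ← hb, Fin.castSucc_inj]
  · refine Matrix.det_eq_zero_of_column_eq_zero j fun a => ?_
    simp [labelMatrix, hl, hj a]

theorem detCochain_boundary_id :
    detCochain m (tupleBoundary (Finsupp.single (id : Fin (m + 2) → Fin (m + 2)) 1)) ≠ 0 := by
  rw [detCochain_boundary_single]
  have : (labelMatrix (id : Fin (m + 2) → Fin (m + 2))).det = 1 := by
    rw [Matrix.det_of_isUpperTriangular]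
    · exact Finset.prod_eq_one fun i _ => by simp [labelMatrix]
    · intro a b hab
      simp only [id_eq] at hab
      have h1 : b ≠ Fin.last (m + 1) := ((hab).trans_le (Fin.le_last a)).ne
      simp [labelMatrix, h1, hab.ne']
  rw [this]
  simp

end DetCochain

/-! ### A criterion for a map not to induce zero in homology -/

section Sperner

variable {m : ℕ}

/-- The tuple of vertices of the standard simplex. -/
noncomputable abbrev stdVertices (n : ℕ) : Fin n → Fin n → ℝ := fun i => Pi.single i 1

theorem tupleMap_congr_of_supported {X Y : Type*} {n : ℕ} {S : Set X} {g g' : X → Y}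
    (h : ∀ x ∈ S, g x = g' x) {c : TupleChain n X} (hc : c ∈ tupleSupported fun t => ∀ i, t i ∈ S) :
    tupleMap g c = tupleMap g' c := by
  have : (tupleMap (n := n) g - tupleMap (n := n) g' : _ →ₗ[ℤ] _) c ∈ (⊥ : Submodule ℤ (TupleChain n Y)) := by
    refine map_mem_of_tupleSupported (fun v hv => ?_) hc
    have : g ∘ v = g' ∘ v := funext fun i => h _ (hv i)
    simp [tupleMap_single, this]
  simpa [sub_eq_zero] using this

theorem tupleSd_iterate_mem_supported {V : Type*} [AddCommGroup V] [Module ℝ V] {n : ℕ} {S : Set V}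
    (hS : Convex ℝ S) {c : TupleChain n V} (hc : c ∈ tupleSupported fun t => ∀ i, t i ∈ S) (N : ℕ) :
    (tupleSd n)^[N] c ∈ tupleSupported fun t => ∀ i, t i ∈ S := by
  induction N with
  | zero => exact hc
  | succ N ih => rw [Function.iterate_succ_apply']; exact tupleSd_mem_supported hS ih

theorem tupleBoundary_sd_iterate {V : Type*} [AddCommGroup V] [Module ℝ V] {n : ℕ}
    (c : TupleChain (n + 1) V) (N : ℕ) :
    tupleBoundary ((tupleSd (n + 1))^[N] c) = (tupleSd n)^[N] (tupleBoundary c) := by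
  induction N with
  | zero => rfl
  | succ N ih => rw [Function.iterate_succ_apply', Function.iterate_succ_apply', tupleBoundary_sd,
      ih]

theorem tupleMap_sd_iterate {V V' : Type*} [AddCommGroup V] [Module ℝ V] [AddCommGroup V']
    [Module ℝ V'] {n : ℕ} (A : V →ₗ[ℝ] V') (c : TupleChain n V) (N : ℕ) :
    tupleMap A ((tupleSd n)^[N] c) = (tupleSd n)^[N] (tupleMap A c) := by
  induction N with
  | zero => rfl
  | succ N ih => rw [Function.iterate_succ_apply', Function.iterate_succ_apply', tupleMap_sd, ih]

/-- The subdivided boundary of a simplex, as the sum of its subdivided faces. -/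
theorem sum_faces_tupleMap_sd {n : ℕ} {Y : Type*} (l : (Fin (n + 1) → ℝ) → Y)
    (l' : Fin (n + 1) → (Fin n → ℝ) → Y)
    (h : ∀ a, ∀ x ∈ stdSimplex ℝ (Fin n), l' a x = l (FunOnFinite.linearMap ℝ ℝ a.succAbove x))
    (N : ℕ) :
    ∑ a : Fin (n + 1), (-1 : ℤ) ^ (a : ℕ) •
        tupleMap (l' a) ((tupleSd n)^[N] (Finsupp.single (stdVertices n) 1)) =
      tupleMap l ((tupleSd n)^[N] (tupleBoundary (Finsupp.single (stdVertices (n + 1)) 1))) := by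
  have hit : ∀ c : TupleChain n (Fin (n + 1) → ℝ),
      (tupleSd n)^[N] c = ((tupleSd (V := Fin (n + 1) → ℝ) n) ^ N) c := fun c => by
    rw [Module.End.pow_apply]
  rw [tupleBoundary_single, hit, map_sum, map_sum]
  refine Finset.sum_congr rfl fun a _ => ?_
  rw [map_smul, map_smul, ← hit]
  congr 1
  rw [tupleMap_congr_of_supported (h a) (tupleSd_iterate_mem_supported (convex_stdSimplex ℝ _)
    (single_mem_tupleSupported fun i => single_mem_stdSimplex ℝ i) N)]
  change tupleMap (l ∘ _) _ = _
  rw [← tupleMap_comp, tupleMap_sd_iterate, tupleMap_single]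
  have hv : (FunOnFinite.linearMap ℝ ℝ a.succAbove) ∘ stdVertices n =
      stdVertices (n + 1) ∘ a.succAbove := by
    funext i
    simp [FunOnFinite.linearMap_piSingle]
  rw [hv]

/-- A form of Sperner's lemma. -/
theorem detCochain_sd_boundary_ne_zero (g : (Fin (m + 2) → ℝ) → Fin (m + 2))
    (hg : ∀ x ∈ stdSimplex ℝ (Fin (m + 2)), 0 < x (g x)) (N : ℕ) :
    detCochain m (tupleMap g ((tupleSd (m + 1))^[N]
      (tupleBoundary (Finsupp.single (stdVertices (m + 2)) 1)))) ≠ 0 := by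
  set S : Fin (m + 2) → Set (Fin (m + 2) → ℝ) := fun a => {x ∈ stdSimplex ℝ (Fin (m + 2)) | x a = 0}
  have hS : ∀ a, Convex ℝ (S a) := fun a => by
    intro x hx y hy s t hs ht hst
    refine ⟨convex_stdSimplex ℝ _ hx.1 hy.1 hs ht hst, ?_⟩
    simp [hx.2, hy.2]
  set c₀ := tupleBoundary (Finsupp.single (stdVertices (m + 2)) (1 : ℤ))
  have hc₀ : c₀ ∈ tupleSupported fun t : Fin (m + 1) → _ => ∃ a, ∀ i, t i ∈ S a := by
    rw [show c₀ = _ from tupleBoundary_single _]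
    refine Submodule.sum_mem _ fun a _ => Submodule.smul_mem _ _ (single_mem_tupleSupported
      ⟨a, fun i => ⟨single_mem_stdSimplex ℝ _, ?_⟩⟩)
    simp [Fin.ne_succAbove]
  have hsd : ∀ N, (tupleSd (m + 1))^[N] c₀ ∈
      tupleSupported fun t : Fin (m + 1) → _ => ∃ a, ∀ i, t i ∈ S a := by
    intro N
    induction N with
    | zero => exact hc₀
    | succ N ih =>
      rw [Function.iterate_succ_apply']
      refine map_mem_of_tupleSupported (fun v ⟨a, hv⟩ => ?_) ih
      exact tupleSupported_mono (fun t ht => ⟨a, ht⟩)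
        (tupleSd_mem_supported (hS a) (single_mem_tupleSupported hv))
  have hstep : ∀ N, detCochain m (tupleMap g ((tupleSd (m + 1))^[N + 1] c₀)) =
      detCochain m (tupleMap g ((tupleSd (m + 1))^[N] c₀)) := by
    intro N
    have h1 := tupleBoundary_htpy ((tupleSd (m + 1))^[N] c₀)
    have h2 : tupleBoundary ((tupleSd (m + 1))^[N] c₀) = 0 := by
      rw [tupleBoundary_sd_iterate, tupleBoundary_boundary]
      rw [← Module.End.pow_apply, map_zero]
    rw [h2, map_zero, sub_zero] at h1
    have h3 : tupleHtpy (m + 1) ((tupleSd (m + 1))^[N] c₀) ∈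
        tupleSupported fun t : Fin (m + 2) → _ => ∃ a, ∀ i, t i ∈ S a := by
      refine map_mem_of_tupleSupported (fun v ⟨a, hv⟩ => ?_) (hsd N)
      exact tupleSupported_mono (fun t ht => ⟨a, ht⟩)
        (tupleHtpy_mem_supported (hS a) (single_mem_tupleSupported hv))
    have h4 : ((detCochain m).comp (tupleBoundary.comp (tupleMap g)))
        (tupleHtpy (m + 1) ((tupleSd (m + 1))^[N] c₀)) ∈ (⊥ : Submodule ℤ ℤ) := by
      refine map_mem_of_tupleSupported (fun v ⟨a, hv⟩ => ?_) h3
      rw [Submodule.mem_bot, LinearMap.comp_apply, LinearMap.comp_apply, tupleMap_single]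
      refine detCochain_boundary_of_missing (j := a) fun i hi => ?_
      have := hg (v i) (hv i).1
      rw [show g (v i) = a from hi, (hv i).2] at this
      exact lt_irrefl _ this
    rw [Submodule.mem_bot, LinearMap.comp_apply, LinearMap.comp_apply, ← tupleMap_boundary, h1,
      map_sub, map_sub, sub_eq_zero] at h4
    rw [Function.iterate_succ_apply', h4]
  have hN : detCochain m (tupleMap g ((tupleSd (m + 1))^[N] c₀)) =
      detCochain m (tupleMap g c₀) := by
    induction N with
    | zero => rfl
    | succ N ih => rw [hstep, ih]
  rw [hN, tupleMap_boundary, tupleMap_single]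
  have : g ∘ stdVertices (m + 2) = id := by
    funext i
    by_contra hne
    have := hg _ (single_mem_stdSimplex ℝ i)
    rw [Pi.single_eq_of_ne (by exact hne)] at this
    exact lt_irrefl _ this
  rw [this]
  exact detCochain_boundary_id

end Sperner

section Singular

open CategoryTheory Limits AlgebraicTopology Simplicial

variable {m : ℕ}

/-- The labelling of a singular simplex that is induced by a labelling of the space. -/
noncomputable def simplexLabel {B : Type} [TopologicalSpace B] {k n : ℕ} (l : B → Fin (k + 1))
    (σ : C(stdSimplex ℝ (Fin n), B)) (x : Fin n → ℝ) : Fin (k + 1) :=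
  open Classical in if h : x ∈ stdSimplex ℝ (Fin n) then l (σ ⟨x, h⟩) else 0

theorem exists_detCochain_sd_eq_zero {B : Type} [TopologicalSpace B] (l : B → Fin (m + 2))
    {U : Fin (m + 2) → Set B} (hU : ∀ j, IsOpen (U j)) (hcov : ∀ x, ∃ j, x ∈ U j)
    (hl : ∀ j, ∀ x ∈ U j, l x ≠ j) (σ : C(stdSimplex ℝ (Fin (m + 2)), B)) :
    ∃ N₀, ∀ N ≥ N₀, detCochain m (tupleMap (simplexLabel l σ) ((tupleSd (m + 1))^[N]
      (tupleBoundary (Finsupp.single (stdVertices (m + 2)) 1)))) = 0 := by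
  obtain ⟨δ, hδ, hδU⟩ := lebesgue_number_lemma_of_metric (s := univ) (c := fun j => σ ⁻¹' U j)
    isCompact_univ (fun j => (hU j).preimage σ.continuous)
    (fun x _ => mem_iUnion.2 (hcov (σ x)))
  obtain ⟨N₀, hN₀⟩ := exists_pow_lt_of_lt_one hδ
    (show (1 : ℝ) - ((m + 2 : ℕ) : ℝ)⁻¹ < 1 by
      have : (0 : ℝ) < ((m + 2 : ℕ) : ℝ)⁻¹ := by positivity
      linarith)
  have h0 : (0 : ℝ) ≤ 1 - ((m + 2 : ℕ) : ℝ)⁻¹ := by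
    rw [sub_nonneg]
    exact inv_le_one_of_one_le₀ (by push_cast; linarith)
  refine ⟨N₀, fun N hN => ?_⟩
  have hlt : (1 - ((m + 2 : ℕ) : ℝ)⁻¹) ^ N < δ :=
    (pow_le_pow_of_le_one h0 (by simp; positivity) hN).trans_lt hN₀
  rw [← tupleBoundary_sd_iterate, tupleMap_boundary]
  have hmesh := tupleSd_iterate_mesh (convex_stdSimplex ℝ (Fin (m + 2)))
    (v := stdVertices (m + 2)) (fun i => single_mem_stdSimplex ℝ i) (D := 1) (fun i j =>
      (Metric.dist_le_diam_of_mem (bounded_stdSimplex _)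
        (single_mem_stdSimplex _ _) (single_mem_stdSimplex _ _)).trans diam_stdSimplex_le) N
  have h4 : ((detCochain m).comp (tupleBoundary.comp (tupleMap (simplexLabel l σ))))
      ((tupleSd (m + 2))^[N] (Finsupp.single (stdVertices (m + 2)) 1)) ∈ (⊥ : Submodule ℤ ℤ) := by
    refine map_mem_of_tupleSupported (fun v hv => ?_) hmesh
    rw [Submodule.mem_bot, LinearMap.comp_apply, LinearMap.comp_apply, tupleMap_single]
    obtain ⟨j, hj⟩ := hδU ⟨v 0, hv.1 0⟩ (mem_univ _)
    refine detCochain_boundary_of_missing (j := j) fun i => ?_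
    rw [Function.comp_apply, simplexLabel, dif_pos (hv.1 i)]
    refine hl j _ (hj ?_)
    rw [Metric.mem_ball, Subtype.dist_eq]
    exact ((hv.2 i 0).trans_eq (mul_one _)).trans_lt hlt
  simpa using h4

/-- If a map kills the homology class of a cycle, then the image of the cycle is a boundary. -/
theorem exists_boundary_of_homologyMap_eq_zero {K L : ChainComplex (ModuleCat.{0} ℤ) ℕ}
    (φ : K ⟶ L) {k : ℕ} (hφ : HomologicalComplex.homologyMap φ (k + 1) = 0)
    (z : ModuleCat.of ℤ ℤ ⟶ K.X (k + 1)) (hz : z ≫ K.d (k + 1) k = 0) :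
    ∃ w : L.X (k + 2), (L.d (k + 2) (k + 1)).hom w = (z ≫ φ.f (k + 1)).hom (1 : ℤ) := by
  have hn : (ComplexShape.down ℕ).next (k + 1) = k := by simp
  have hp : (ComplexShape.down ℕ).prev (k + 1) = k + 2 := by simp
  let zc := K.liftCycles z k hn hz
  have h1 : (zc ≫ HomologicalComplex.cyclesMap φ (k + 1)) ≫ L.homologyπ (k + 1) = 0 := by
    rw [Category.assoc, ← HomologicalComplex.homologyπ_naturality, hφ, comp_zero, comp_zero]
  let S : ShortComplex (ModuleCat.{0} ℤ) :=
    ShortComplex.mk (L.toCycles (k + 2) (k + 1)) (L.homologyπ (k + 1)) (by simp)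
  have hS : S.Exact := ShortComplex.exact_of_g_is_cokernel S (L.homologyIsCokernel _ _ hp)
  obtain ⟨w, hw⟩ := (ShortComplex.moduleCat_exact_iff S).1 hS
    ((zc ≫ HomologicalComplex.cyclesMap φ (k + 1)).hom (1 : ℤ)) (by
      have := congrArg (fun f => f.hom (1 : ℤ)) h1
      simpa using this)
  refine ⟨w, ?_⟩
  have h2 := congrArg (L.iCycles (k + 1)).hom hw
  have h3 : (L.toCycles (k + 2) (k + 1)) ≫ L.iCycles (k + 1) = L.d (k + 2) (k + 1) := by simp
  have h4 : (zc ≫ HomologicalComplex.cyclesMap φ (k + 1)) ≫ L.iCycles (k + 1) =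
      z ≫ φ.f (k + 1) := by simp [zc]
  rw [← h3, ← h4]
  exact h2


theorem toSSetObjEquiv_map {X Y : TopCat.{0}} (f : X ⟶ Y) {n : ℕ}
    (σ : (TopCat.toSSet.obj X) _⦋n⦌) (x : stdSimplex ℝ (Fin (n + 1))) :
    Y.toSSetObjEquiv (Opposite.op ⦋n⦌) ((TopCat.toSSet.map f).app _ σ) x =
      f (X.toSSetObjEquiv (Opposite.op ⦋n⦌) σ x) :=
  rfl

/-- A linear form on singular chains with prescribed values on simplices. -/
theorem exists_chain_form (X : SSet.{0}) (n : ℕ) (c : X _⦋n⦌ → ℤ) :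
    ∃ F : (X.chainComplex (ModuleCat.of ℤ ℤ)).X n ⟶ ModuleCat.of ℤ ℤ,
      ∀ x, X.ιChainComplex x ≫ F = c x • 𝟙 _ :=
  ⟨(X.isColimitChainComplexXCofan (ModuleCat.of ℤ ℤ) n).desc
    (Cofan.mk (ModuleCat.of ℤ ℤ) fun x => c x • 𝟙 (ModuleCat.of ℤ ℤ)),
    fun x => (X.isColimitChainComplexXCofan (ModuleCat.of ℤ ℤ) n).fac _ ⟨x⟩⟩

theorem chainComplex_mem_of_ι_mem (X : SSet.{0}) (n : ℕ)
    (Q : Submodule ℤ ((X.chainComplex (ModuleCat.of ℤ ℤ)).X n))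
    (hQ : ∀ x, (X.ιChainComplex x : ModuleCat.of ℤ ℤ ⟶ _).hom (1 : ℤ) ∈ Q) (w) : w ∈ Q := by
  let T : ModuleCat.{0} ℤ := @ModuleCat.of ℤ _ (_ ⧸ Q) _ (Submodule.Quotient.module Q)
  let q : (X.chainComplex (ModuleCat.of ℤ ℤ)).X n ⟶ T :=
    @ModuleCat.ofHom ℤ _ _ (_ ⧸ Q) _ _ _ (Submodule.Quotient.module Q) Q.mkQ
  have h0 : q = 0 := by
    refine SSet.chainComplex_hom_ext fun x => ?_
    rw [comp_zero]
    refine ConcreteCategory.hom_ext _ _ fun c => ?_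
    refine (Submodule.Quotient.mk_eq_zero Q).2 ?_
    have hc : ((X.ιChainComplex x : ModuleCat.of ℤ ℤ ⟶ _).hom c) =
        (X.ιChainComplex x : ModuleCat.of ℤ ℤ ⟶ _).hom ((c : ℤ) • (1 : ℤ)) := by
      rw [smul_eq_mul, mul_one]
    have hc' := hc.trans ((X.ιChainComplex x : ModuleCat.of ℤ ℤ ⟶ _).hom.map_smul c (1 : ℤ))
    exact hc'.symm ▸ Q.smul_mem c (hQ x)
  have h := congrArg (fun f : (X.chainComplex (ModuleCat.of ℤ ℤ)).X n ⟶ T => f.hom w) h0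
  exact (Submodule.Quotient.mk_eq_zero Q).1 h

theorem zsmul_id_hom_one (c : ℤ) : (c • 𝟙 (ModuleCat.of ℤ ℤ)).hom (1 : ℤ) = c := by
  rw [ModuleCat.hom_zsmul]
  exact mul_one c

/-- Let `B` have an open cover `U` and a labelling `l` such that the label `j` does not occur in
`U j`. A map to `B` is not zero in homology if it is defined on a space to which the boundary of the
standard simplex maps in such a way that the resulting labelling is Sperner. -/
theorem singularHomology_map_ne_zero {k : ℕ} {A B : TopCat.{0}} (i : A ⟶ B)
    (l : B → Fin (k + 3)) {U : Fin (k + 3) → Set B} (hU : ∀ j, IsOpen (U j))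
    (hcov : ∀ x, ∃ j, x ∈ U j) (hl : ∀ j, ∀ x ∈ U j, l x ≠ j)
    (ζ : (Fin (k + 3) → ℝ) → A)
    (hζ : ∀ a, ContinuousOn ζ {x | x ∈ stdSimplex ℝ (Fin (k + 3)) ∧ x a = 0})
    (hlζ : ∀ x ∈ stdSimplex ℝ (Fin (k + 3)), (∃ a, x a = 0) → 0 < x (l (i (ζ x)))) :
    ((singularHomologyFunctor (ModuleCat.{0} ℤ) (k + 1)).obj (ModuleCat.of ℤ ℤ)).map i ≠ 0 := by
  intro h0
  let R := ModuleCat.of ℤ ℤ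
  let KA := (TopCat.toSSet.obj A).chainComplex R
  let KB := (TopCat.toSSet.obj B).chainComplex R
  let φ : KA ⟶ KB := SSet.chainComplexMap (TopCat.toSSet.map i) R
  have hφ : HomologicalComplex.homologyMap φ (k + 1) = 0 := h0
  have hface : ∀ (a : Fin (k + 3)) (x : stdSimplex ℝ (Fin (k + 2))),
      (stdSimplex.map a.succAbove x).1 ∈ {x | x ∈ stdSimplex ℝ (Fin (k + 3)) ∧ x a = 0} := by
    intro a x
    refine ⟨(stdSimplex.map a.succAbove x).2, ?_⟩
    change FunOnFinite.linearMap ℝ ℝ a.succAbove x.1 a = 0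
    rw [FunOnFinite.linearMap_apply_apply]
    refine Finset.sum_eq_zero fun j hj => ?_
    exact absurd (Finset.mem_filter.1 hj).2 (Fin.succAbove_ne a j)
  -- the faces of the boundary of the simplex, as singular simplices of `A`
  let zf : Fin (k + 3) → C(stdSimplex ℝ (Fin (k + 2)), A) := fun a =>
    ⟨fun x => ζ (stdSimplex.map a.succAbove x).1, (hζ a).comp_continuous
      (continuous_subtype_val.comp (stdSimplex.continuous_map _)) (hface a)⟩
  let zs : Fin (k + 3) → (TopCat.toSSet.obj A) _⦋k + 1⦌ := fun a =>
    (A.toSSetObjEquiv (Opposite.op ⦋k + 1⦌)).symm (zf a)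
  let z : R ⟶ KA.X (k + 1) := ∑ a : Fin (k + 3), (-1 : ℤ) ^ a.val •
    (TopCat.toSSet.obj A).ιChainComplex (zs a)
  have hz : z ≫ KA.d (k + 1) k = 0 := by
    let A' : TopCat.{0} := @TopCat.of A ⊤
    let j : A ⟶ A' := @TopCat.ofHom A A _ ⊤ (@ContinuousMap.mk A A _ ⊤ id continuous_top)
    have hj : Mono j := (TopCat.mono_iff_injective j).2 fun x y h => h
    let KA' := (TopCat.toSSet.obj A').chainComplex R
    let ψ : KA ⟶ KA' := SSet.chainComplexMap (TopCat.toSSet.map j) R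
    have hψ : Mono ψ := by
      have : Mono (((singularChainComplexFunctor (ModuleCat.{0} ℤ)).obj R).map j) := inferInstance
      exact this
    have hψk : Mono (ψ.f k) := by
      have : Mono ((HomologicalComplex.eval _ _ k).map ψ) := inferInstance
      exact this
    let Z : (TopCat.toSSet.obj A') _⦋k + 2⦌ := (A'.toSSetObjEquiv (Opposite.op ⦋k + 2⦌)).symm
      (@ContinuousMap.mk _ A _ ⊤ (fun x : stdSimplex ℝ (Fin (k + 3)) => ζ x.1) continuous_top)
    have hzZ : z ≫ ψ.f (k + 1) = (TopCat.toSSet.obj A').ιChainComplex Z ≫ KA'.d (k + 2) (k + 1) := by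
      rw [SSet.ιChainComplex_d, Preadditive.sum_comp]
      refine Finset.sum_congr rfl fun a _ => ?_
      rw [Preadditive.zsmul_comp, SSet.ι_chainComplexMap_f]
      rfl
    rw [← cancel_mono (ψ.f k), zero_comp, Category.assoc, ← ψ.comm, ← Category.assoc, hzZ,
      Category.assoc, KA'.d_comp_d, comp_zero]
  obtain ⟨w, hw⟩ := exists_boundary_of_homologyMap_eq_zero φ hφ z hz
  -- the cochains obtained from subdivisions
  have hF := fun N : ℕ => exists_chain_form (TopCat.toSSet.obj B) (k + 1) fun σ =>
    detCochain (k + 1) (tupleMap (simplexLabel l (B.toSSetObjEquiv (Opposite.op ⦋k + 1⦌) σ))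
      ((tupleSd (k + 2))^[N] (Finsupp.single (stdVertices (k + 2)) 1)))
  choose F hF using hF
  let Q : Submodule ℤ (KB.X (k + 2)) :=
    { carrier := {w | ∃ N₀, ∀ N ≥ N₀, (F N).hom ((KB.d (k + 2) (k + 1)).hom w) = 0}
      add_mem' := by
        rintro a b ⟨N₁, h₁⟩ ⟨N₂, h₂⟩
        refine ⟨max N₁ N₂, fun N hN => ?_⟩
        rw [map_add, map_add, h₁ N (le_of_max_le_left hN), h₂ N (le_of_max_le_right hN), add_zero]
      zero_mem' := ⟨0, fun N _ => by rw [map_zero, map_zero]⟩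
      smul_mem' := by
        rintro c a ⟨N₁, h₁⟩
        refine ⟨N₁, fun N hN => ?_⟩
        exact (congrArg (F N).hom ((KB.d (k + 2) (k + 1)).hom.map_smul c a)).trans
          (((F N).hom.map_smul c _).trans ((congrArg (fun y : ℤ => c * y) (h₁ N hN)).trans
            (mul_zero c))) }
  obtain ⟨N, hN⟩ : w ∈ Q := by
    refine chainComplex_mem_of_ι_mem (TopCat.toSSet.obj B) (k + 2) Q (fun σ => ?_) w
    obtain ⟨N₀, hN₀⟩ := exists_detCochain_sd_eq_zero l hU hcov hl
      (B.toSSetObjEquiv (Opposite.op ⦋k + 2⦌) σ)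
    refine ⟨N₀, fun N hN => ?_⟩
    rw [← hN₀ N hN]
    rw [← sum_faces_tupleMap_sd (simplexLabel l _) (fun a => simplexLabel l
      (B.toSSetObjEquiv (Opposite.op ⦋k + 1⦌) ((TopCat.toSSet.obj B).δ a σ))) ?_ N, map_sum]
    · have h1 : (TopCat.toSSet.obj B).ιChainComplex (R := R) σ ≫ KB.d (k + 2) (k + 1) ≫ F N =
          (∑ a : Fin (k + 3), detCochain (k + 1) ((-1 : ℤ) ^ a.val • tupleMap (simplexLabel l
            (B.toSSetObjEquiv (Opposite.op ⦋k + 1⦌) ((TopCat.toSSet.obj B).δ a σ)))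
            ((tupleSd (k + 2))^[N] (Finsupp.single (stdVertices (k + 2)) 1)))) • 𝟙 R := by
        rw [← Category.assoc, SSet.ιChainComplex_d, Preadditive.sum_comp, Finset.sum_smul]
        refine Finset.sum_congr rfl fun a _ => ?_
        rw [Preadditive.zsmul_comp, hF, map_smul, smul_smul, smul_eq_mul]
      exact (congrArg (fun f : R ⟶ R => f.hom (1 : ℤ)) h1).trans (zsmul_id_hom_one _)
    · intro a x hx
      have hx' : FunOnFinite.linearMap ℝ ℝ a.succAbove x ∈ stdSimplex ℝ (Fin (k + 3)) :=
        (stdSimplex.map a.succAbove ⟨x, hx⟩).2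
      have h2 : simplexLabel l (B.toSSetObjEquiv (Opposite.op ⦋k + 2⦌) σ)
          (FunOnFinite.linearMap ℝ ℝ a.succAbove x) =
          l (B.toSSetObjEquiv (Opposite.op ⦋k + 2⦌) σ ⟨_, hx'⟩) := dif_pos hx'
      exact (dif_pos hx).trans h2.symm
  have hNz := hN N le_rfl
  rw [hw] at hNz
  let g : (Fin (k + 3) → ℝ) → Fin (k + 3) := fun x =>
    open Classical in if ∃ a, x a = 0 then l (i (ζ x)) else 0
  have hg : ∀ x ∈ stdSimplex ℝ (Fin (k + 3)), 0 < x (g x) := by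
    intro x hx
    by_cases h : ∃ a, x a = 0
    · simp only [g, if_pos h]
      exact hlζ x hx h
    · simp only [g, if_neg h]
      push Not at h
      exact lt_of_le_of_ne (hx.1 0) (h 0).symm
  apply detCochain_sd_boundary_ne_zero g hg N
  rw [← hNz, ← sum_faces_tupleMap_sd g (fun a => simplexLabel l
      (B.toSSetObjEquiv (Opposite.op ⦋k + 1⦌) ((TopCat.toSSet.map i).app _ (zs a)))) ?_ N, map_sum]
  · have h1 : z ≫ φ.f (k + 1) ≫ F N =
        (∑ a : Fin (k + 3), detCochain (k + 1) ((-1 : ℤ) ^ a.val • tupleMap (simplexLabel l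
          (B.toSSetObjEquiv (Opposite.op ⦋k + 1⦌) ((TopCat.toSSet.map i).app _ (zs a))))
          ((tupleSd (k + 2))^[N] (Finsupp.single (stdVertices (k + 2)) 1)))) • 𝟙 R := by
      rw [Preadditive.sum_comp, Finset.sum_smul]
      refine Finset.sum_congr rfl fun a _ => ?_
      rw [Preadditive.zsmul_comp, ← Category.assoc, SSet.ι_chainComplexMap_f, hF, map_smul,
        smul_smul, smul_eq_mul]
    exact ((congrArg (fun f : R ⟶ R => f.hom (1 : ℤ)) h1).trans (zsmul_id_hom_one _)).symm
  · intro a x hx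
    have hx' := hface a ⟨x, hx⟩
    rw [simplexLabel, dif_pos hx, toSSetObjEquiv_map]
    have : g (FunOnFinite.linearMap ℝ ℝ a.succAbove x) =
        l (i (ζ (FunOnFinite.linearMap ℝ ℝ a.succAbove x))) := if_pos ⟨a, hx'.2⟩
    rw [this, Equiv.apply_symm_apply]
    rfl

end Singular

/-! ### The conformal map and the coordinates of `ℝᵐ⁺² = ℝᵐ⁺¹ × ℝ` -/

section ConformalMap

variable {n : ℕ}

theorem norm_sph (x : Sph n) : ‖(x : EuclideanSpace ℝ (Fin (n + 1)))‖ = 1 := by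
  simp

theorem norm_conformalMap (p : SphR n) : ‖conformalMap p‖ = Real.exp p.2 := by
  rw [conformalMap, norm_smul, norm_sph, mul_one, Real.norm_of_nonneg (Real.exp_pos _).le]

theorem conformalMap_ne_zero (p : SphR n) : conformalMap p ≠ 0 := by
  rw [← norm_pos_iff, norm_conformalMap]
  exact Real.exp_pos _

theorem norm_normalize {E : Type*} [NormedAddCommGroup E] [NormedSpace ℝ E] {y : E} (hy : y ≠ 0) :
    ‖‖y‖⁻¹ • y‖ = 1 := by
  rw [norm_smul, norm_inv, norm_norm, inv_mul_cancel₀ (norm_ne_zero_iff.2 hy)]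

/-- The inverse of the conformal map. -/
noncomputable def conformalInv (y : EuclideanSpace ℝ (Fin (n + 1))) (hy : y ≠ 0) : SphR n :=
  (⟨‖y‖⁻¹ • y, by simpa using norm_normalize hy⟩, Real.log ‖y‖)

theorem conformalMap_conformalInv (y : EuclideanSpace ℝ (Fin (n + 1))) (hy : y ≠ 0) :
    conformalMap (conformalInv y hy) = y := by
  have : ‖y‖ ≠ 0 := norm_ne_zero_iff.2 hy
  simp only [conformalMap, conformalInv]
  rw [Real.exp_log (norm_pos_iff.2 hy), smul_smul, mul_inv_cancel₀ this, one_smul]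

theorem conformalMap_injective : Function.Injective (conformalMap (n := n)) := by
  intro p q h
  have h2 : p.2 = q.2 := by
    have := congrArg norm h
    rw [norm_conformalMap, norm_conformalMap] at this
    exact Real.exp_injective this
  refine Prod.ext (Subtype.ext ?_) h2
  rw [conformalMap, conformalMap, h2] at h
  exact smul_right_injective _ (Real.exp_pos _).ne' h

theorem conformalInv_conformalMap (p : SphR n) :
    conformalInv (conformalMap p) (conformalMap_ne_zero p) = p :=
  conformalMap_injective (conformalMap_conformalInv _ _)

theorem mem_totGeodCyl_iff {W : Submodule ℝ (EuclideanSpace ℝ (Fin (n + 1)))} {p : SphR n} :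
    p ∈ totGeodCyl W ↔ conformalMap p ∈ W :=
  (W.smul_mem_iff (Real.exp_pos _).ne').symm

theorem continuous_conformalMap : Continuous (conformalMap (n := n)) := by
  unfold conformalMap
  fun_prop

theorem continuous_conformalInv {X : Type*} [TopologicalSpace X]
    {Y : X → EuclideanSpace ℝ (Fin (n + 1))} (hc : Continuous Y) (hY : ∀ x, Y x ≠ 0) :
    Continuous fun x => conformalInv (Y x) (hY x) := by
  have hn : ∀ x, ‖Y x‖ ≠ 0 := fun x => norm_ne_zero_iff.2 (hY x)
  refine Continuous.prodMk (Continuous.subtype_mk ?_ _) ?_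
  · exact (hc.norm.inv₀ hn).smul hc
  · exact hc.norm.log hn

end ConformalMap

section Coordinates

variable {m : ℕ}

/-- The projection of `ℝᵐ⁺² = ℝᵐ⁺¹ × ℝ` onto the first factor. -/
noncomputable def initPart : EuclideanSpace ℝ (Fin (m + 1 + 1)) →L[ℝ] EuclideanSpace ℝ (Fin (m + 1)) :=
  LinearMap.toContinuousLinearMap
    { toFun := fun y => WithLp.toLp 2 fun i => y i.castSucc
      map_add' := fun _ _ => rfl
      map_smul' := fun _ _ => rfl }

/-- The linear map `(x, h) ↦ halfLinePoint x h` for `h = 0`. -/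
noncomputable def zeroHeight :
    EuclideanSpace ℝ (Fin (m + 1)) →ₗᵢ[ℝ] EuclideanSpace ℝ (Fin (m + 1 + 1)) where
  toFun x := halfLinePoint x 0
  map_add' x y := by
    ext i
    refine Fin.lastCases ?_ (fun i => ?_) i <;> simp [halfLinePoint]
  map_smul' c x := by
    ext i
    refine Fin.lastCases ?_ (fun i => ?_) i <;> simp [halfLinePoint]
  norm_map' x := by
    simp [EuclideanSpace.norm_eq, halfLinePoint, Fin.sum_univ_castSucc]

/-- The last vector of the standard basis. -/
noncomputable def lastVec (m : ℕ) : EuclideanSpace ℝ (Fin (m + 1 + 1)) :=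
  EuclideanSpace.single (Fin.last (m + 1)) 1

@[simp] theorem initPart_apply (y : EuclideanSpace ℝ (Fin (m + 1 + 1))) (i : Fin (m + 1)) :
    initPart y i = y i.castSucc := rfl

theorem zeroHeight_apply (x : EuclideanSpace ℝ (Fin (m + 1))) :
    zeroHeight x = halfLinePoint x 0 := rfl

@[simp] theorem zeroHeight_castSucc (x : EuclideanSpace ℝ (Fin (m + 1))) (i : Fin (m + 1)) :
    zeroHeight x i.castSucc = x i := by
  simp [zeroHeight_apply, halfLinePoint]

@[simp] theorem zeroHeight_last (x : EuclideanSpace ℝ (Fin (m + 1))) :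
    zeroHeight x (Fin.last (m + 1)) = 0 := by
  simp [zeroHeight_apply, halfLinePoint]

@[simp] theorem lastVec_castSucc (i : Fin (m + 1)) : lastVec m i.castSucc = 0 := by
  simp [lastVec, Fin.castSucc_ne_last]

@[simp] theorem lastVec_last : lastVec m (Fin.last (m + 1)) = 1 := by
  simp [lastVec]

@[simp] theorem initPart_zeroHeight (x : EuclideanSpace ℝ (Fin (m + 1))) :
    initPart (zeroHeight x) = x := by
  ext i
  simp

@[simp] theorem initPart_lastVec : initPart (lastVec m) = 0 := by
  ext i
  simp

theorem halfLinePoint_eq (x : EuclideanSpace ℝ (Fin (m + 1))) (h : ℝ) :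
    halfLinePoint x h = zeroHeight x + h • lastVec m := by
  ext i
  refine Fin.lastCases ?_ (fun i => ?_) i <;> simp [halfLinePoint]

theorem eq_zeroHeight_initPart_add (y : EuclideanSpace ℝ (Fin (m + 1 + 1))) :
    y = zeroHeight (initPart y) + y (Fin.last (m + 1)) • lastVec m := by
  ext i
  refine Fin.lastCases ?_ (fun i => ?_) i <;> simp

@[simp] theorem norm_lastVec : ‖lastVec m‖ = 1 := by simp [lastVec]

theorem inner_lastVec (y : EuclideanSpace ℝ (Fin (m + 1 + 1))) :
    ⟪y, lastVec m⟫ = y (Fin.last (m + 1)) := by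
  rw [lastVec, EuclideanSpace.inner_single_right]
  simp

@[simp] theorem inner_zeroHeight_lastVec (x : EuclideanSpace ℝ (Fin (m + 1))) :
    ⟪zeroHeight x, lastVec m⟫ = 0 := by
  rw [inner_lastVec, zeroHeight_last]

theorem norm_sq_zeroHeight_add (x : EuclideanSpace ℝ (Fin (m + 1))) (h : ℝ) :
    ‖zeroHeight x + h • lastVec m‖ ^ 2 = ‖x‖ ^ 2 + h ^ 2 := by
  rw [norm_add_sq_real, inner_smul_right, inner_zeroHeight_lastVec, norm_smul, norm_lastVec,
    zeroHeight.norm_map]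
  simp

theorem zeroHeight_add_ne_zero {x : EuclideanSpace ℝ (Fin (m + 1))} {h : ℝ}
    (hxh : x ≠ 0 ∨ h ≠ 0) : zeroHeight x + h • lastVec m ≠ 0 := by
  intro h0
  have h1 := norm_sq_zeroHeight_add x h
  rw [h0] at h1
  rcases hxh with hx | hh
  · have := norm_pos_iff.2 hx
    simp at h1
    nlinarith [sq_nonneg h]
  · have : 0 < h ^ 2 := by positivity
    simp at h1
    nlinarith [sq_nonneg ‖x‖]

theorem mem_sphereRH_iff {xbar : EuclideanSpace ℝ (Fin (m + 1))} {r h : ℝ}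
    {y : EuclideanSpace ℝ (Fin (m + 1 + 1))} :
    y ∈ sphereRH xbar r h ↔ ‖initPart y - xbar‖ = r ∧ y (Fin.last (m + 1)) = h := by
  have key : y (Fin.last (m + 1)) = h →
      ‖y - halfLinePoint xbar h‖ = ‖initPart y - xbar‖ := by
    intro hl
    have h1 : y - halfLinePoint xbar h = zeroHeight (initPart y - xbar) := by
      rw [halfLinePoint_eq, map_sub]
      conv_lhs => rw [eq_zeroHeight_initPart_add y, hl]
      abel
    rw [h1, zeroHeight.norm_map]
  constructor
  · rintro ⟨h1, h2⟩
    exact ⟨(key h2).symm.trans h1, h2⟩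
  · rintro ⟨h1, h2⟩
    exact ⟨(key h2).trans h1, h2⟩

theorem mem_MRH_iff {xbar : EuclideanSpace ℝ (Fin (m + 1))} {r h : ℝ} {p : SphR (m + 1)} :
    p ∈ MRH xbar r h ↔ ‖initPart (conformalMap p) - xbar‖ = r ∧
      conformalMap p (Fin.last (m + 1)) = h :=
  mem_sphereRH_iff

theorem conformalInv_mem_MRH {xbar v : EuclideanSpace ℝ (Fin (m + 1))} {h : ℝ}
    (hy : zeroHeight (xbar + v) + h • lastVec m ≠ 0) :
    conformalInv (zeroHeight (xbar + v) + h • lastVec m) hy ∈ MRH xbar ‖v‖ h := by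
  rw [mem_MRH_iff, conformalMap_conformalInv]
  constructor <;> simp

/-- A subspace containing `φ(M_{r,h})` contains `ℝᵐ⁺¹ × {0}`. -/
theorem zeroHeight_mem_of_MRH_subset {xbar : EuclideanSpace ℝ (Fin (m + 1))}
    {r h : ℝ} (hr : 0 < r) {W : Submodule ℝ (EuclideanSpace ℝ (Fin (m + 1 + 1)))}
    (hW : MRH xbar r h ⊆ totGeodCyl W) (w : EuclideanSpace ℝ (Fin (m + 1))) :
    zeroHeight w ∈ W := by
  have hmem : ∀ v : EuclideanSpace ℝ (Fin (m + 1)), ‖v‖ = r →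
      zeroHeight (xbar + v) + h • lastVec m ∈ W := by
    intro v hv
    by_cases h0 : zeroHeight (xbar + v) + h • lastVec m = 0
    · rw [h0]; exact W.zero_mem
    · have h1 := hW (hv ▸ conformalInv_mem_MRH (xbar := xbar) (v := v) h0)
      rwa [mem_totGeodCyl_iff, conformalMap_conformalInv] at h1
  by_cases hw : w = 0
  · rw [hw, map_zero]; exact W.zero_mem
  have hw' : ‖w‖ ≠ 0 := norm_ne_zero_iff.2 hw
  set v := (r / ‖w‖) • w
  have hv : ‖v‖ = r := by
    rw [norm_smul, norm_div, norm_norm, Real.norm_of_nonneg hr.le, div_mul_cancel₀ _ hw']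
  have h1 := W.sub_mem (hmem v hv) (hmem (-v) (by rwa [norm_neg]))
  have h2 : zeroHeight (xbar + v) + h • lastVec m - (zeroHeight (xbar + -v) + h • lastVec m) =
      (2 * (r / ‖w‖)) • zeroHeight w := by
    simp only [v, map_add, map_neg, map_smul]
    module
  rw [h2] at h1
  exact (W.smul_mem_iff (by positivity)).1 h1

theorem lastVec_mem_of_MRH_subset {xbar : EuclideanSpace ℝ (Fin (m + 1))} (hx : xbar ≠ 0)
    {r h : ℝ} (hr : 0 < r) (hh : h ≠ 0) {W : Submodule ℝ (EuclideanSpace ℝ (Fin (m + 1 + 1)))}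
    (hW : MRH xbar r h ⊆ totGeodCyl W) : lastVec m ∈ W := by
  obtain ⟨u, hu⟩ : ∃ u : EuclideanSpace ℝ (Fin (m + 1)), ‖u‖ = r :=
    ⟨(r / ‖xbar‖) • xbar, by
      rw [norm_smul, norm_div, norm_norm, Real.norm_of_nonneg hr.le,
        div_mul_cancel₀ _ (norm_ne_zero_iff.2 hx)]⟩
  have h0 : zeroHeight (xbar + u) + h • lastVec m ≠ 0 := zeroHeight_add_ne_zero (Or.inr hh)
  have h1 := hW (hu ▸ conformalInv_mem_MRH (xbar := xbar) (v := u) h0)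
  rwa [mem_totGeodCyl_iff, conformalMap_conformalInv,
    W.add_mem_iff_right (zeroHeight_mem_of_MRH_subset hr hW _), W.smul_mem_iff hh] at h1

theorem finrank_range_zeroHeight :
    finrank ℝ (LinearMap.range (zeroHeight (m := m)).toLinearMap) = m + 1 := by
  rw [LinearMap.finrank_range_of_inj zeroHeight.injective, finrank_euclideanSpace_fin]

theorem eq_range_zeroHeight_of_MRH_subset {xbar : EuclideanSpace ℝ (Fin (m + 1))}
    {r h : ℝ} (hr : 0 < r) {W : Submodule ℝ (EuclideanSpace ℝ (Fin (m + 1 + 1)))}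
    (hWm : finrank ℝ W = m + 1) (hW : MRH xbar r h ⊆ totGeodCyl W) :
    W = LinearMap.range (zeroHeight (m := m)).toLinearMap := by
  refine (Submodule.eq_of_le_of_finrank_eq ?_ ?_).symm
  · rintro _ ⟨w, rfl⟩
    exact zeroHeight_mem_of_MRH_subset hr hW w
  · rw [finrank_range_zeroHeight, hWm]

/-- `M_{r,h}` lies in a totally geodesic hypersurface `𝕊ᵐ × ℝ` if and only if `h = 0`. -/
theorem exists_totGeodCyl_iff {xbar : EuclideanSpace ℝ (Fin (m + 1))} (hx : xbar ≠ 0)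
    {r h : ℝ} (hr : 0 < r) :
    (∃ W : Submodule ℝ (EuclideanSpace ℝ (Fin (m + 1 + 1))),
      finrank ℝ W = m + 1 ∧ MRH xbar r h ⊆ totGeodCyl W) ↔ h = 0 := by
  constructor
  · rintro ⟨W, hWm, hW⟩
    by_contra hh
    have h1 := lastVec_mem_of_MRH_subset hx hr hh hW
    rw [eq_range_zeroHeight_of_MRH_subset hr hWm hW] at h1
    obtain ⟨w, hw⟩ := h1
    have := congrArg (fun y : EuclideanSpace ℝ (Fin (m + 1 + 1)) => y (Fin.last (m + 1))) hw
    simp at this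
  · rintro rfl
    refine ⟨_, finrank_range_zeroHeight, fun p hp => ?_⟩
    rw [mem_totGeodCyl_iff, eq_zeroHeight_initPart_add (conformalMap p), (mem_MRH_iff.1 hp).2,
      zero_smul, add_zero]
    exact ⟨_, rfl⟩

end Coordinates

/-! ### The homology class of `M_{r,0}` -/

section Homology

open CategoryTheory AlgebraicTopology

variable {m : ℕ}

/-- An inclusion that is homotopic to a constant map is zero in positive degrees. -/
theorem isNullHomologous_of_nullhomotopic {X : Type} [TopologicalSpace X] {k : ℕ} (hk : k ≠ 0)
    {A B : Set X} (hAB : A ⊆ B) (b : B)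
    (H : ContinuousMap.Homotopy (⟨Set.inclusion hAB, continuous_inclusion hAB⟩ : C(A, B))
      (ContinuousMap.const A b)) : IsNullHomologous k hAB := by
  let f : TopCat.of A ⟶ TopCat.of B :=
    TopCat.ofHom ⟨Set.inclusion hAB, continuous_inclusion hAB⟩
  let u : TopCat.of A ⟶ TopCat.of PUnit := TopCat.ofHom (ContinuousMap.const A PUnit.unit)
  let v : TopCat.of PUnit ⟶ TopCat.of B := TopCat.ofHom (ContinuousMap.const PUnit b)
  have H' : TopCat.Homotopy f (u ≫ v) := H
  have h1 := TopCat.Homotopy.congr_homologyMap_singularChainComplexFunctor H'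
    (ModuleCat.of ℤ ℤ : ModuleCat.{0} ℤ) k
  have h2 : ((singularHomologyFunctor (ModuleCat.{0} ℤ) k).obj (ModuleCat.of ℤ ℤ)).map f =
      ((singularHomologyFunctor (ModuleCat.{0} ℤ) k).obj (ModuleCat.of ℤ ℤ)).map (u ≫ v) := h1
  have h3 := isZero_singularHomologyFunctor_of_totallyDisconnectedSpace (ModuleCat.{0} ℤ) k
    (ModuleCat.of ℤ ℤ) (TopCat.of PUnit) hk
  have h4 : ((singularHomologyFunctor (ModuleCat.{0} ℤ) k).obj (ModuleCat.of ℤ ℤ)).map u = 0 :=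
    h3.eq_of_tgt _ _
  refine h2.trans ?_
  rw [Functor.map_comp, h4, Limits.zero_comp]

theorem isNullHomologous_MRH {xbar : EuclideanSpace ℝ (Fin (m + 1))} (hm : m ≠ 0) {r : ℝ}
    (hr : 0 < r) (hd : r < ‖xbar‖) {W : Submodule ℝ (EuclideanSpace ℝ (Fin (m + 1 + 1)))}
    (hW : MRH xbar r 0 ⊆ totGeodCyl W) : IsNullHomologous m hW := by
  have hWz := zeroHeight_mem_of_MRH_subset hr hW
  let Y : unitInterval × MRH xbar r 0 → EuclideanSpace ℝ (Fin (m + 1 + 1)) := fun q =>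
    (1 - (q.1 : ℝ)) • conformalMap q.2.1 + (q.1 : ℝ) • zeroHeight xbar
  have hYc : Continuous Y := by
    have := continuous_conformalMap (n := m + 1)
    fun_prop
  have hY : ∀ q, Y q ≠ 0 := by
    rintro ⟨t, p, hp⟩ h0
    have h1 : initPart (Y (t, ⟨p, hp⟩)) - xbar =
        (1 - (t : ℝ)) • (initPart (conformalMap p) - xbar) := by
      simp only [Y, map_add, map_smul, initPart_zeroHeight]
      module
    have h2 : ‖xbar‖ ≤ r := by
      have h3 := congrArg norm h1
      rw [h0, map_zero, zero_sub, norm_neg, norm_smul, (mem_MRH_iff.1 hp).1,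
        Real.norm_of_nonneg (sub_nonneg.2 t.2.2)] at h3
      nlinarith [t.2.1]
    exact absurd hd h2.not_gt
  have hYW : ∀ q, Y q ∈ W := fun q =>
    W.add_mem (W.smul_mem _ (mem_totGeodCyl_iff.1 (hW q.2.2))) (W.smul_mem _ (hWz _))
  have hx0 : zeroHeight xbar ≠ 0 := by
    rw [← norm_pos_iff, zeroHeight.norm_map]
    exact hr.trans hd
  let b : totGeodCyl W := ⟨conformalInv (zeroHeight xbar) hx0, by
    rw [mem_totGeodCyl_iff, conformalMap_conformalInv]; exact hWz _⟩
  have hYB : ∀ q, conformalInv (Y q) (hY q) ∈ totGeodCyl W := fun q => by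
    rw [mem_totGeodCyl_iff, conformalMap_conformalInv]; exact hYW q
  refine isNullHomologous_of_nullhomotopic hm hW b
    { toFun := fun q => ⟨conformalInv (Y q) (hY q), hYB q⟩
      continuous_toFun := (continuous_conformalInv hYc hY).subtype_mk hYB
      map_zero_left := fun p => ?_
      map_one_left := fun p => ?_ }
  · apply Subtype.ext
    apply conformalMap_injective
    simp [conformalMap_conformalInv, Y]
  · apply Subtype.ext
    apply conformalMap_injective
    simp [conformalMap_conformalInv, Y, b]

/-- The affine functions `b₀, …, b_{m+1}` on `ℝᵐ⁺¹` with sum zero. -/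
noncomputable def simplexForm (y : EuclideanSpace ℝ (Fin (m + 1))) (j : Fin (m + 2)) : ℝ :=
  Fin.lastCases (motive := fun _ => ℝ) (-∑ i, y i) (fun i => y i) j

theorem simplexForm_castSucc (y : EuclideanSpace ℝ (Fin (m + 1))) (i : Fin (m + 1)) :
    simplexForm y i.castSucc = y i := by simp [simplexForm]

theorem simplexForm_last (y : EuclideanSpace ℝ (Fin (m + 1))) :
    simplexForm y (Fin.last (m + 1)) = -∑ i, y i := by simp [simplexForm]

theorem sum_simplexForm (y : EuclideanSpace ℝ (Fin (m + 1))) : ∑ j, simplexForm y j = 0 := by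
  rw [Fin.sum_univ_castSucc, simplexForm_last]
  simp [simplexForm_castSucc]

theorem continuous_simplexForm (j : Fin (m + 2)) :
    Continuous fun y : EuclideanSpace ℝ (Fin (m + 1)) => simplexForm y j := by
  refine Fin.lastCases ?_ (fun i => ?_) j
  · simp only [simplexForm_last]; fun_prop
  · simp only [simplexForm_castSucc]; fun_prop

theorem simplexForm_smul (c : ℝ) (y : EuclideanSpace ℝ (Fin (m + 1))) (j : Fin (m + 2)) :
    simplexForm (c • y) j = c * simplexForm y j := by
  refine Fin.lastCases ?_ (fun i => ?_) j
  · simp [simplexForm_last, Finset.mul_sum]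
  · simp [simplexForm_castSucc]

theorem exists_simplexForm_pos {y : EuclideanSpace ℝ (Fin (m + 1))} (hy : y ≠ 0) :
    (∃ j, 0 < simplexForm y j) ∧ ∃ j, simplexForm y j < 0 := by
  have hne : ∃ j ∈ Finset.univ, simplexForm y j ≠ 0 := by
    by_contra! h
    apply hy
    ext i
    rw [← simplexForm_castSucc, h _ (Finset.mem_univ _)]
    rfl
  obtain ⟨j, -, hj⟩ := Finset.exists_pos_of_sum_zero_of_exists_nonzero _ (sum_simplexForm y) hne
  have hne' : ∃ j ∈ Finset.univ, -simplexForm y j ≠ 0 := by simpa using hne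
  obtain ⟨i, -, hi⟩ := Finset.exists_pos_of_sum_zero_of_exists_nonzero _
    (show ∑ j, -simplexForm y j = 0 by simp [sum_simplexForm]) hne'
  exact ⟨⟨j, hj⟩, ⟨i, by linarith⟩⟩

/-- The point of `ℝᵐ⁺¹` at which the forms take the values `x j - 1 / (m + 2)`. -/
noncomputable def simplexPoint (x : Fin (m + 2) → ℝ) : EuclideanSpace ℝ (Fin (m + 1)) :=
  WithLp.toLp 2 fun i => x i.castSucc - 1 / (m + 2)

theorem simplexForm_simplexPoint {x : Fin (m + 2) → ℝ} (hx : x ∈ stdSimplex ℝ (Fin (m + 2)))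
    (j : Fin (m + 2)) : simplexForm (simplexPoint x) j = x j - 1 / (m + 2) := by
  refine Fin.lastCases ?_ (fun i => ?_) j
  · have h := hx.2
    rw [Fin.sum_univ_castSucc] at h
    rw [simplexForm_last, simplexPoint]
    simp only [Finset.sum_sub_distrib, Finset.sum_const, Finset.card_univ, Fintype.card_fin,
      nsmul_eq_mul]
    push_cast
    field_simp
    linear_combination (-(m : ℝ) - 2) * h
  · simp [simplexForm_castSucc, simplexPoint]

theorem simplexPoint_ne_zero {x : Fin (m + 2) → ℝ} (hx : x ∈ stdSimplex ℝ (Fin (m + 2)))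
    {a : Fin (m + 2)} (ha : x a = 0) : simplexPoint x ≠ 0 := by
  intro h0
  have h1 := simplexForm_simplexPoint hx a
  have h2 := simplexForm_smul 0 (simplexPoint x) a
  rw [zero_smul, ← h0, h1, ha, zero_mul] at h2
  have : (0 : ℝ) < 1 / (m + 2) := by positivity
  linarith

/-- The positive factor that carries `y` to the sphere of centre `c` and radius `r > |c|`. -/
noncomputable def radialFactor (c : EuclideanSpace ℝ (Fin (m + 1))) (r : ℝ)
    (y : EuclideanSpace ℝ (Fin (m + 1))) : ℝ :=
  (⟪y, c⟫ + √(⟪y, c⟫ ^ 2 + ‖y‖ ^ 2 * (r ^ 2 - ‖c‖ ^ 2))) / ‖y‖ ^ 2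

theorem radialFactor_pos {c : EuclideanSpace ℝ (Fin (m + 1))} {r : ℝ} (hr : ‖c‖ < r)
    {y : EuclideanSpace ℝ (Fin (m + 1))} (hy : y ≠ 0) : 0 < radialFactor c r y := by
  have hy' := norm_pos_iff.2 hy
  have h1 : 0 < ‖y‖ ^ 2 * (r ^ 2 - ‖c‖ ^ 2) := by
    have := norm_nonneg c
    have : 0 < r ^ 2 - ‖c‖ ^ 2 := by nlinarith
    positivity
  have h2 : |⟪y, c⟫| < √(⟪y, c⟫ ^ 2 + ‖y‖ ^ 2 * (r ^ 2 - ‖c‖ ^ 2)) := by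
    rw [← Real.sqrt_sq_eq_abs]
    exact Real.sqrt_lt_sqrt (sq_nonneg _) (by linarith)
  have := neg_abs_le ⟪y, c⟫
  exact div_pos (by linarith) (by positivity)

theorem norm_radialFactor_smul_sub {c : EuclideanSpace ℝ (Fin (m + 1))} {r : ℝ} (hr : ‖c‖ < r)
    {y : EuclideanSpace ℝ (Fin (m + 1))} (hy : y ≠ 0) : ‖radialFactor c r y • y - c‖ = r := by
  have hr0 : 0 ≤ r := (norm_nonneg c).trans hr.le
  rw [← sq_eq_sq₀ (norm_nonneg _) hr0, norm_sub_sq_real, norm_smul, mul_pow, Real.norm_eq_abs,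
    sq_abs, real_inner_smul_left]
  have hy' := norm_pos_iff.2 hy
  have h1 : 0 ≤ ⟪y, c⟫ ^ 2 + ‖y‖ ^ 2 * (r ^ 2 - ‖c‖ ^ 2) := by
    have := norm_nonneg c
    have : 0 ≤ r ^ 2 - ‖c‖ ^ 2 := by nlinarith
    positivity
  have hs := Real.sq_sqrt h1
  rw [radialFactor]
  set s := √(⟪y, c⟫ ^ 2 + ‖y‖ ^ 2 * (r ^ 2 - ‖c‖ ^ 2))
  field_simp
  linear_combination hs

theorem continuousOn_radialFactor (c : EuclideanSpace ℝ (Fin (m + 1))) (r : ℝ) :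
    ContinuousOn (radialFactor c r) {y | y ≠ 0} := by
  unfold radialFactor
  refine ContinuousOn.div (by fun_prop) (by fun_prop) fun y hy => ?_
  exact pow_ne_zero 2 (norm_ne_zero_iff.2 hy)

theorem not_isNullHomologous_MRH {xbar : EuclideanSpace ℝ (Fin (m + 1))} (hm : m ≠ 0) {r : ℝ}
    (hr : 0 < r) (hd : ‖xbar‖ < r) {W : Submodule ℝ (EuclideanSpace ℝ (Fin (m + 1 + 1)))}
    (hWm : finrank ℝ W = m + 1) (hW : MRH xbar r 0 ⊆ totGeodCyl W) : ¬ IsNullHomologous m hW := by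
  obtain ⟨k, rfl⟩ := Nat.exists_eq_succ_of_ne_zero hm
  have hWr := eq_range_zeroHeight_of_MRH_subset hr hWm hW
  have hinit : ∀ p : totGeodCyl W, initPart (conformalMap p.1) ≠ 0 := by
    rintro ⟨p, hp⟩ h0
    rw [hWr, mem_totGeodCyl_iff] at hp
    obtain ⟨w, hw⟩ := hp
    have hw' : zeroHeight w = conformalMap p := hw
    rw [← hw', initPart_zeroHeight] at h0
    exact conformalMap_ne_zero p (by rw [← hw', h0, map_zero])
  have hcont : Continuous fun p : totGeodCyl W => initPart (conformalMap p.1) :=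
    initPart.continuous.comp (continuous_conformalMap.comp continuous_subtype_val)
  choose l hlpos using fun p => (exists_simplexForm_pos (hinit p)).1
  -- the radial projection of the boundary of a simplex
  let Y : EuclideanSpace ℝ (Fin (k + 1 + 1)) → EuclideanSpace ℝ (Fin (k + 1 + 1)) := fun y =>
    radialFactor xbar r y • y
  have hYne : ∀ y, y ≠ 0 → zeroHeight (xbar + (Y y - xbar)) + (0 : ℝ) • lastVec (k + 1) ≠ 0 := by
    intro y hy
    refine zeroHeight_add_ne_zero (Or.inl ?_)
    rw [add_sub_cancel]
    exact smul_ne_zero (radialFactor_pos hd hy).ne' hy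
  have hYmem : ∀ y (hy : y ≠ 0), conformalInv _ (hYne y hy) ∈ MRH xbar r 0 := by
    intro y hy
    have := conformalInv_mem_MRH (hYne y hy)
    rwa [show ‖Y y - xbar‖ = r from norm_radialFactor_smul_sub hd hy] at this
  have hone : ∃ y : EuclideanSpace ℝ (Fin (k + 1 + 1)), y ≠ 0 := exists_ne 0
  obtain ⟨y₀, hy₀⟩ := hone
  let ζ : (Fin (k + 1 + 2) → ℝ) → MRH xbar r 0 := fun x => open Classical in
    if h : simplexPoint x ≠ 0 then ⟨conformalInv _ (hYne _ h), hYmem _ h⟩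
    else ⟨conformalInv _ (hYne y₀ hy₀), hYmem y₀ hy₀⟩
  have hζ : ∀ x, simplexPoint x ≠ 0 →
      initPart (conformalMap (ζ x).1) = radialFactor xbar r (simplexPoint x) • simplexPoint x := by
    intro x hx
    simp only [ζ, dif_pos hx, conformalMap_conformalInv]
    simp [Y]
  refine singularHomology_map_ne_zero (k := k) (TopCat.ofHom ⟨Set.inclusion hW,
    continuous_inclusion hW⟩ : TopCat.of (MRH xbar r 0) ⟶ TopCat.of (totGeodCyl W)) l
    (U := fun j => {p | simplexForm (initPart (conformalMap p.1)) j < 0}) (fun j => ?_)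
    (fun p => (exists_simplexForm_pos (hinit p)).2) (fun j p hp h => ?_) ζ (fun a => ?_)
    (fun x hx ⟨a, ha⟩ => ?_)
  · exact isOpen_lt ((continuous_simplexForm j).comp hcont) continuous_const
  · have := hlpos p
    rw [h] at this
    exact lt_asymm this hp
  · have hsub : {x | x ∈ stdSimplex ℝ (Fin (k + 1 + 2)) ∧ x a = 0} ⊆
        {x : Fin (k + 1 + 2) → ℝ | simplexPoint x ≠ 0} := fun x hx => simplexPoint_ne_zero hx.1 hx.2
    refine ContinuousOn.mono ?_ hsub
    rw [continuousOn_iff_continuous_domRestrict]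
    have hsp : Continuous (simplexPoint (m := k + 1)) := by
      unfold simplexPoint
      fun_prop
    have hc : Continuous fun x : {x : Fin (k + 1 + 2) → ℝ | simplexPoint x ≠ 0} =>
        zeroHeight (xbar + (Y (simplexPoint x.1) - xbar)) + (0 : ℝ) • lastVec (k + 1) := by
      have hrad : Continuous fun x : {x : Fin (k + 1 + 2) → ℝ | simplexPoint x ≠ 0} =>
          radialFactor xbar r (simplexPoint x.1) :=
        (continuousOn_radialFactor xbar r).comp_continuous (hsp.comp continuous_subtype_val)
          fun x => x.2
      have hz := (zeroHeight (m := k + 1)).continuous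
      have hs := hsp.comp (continuous_subtype_val (p := fun x => simplexPoint x ≠ 0))
      exact (hz.comp (continuous_const.add ((hrad.smul hs).sub continuous_const))).add
        continuous_const
    have hc' := Continuous.subtype_mk (p := fun p => p ∈ MRH xbar r 0)
      (continuous_conformalInv hc fun x => hYne _ x.2) fun x => hYmem _ x.2
    refine hc'.congr fun x => ?_
    have hx : simplexPoint x.1 ≠ 0 := x.2
    have : ζ x.1 = ⟨conformalInv _ (hYne _ hx), hYmem _ hx⟩ := dif_pos hx
    exact this.symm
  · have hne := simplexPoint_ne_zero hx ha
    set p : totGeodCyl W := ⟨(ζ x).1, hW (ζ x).2⟩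
    have h1 : 0 < simplexForm (initPart (conformalMap (ζ x).1)) (l p) := hlpos p
    rw [hζ x hne, simplexForm_smul, simplexForm_simplexPoint hx] at h1
    have h2 := pos_of_mul_pos_right h1 (radialFactor_pos hd hne).le
    have : (0 : ℝ) < 1 / ((k + 1 : ℕ) + 2) := by positivity
    change 0 < x (l p)
    linarith

end Homology

/-! ### Isometries of `𝕊ⁿ × ℝ` and noncongruence -/

section Isometries

variable {n : ℕ}

/-- The distance of `𝕊ⁿ`. -/
noncomputable abbrev sphAngle (x y : Sph n) : ℝ :=
  InnerProductGeometry.angle (x : EuclideanSpace ℝ (Fin (n + 1))) y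

theorem riemDist_sq (p q : SphR n) :
    riemDist p q ^ 2 = sphAngle p.1 q.1 ^ 2 + (p.2 - q.2) ^ 2 :=
  Real.sq_sqrt (by positivity)

theorem IsAmbientIsometry.sq_eq {Ψ : SphR n ≃ SphR n} (hΨ : IsAmbientIsometry Ψ) (p q : SphR n) :
    sphAngle (Ψ p).1 (Ψ q).1 ^ 2 + ((Ψ p).2 - (Ψ q).2) ^ 2 =
      sphAngle p.1 q.1 ^ 2 + (p.2 - q.2) ^ 2 := by
  rw [← riemDist_sq, hΨ, riemDist_sq]

theorem sphAngle_self (x : Sph n) : sphAngle x x = 0 := by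
  refine InnerProductGeometry.angle_self ?_
  rw [← norm_pos_iff, norm_sph]
  exact one_pos

theorem eq_of_sphAngle_eq_zero {x y : Sph n} (h : sphAngle x y = 0) : x = y := by
  rw [sphAngle, InnerProductGeometry.angle_eq_zero_iff] at h
  obtain ⟨-, c, hc, h⟩ := h
  have h1 := congrArg norm h
  rw [norm_smul, norm_sph, norm_sph, mul_one, Real.norm_of_nonneg hc.le] at h1
  rw [← h1, one_smul] at h
  exact Subtype.ext h.symm

theorem IsAmbientIsometry.vertical {Ψ : SphR n ≃ SphR n} (hΨ : IsAmbientIsometry Ψ) (x : Sph n)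
    (s t : ℝ) : (Ψ (x, s)).1 = (Ψ (x, t)).1 ∧ ((Ψ (x, s)).2 - (Ψ (x, t)).2) ^ 2 = (s - t) ^ 2 := by
  have hline : ∀ u v, sphAngle (Ψ (x, u)).1 (Ψ (x, v)).1 ^ 2 +
      ((Ψ (x, u)).2 - (Ψ (x, v)).2) ^ 2 = (u - v) ^ 2 := fun u v => by
    have := hΨ.sq_eq (x, u) (x, v)
    rwa [sphAngle_self, zero_pow two_ne_zero, zero_add] at this
  set a := (Ψ (x, s)).2
  set b := (Ψ (x, t)).2
  have hle : |a - b| ≤ |s - t| := by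
    rw [← sq_le_sq]
    nlinarith [hline s t, sq_nonneg (sphAngle (Ψ (x, s)).1 (Ψ (x, t)).1)]
  have hge : |s - t| ≤ |a - b| := by
    by_contra! hlt
    set e := |s - t| - |a - b|
    have he : 0 < e := sub_pos.2 hlt
    set R := |s| + |t| + Real.pi ^ 2 / e + 1
    have hpe : 0 < Real.pi ^ 2 / e := div_pos (by positivity) he
    have hRs : 0 < R - s := by have := le_abs_self s; have := abs_nonneg t; simp only [R]; linarith
    have hRt : 0 < R - t := by have := le_abs_self t; have := abs_nonneg s; simp only [R]; linarith
    have h1 := hline R s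
    have h2 := hline R t
    set u := (Ψ (x, R)).2
    set θ₁ := sphAngle (Ψ (x, R)).1 (Ψ (x, s)).1
    set θ₂ := sphAngle (Ψ (x, R)).1 (Ψ (x, t)).1
    have hθ₁ : θ₁ ^ 2 ≤ Real.pi ^ 2 :=
      pow_le_pow_left₀ (InnerProductGeometry.angle_nonneg _ _) (InnerProductGeometry.angle_le_pi _ _) 2
    have hθ₂ : θ₂ ^ 2 ≤ Real.pi ^ 2 :=
      pow_le_pow_left₀ (InnerProductGeometry.angle_nonneg _ _) (InnerProductGeometry.angle_le_pi _ _) 2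
    have hua : |u - a| ≤ R - s := by
      rw [← abs_of_pos hRs, ← sq_le_sq]; nlinarith [sq_nonneg θ₁]
    have hub : |u - b| ≤ R - t := by
      rw [← abs_of_pos hRt, ← sq_le_sq]; nlinarith [sq_nonneg θ₂]
    have h3 : (a - b) * ((u - a) + (u - b)) =
        (s - t) * ((R - s) + (R - t)) + θ₁ ^ 2 - θ₂ ^ 2 := by
      linear_combination h2 - h1
    have h4 : |s - t| * ((R - s) + (R - t)) ≤ |a - b| * ((R - s) + (R - t)) + Real.pi ^ 2 := by
      calc |s - t| * ((R - s) + (R - t)) = |(s - t) * ((R - s) + (R - t))| := by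
            rw [abs_mul, abs_of_pos (add_pos hRs hRt)]
        _ = |(a - b) * ((u - a) + (u - b)) + (θ₂ ^ 2 - θ₁ ^ 2)| := by rw [h3]; ring_nf
        _ ≤ |(a - b) * ((u - a) + (u - b))| + |θ₂ ^ 2 - θ₁ ^ 2| := abs_add_le _ _
        _ ≤ |a - b| * ((R - s) + (R - t)) + Real.pi ^ 2 := by
            rw [abs_mul]
            gcongr
            · exact (abs_add_le _ _).trans (add_le_add hua hub)
            · rw [abs_le]; constructor <;> nlinarith [sq_nonneg θ₁, sq_nonneg θ₂]
    have h5 : e * ((R - s) + (R - t)) ≤ Real.pi ^ 2 := by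
      simp only [e]; linarith
    have h6 : Real.pi ^ 2 / e < (R - s) + (R - t) := by
      have := le_abs_self s; have := le_abs_self t; have := abs_nonneg s; have := abs_nonneg t
      simp only [R]; linarith
    rw [div_lt_iff₀ he] at h6
    linarith
  have hsq : (a - b) ^ 2 = (s - t) ^ 2 := by
    rw [← sq_abs, ← sq_abs (s - t), le_antisymm hle hge]
  refine ⟨eq_of_sphAngle_eq_zero ?_, hsq⟩
  have := hline s t
  rw [hsq] at this
  exact pow_eq_zero_iff two_ne_zero |>.1 (by linarith)

/-- The isometries of `𝕊ⁿ × ℝ` are products of isometries of the factors. -/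
theorem IsAmbientIsometry.exists_split {Ψ : SphR n ≃ SphR n} (hΨ : IsAmbientIsometry Ψ) :
    ∃ (A : Sph n → Sph n) (ε c : ℝ), (ε = 1 ∨ ε = -1) ∧
      (∀ x y, sphAngle (A x) (A y) = sphAngle x y) ∧ ∀ x t, Ψ (x, t) = (A x, ε * t + c) := by
  set A : Sph n → Sph n := fun x => (Ψ (x, 0)).1
  set c : Sph n → ℝ := fun x => (Ψ (x, 0)).2
  set ε : Sph n → ℝ := fun x => (Ψ (x, 1)).2 - (Ψ (x, 0)).2
  have hε : ∀ x, ε x ^ 2 = 1 := fun x => by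
    have := (hΨ.vertical x 1 0).2
    simpa using this
  have hform : ∀ x t, Ψ (x, t) = (A x, ε x * t + c x) := by
    intro x t
    refine Prod.ext (hΨ.vertical x t 0).1 ?_
    have h1 := (hΨ.vertical x t 0).2
    have h2 := (hΨ.vertical x t 1).2
    have h3 := hε x
    simp only [ε, c] at h3 ⊢
    nlinarith
  have hpair : ∀ x y t s, sphAngle (A x) (A y) ^ 2 + (ε x * t + c x - (ε y * s + c y)) ^ 2 =
      sphAngle x y ^ 2 + (t - s) ^ 2 := fun x y t s => by
    have := hΨ.sq_eq (x, t) (y, s)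
    rwa [hform, hform] at this
  have hεε : ∀ x y, ε x = ε y := by
    intro x y
    have h1 := hpair x y 1 1
    have h2 := hpair x y (-1) (-1)
    have h3 := hpair x y 1 (-1)
    have h4 := hpair x y (-1) 1
    have h5 : ε x * ε y = 1 := by nlinarith
    have := hε y
    calc ε x = ε x * ε y ^ 2 := by rw [this, mul_one]
      _ = ε x * ε y * ε y := by ring
      _ = ε y := by rw [h5, one_mul]
  have hcc : ∀ x y, c x = c y := by
    intro x y
    have h1 := hpair x y 1 0
    have h2 := hpair x y (-1) 0
    have h3 : ε x * (c x - c y) = 0 := by nlinarith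
    rcases mul_eq_zero.1 h3 with h | h
    · have := hε x; rw [h] at this; norm_num at this
    · linarith
  obtain ⟨x₀⟩ : Nonempty (Sph n) := by
    refine ⟨⟨EuclideanSpace.single 0 1, ?_⟩⟩
    simp
  refine ⟨A, ε x₀, c x₀, mul_self_eq_one_iff.1 (by rw [← sq]; exact hε x₀), fun x y => ?_, fun x t => ?_⟩
  · have := hpair x y 0 0
    rw [hcc x y] at this
    refine (sq_eq_sq₀ (InnerProductGeometry.angle_nonneg _ _)
      (InnerProductGeometry.angle_nonneg _ _)).1 ?_
    linarith [this]
  · rw [hform, hεε x x₀, hcc x x₀]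

theorem AreCongruent.symm {A B : Set (SphR n)} (h : AreCongruent A B) : AreCongruent B A := by
  obtain ⟨Ψ, hΨ, h⟩ := h
  refine ⟨Ψ.symm, fun p q => ?_, ?_⟩
  · have := hΨ (Ψ.symm p) (Ψ.symm q)
    simpa using this.symm
  · rw [← h, ← image_comp]
    simp

end Isometries

section Noncongruence

variable {m : ℕ} {xbar : EuclideanSpace ℝ (Fin (m + 1))} {r h : ℝ}

theorem exp_height_sq_of_mem_MRH {p : SphR (m + 1)} (hp : p ∈ MRH xbar r h) :
    Real.exp p.2 ^ 2 = ‖initPart (conformalMap p)‖ ^ 2 + h ^ 2 := by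
  rw [← norm_conformalMap]
  conv_lhs => rw [eq_zeroHeight_initPart_add (conformalMap p), (mem_MRH_iff.1 hp).2]
  exact norm_sq_zeroHeight_add _ _

theorem norm_sq_of_norm_sub_eq (hx : xbar ≠ 0) {s : ℝ} (hs : s ≠ 0)
    {q : EuclideanSpace ℝ (Fin (m + 1))} (hq : ‖q - xbar‖ ^ 2 = s ^ 2) :
    ‖q‖ ^ 2 = (‖xbar‖ + s) ^ 2 - ‖xbar‖ / s * ‖q - (1 + s / ‖xbar‖) • xbar‖ ^ 2 := by
  have hd : ‖xbar‖ ≠ 0 := norm_ne_zero_iff.2 hx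
  rw [norm_sub_sq_real] at hq ⊢
  rw [norm_smul, real_inner_smul_right, mul_pow, Real.norm_eq_abs, sq_abs]
  field_simp
  linear_combination (‖xbar‖ + s) * hq

/-- The highest (`s = r`) and the lowest (`s = -r`) point of `M_{r,h}`. -/
theorem extremal_mem_MRH (hx : xbar ≠ 0) {s : ℝ}
    (hne : zeroHeight ((1 + s / ‖xbar‖) • xbar) + h • lastVec m ≠ 0) :
    conformalInv _ hne ∈ MRH xbar |s| h := by
  rw [mem_MRH_iff, conformalMap_conformalInv]
  have hd : ‖xbar‖ ≠ 0 := norm_ne_zero_iff.2 hx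
  constructor
  · have : (1 + s / ‖xbar‖) • xbar - xbar = (s / ‖xbar‖) • xbar := by module
    simp only [map_add, map_smul, initPart_zeroHeight, initPart_lastVec, smul_zero, add_zero, this]
    rw [norm_smul, norm_div, norm_norm, Real.norm_eq_abs, div_mul_cancel₀ _ hd]
  · simp

theorem exp_conformalInv_snd {n : ℕ} {y : EuclideanSpace ℝ (Fin (n + 1))} (hy : y ≠ 0) :
    Real.exp (conformalInv y hy).2 = ‖y‖ :=
  Real.exp_log (norm_pos_iff.2 hy)

theorem norm_sq_extremal (hx : xbar ≠ 0) (s h : ℝ) :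
    ‖zeroHeight ((1 + s / ‖xbar‖) • xbar) + h • lastVec m‖ ^ 2 = (‖xbar‖ + s) ^ 2 + h ^ 2 := by
  have hd : ‖xbar‖ ≠ 0 := norm_ne_zero_iff.2 hx
  rw [norm_sq_zeroHeight_add, norm_smul, mul_pow, Real.norm_eq_abs, sq_abs]
  field_simp

theorem height_le_top (hx : xbar ≠ 0) (hr : 0 < r)
    (hne : zeroHeight ((1 + r / ‖xbar‖) • xbar) + h • lastVec m ≠ 0) {p : SphR (m + 1)}
    (hp : p ∈ MRH xbar r h) : p.2 ≤ (conformalInv _ hne).2 ∧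
      ((conformalInv _ hne).2 ≤ p.2 → p = conformalInv _ hne) := by
  have h1 := exp_height_sq_of_mem_MRH hp
  have h2 := norm_sq_of_norm_sub_eq hx hr.ne' (by rw [(mem_MRH_iff.1 hp).1])
  have h3 := norm_sq_extremal hx r h
  rw [← exp_conformalInv_snd hne] at h3
  have hpos : 0 < ‖xbar‖ / r := div_pos (norm_pos_iff.2 hx) hr
  have hkey : Real.exp p.2 ^ 2 + ‖xbar‖ / r *
      ‖initPart (conformalMap p) - (1 + r / ‖xbar‖) • xbar‖ ^ 2 =
      Real.exp (conformalInv _ hne).2 ^ 2 := by linarith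
  constructor
  · rw [← Real.exp_le_exp, ← sq_le_sq₀ (Real.exp_pos _).le (Real.exp_pos _).le]
    nlinarith [sq_nonneg ‖initPart (conformalMap p) - (1 + r / ‖xbar‖) • xbar‖]
  · intro hle
    rw [← Real.exp_le_exp, ← sq_le_sq₀ (Real.exp_pos _).le (Real.exp_pos _).le] at hle
    have h4 : ‖initPart (conformalMap p) - (1 + r / ‖xbar‖) • xbar‖ ^ 2 = 0 := by
      nlinarith [sq_nonneg ‖initPart (conformalMap p) - (1 + r / ‖xbar‖) • xbar‖]
    rw [sq_eq_zero_iff, norm_eq_zero, sub_eq_zero] at h4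
    apply conformalMap_injective
    rw [conformalMap_conformalInv, eq_zeroHeight_initPart_add (conformalMap p), h4,
      (mem_MRH_iff.1 hp).2]

theorem bot_le_height (hx : xbar ≠ 0) (hr : 0 < r)
    (hne : zeroHeight ((1 + -r / ‖xbar‖) • xbar) + h • lastVec m ≠ 0) {p : SphR (m + 1)}
    (hp : p ∈ MRH xbar r h) : (conformalInv _ hne).2 ≤ p.2 ∧
      (p.2 ≤ (conformalInv _ hne).2 → p = conformalInv _ hne) := by
  have h1 := exp_height_sq_of_mem_MRH hp
  have h2 := norm_sq_of_norm_sub_eq hx (neg_ne_zero.2 hr.ne')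
    (q := initPart (conformalMap p)) (by rw [(mem_MRH_iff.1 hp).1, neg_sq])
  have h3 := norm_sq_extremal hx (-r) h
  rw [← exp_conformalInv_snd hne] at h3
  have hpos : 0 < ‖xbar‖ / r := div_pos (norm_pos_iff.2 hx) hr
  rw [div_neg] at h2
  have hkey : Real.exp p.2 ^ 2 = Real.exp (conformalInv _ hne).2 ^ 2 + ‖xbar‖ / r *
      ‖initPart (conformalMap p) - (1 + -r / ‖xbar‖) • xbar‖ ^ 2 := by linarith
  constructor
  · rw [← Real.exp_le_exp, ← sq_le_sq₀ (Real.exp_pos _).le (Real.exp_pos _).le]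
    nlinarith [sq_nonneg ‖initPart (conformalMap p) - (1 + -r / ‖xbar‖) • xbar‖]
  · intro hle
    rw [← Real.exp_le_exp, ← sq_le_sq₀ (Real.exp_pos _).le (Real.exp_pos _).le] at hle
    have h4 : ‖initPart (conformalMap p) - (1 + -r / ‖xbar‖) • xbar‖ ^ 2 = 0 := by
      nlinarith [sq_nonneg ‖initPart (conformalMap p) - (1 + -r / ‖xbar‖) • xbar‖]
    rw [sq_eq_zero_iff, norm_eq_zero, sub_eq_zero] at h4
    apply conformalMap_injective
    rw [conformalMap_conformalInv, eq_zeroHeight_initPart_add (conformalMap p), h4,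
      (mem_MRH_iff.1 hp).2]

theorem extremal_ne_zero (hx : xbar ≠ 0) {s h : ℝ} (hne : ‖xbar‖ + s ≠ 0 ∨ h ≠ 0) :
    zeroHeight ((1 + s / ‖xbar‖) • xbar) + h • lastVec m ≠ 0 := by
  intro h0
  have h1 := norm_sq_extremal hx s h
  rw [h0, norm_zero, zero_pow two_ne_zero] at h1
  rcases hne with h2 | h2
  · have : 0 < (‖xbar‖ + s) ^ 2 := by positivity
    nlinarith [sq_nonneg h]
  · have : 0 < h ^ 2 := by positivity
    nlinarith [sq_nonneg (‖xbar‖ + s)]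

theorem norm_sq_conformalMap_sub {n : ℕ} (p q : SphR n) :
    ‖conformalMap p - conformalMap q‖ ^ 2 =
      Real.exp p.2 ^ 2 + Real.exp q.2 ^ 2 -
        2 * (Real.exp p.2 * Real.exp q.2 * Real.cos (sphAngle p.1 q.1)) := by
  rw [norm_sub_sq_real, norm_conformalMap, norm_conformalMap, conformalMap, conformalMap,
    real_inner_smul_left, real_inner_smul_right, InnerProductGeometry.cos_angle, norm_sph, norm_sph]
  ring

theorem exists_unit_orthogonal {k : ℕ} (hk : k ≠ 0) {v : EuclideanSpace ℝ (Fin (k + 1))}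
    (hv : v ≠ 0) : ∃ w : EuclideanSpace ℝ (Fin (k + 1)), ‖w‖ = 1 ∧ ⟪v, w⟫ = 0 := by
  have h1 : finrank ℝ (Submodule.span ℝ {v})ᗮ = k :=
    Submodule.finrank_orthogonal_span_singleton hv
  have h2 : 0 < finrank ℝ (Submodule.span ℝ {v})ᗮ := by omega
  obtain ⟨⟨w, hw⟩, hw0⟩ := finrank_pos_iff_exists_ne_zero.1 h2
  have hw0' : w ≠ 0 := fun h => hw0 (Subtype.ext h)
  refine ⟨‖w‖⁻¹ • w, norm_normalize hw0', ?_⟩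
  rw [real_inner_smul_right, Submodule.mem_orthogonal_singleton_iff_inner_right.1 hw, mul_zero]

/-- The submanifold `M_{d,0}` is not bounded from below. -/
theorem exists_height_lt (hm : m ≠ 0) (hx : xbar ≠ 0) (C : ℝ) :
    ∃ p ∈ MRH xbar ‖xbar‖ 0, p.2 < C := by
  obtain ⟨w, hw, hxw⟩ := exists_unit_orthogonal hm hx
  have hd := norm_pos_iff.2 hx
  have hC := Real.exp_pos C
  set k := 2 * ‖xbar‖ ^ 2 / Real.exp C
  have hk : 0 < k := by positivity
  set y := xbar + k • w
  have hy2 : ‖y‖ ^ 2 = ‖xbar‖ ^ 2 + k ^ 2 := by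
    rw [norm_add_sq_real, real_inner_smul_right, hxw, norm_smul, hw, Real.norm_eq_abs]
    simp
  have hyx : ⟪y, xbar⟫ = ‖xbar‖ ^ 2 := by
    rw [inner_add_left, real_inner_smul_left, real_inner_comm, real_inner_self_eq_norm_sq,
      real_inner_comm, hxw]
    ring
  have hy : 0 < ‖y‖ := by
    by_contra h0
    have : ‖y‖ = 0 := le_antisymm (not_lt.1 h0) (norm_nonneg _)
    rw [this] at hy2
    nlinarith
  have hky : k < ‖y‖ := by
    rw [← sq_lt_sq₀ hk.le hy.le, hy2]
    have : 0 < ‖xbar‖ ^ 2 := by positivity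
    linarith
  set q := (2 * ‖xbar‖ ^ 2 / ‖y‖ ^ 2) • y
  have hqn : ‖q‖ = 2 * ‖xbar‖ ^ 2 / ‖y‖ := by
    rw [norm_smul, Real.norm_of_nonneg (by positivity)]
    field_simp
  have hq : ‖q - xbar‖ = ‖xbar‖ := by
    rw [← sq_eq_sq₀ (norm_nonneg _) (norm_nonneg _), norm_sub_sq_real, hqn, real_inner_smul_left,
      hyx]
    field_simp
    ring
  have hq0 : q ≠ 0 := by
    rw [← norm_pos_iff, hqn]
    positivity
  have hne : zeroHeight (xbar + (q - xbar)) + (0 : ℝ) • lastVec m ≠ 0 :=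
    zeroHeight_add_ne_zero (Or.inl (by rwa [add_sub_cancel]))
  refine ⟨conformalInv _ hne, hq ▸ conformalInv_mem_MRH hne, ?_⟩
  rw [← Real.exp_lt_exp, exp_conformalInv_snd, zero_smul, add_zero, zeroHeight.norm_map,
    add_sub_cancel, hqn, div_lt_iff₀ hy]
  calc 2 * ‖xbar‖ ^ 2 = Real.exp C * k := by simp only [k]; field_simp
    _ < Real.exp C * ‖y‖ := by gcongr

theorem add_neg_ne_zero_or {d r h : ℝ} (hrh : (r, h) ≠ (d, 0)) : d + -r ≠ 0 ∨ h ≠ 0 := by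
  by_contra! h0
  exact hrh (Prod.ext (by linarith [h0.1]) h0.2)

theorem not_areCongruent_unbounded (hm : m ≠ 0) (hx : xbar ≠ 0) (hr : 0 < r)
    (hrh : (r, h) ≠ (‖xbar‖, 0)) : ¬ AreCongruent (MRH xbar ‖xbar‖ 0) (MRH xbar r h) := by
  rintro ⟨Ψ, hΨ, himg⟩
  obtain ⟨A, ε, c, hε, -, hform⟩ := hΨ.exists_split
  have hd := norm_pos_iff.2 hx
  have ht := extremal_ne_zero (m := m) hx (s := r) (h := h) (Or.inl (by positivity))
  have hb := extremal_ne_zero (m := m) hx (s := -r) (h := h) (add_neg_ne_zero_or hrh)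
  have hbd : ∀ p ∈ MRH xbar ‖xbar‖ 0, (conformalInv _ hb).2 ≤ ε * p.2 + c ∧
      ε * p.2 + c ≤ (conformalInv _ ht).2 := by
    intro p hp
    have h1 : Ψ p ∈ MRH xbar r h := himg ▸ mem_image_of_mem Ψ hp
    have h2 : (Ψ p).2 = ε * p.2 + c := by rw [show p = (p.1, p.2) from rfl, hform]
    rw [← h2]
    exact ⟨(bot_le_height hx hr hb h1).1, (height_le_top hx hr ht h1).1⟩
  obtain ⟨p, hp, hlt⟩ := exists_height_lt hm hx
    (min ((conformalInv _ hb).2 - c) (c - (conformalInv _ ht).2))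
  have h1 := hlt.trans_le (min_le_left _ _)
  have h2 := hlt.trans_le (min_le_right _ _)
  have h3 := hbd p hp
  rcases hε with rfl | rfl <;> linarith

theorem eq_of_scaled_invariants {d r h r' h' K a b c : ℝ} (hd : 0 < d) (hr : 0 < r) (hh : 0 ≤ h)
    (hh' : 0 ≤ h') (hK : 0 < K) (a1 : a ^ 2 = (d + r) ^ 2 + h ^ 2)
    (b1 : b ^ 2 = (d + -r) ^ 2 + h ^ 2) (c1 : (2 * r) ^ 2 = a ^ 2 + b ^ 2 - 2 * (a * b * c))
    (a2 : (K * a) ^ 2 = (d + r') ^ 2 + h' ^ 2) (b2 : (K * b) ^ 2 = (d + -r') ^ 2 + h' ^ 2)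
    (c2 : (2 * r') ^ 2 = (K * a) ^ 2 + (K * b) ^ 2 - 2 * (K * a * (K * b) * c)) :
    r = r' ∧ h = h' := by
  have hr2 : r' ^ 2 = K ^ 2 * r ^ 2 := by linear_combination (1 / 4) * c2 - (K ^ 2 / 4) * c1
  have hrr : r' * d = K ^ 2 * r * d := by
    linear_combination (K ^ 2 / 4) * (a1 - b1) - (1 / 4) * (a2 - b2)
  have hrr' : r' = K ^ 2 * r := mul_right_cancel₀ hd.ne' hrr
  have hK1 : K ^ 2 = 1 := by
    rw [hrr'] at hr2
    have : K ^ 2 * r ^ 2 * (K ^ 2 - 1) = 0 := by linear_combination hr2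
    have h0 : K ^ 2 * r ^ 2 ≠ 0 := by positivity
    linarith [(mul_eq_zero.1 this).resolve_left h0]
  have hrfin : r = r' := by rw [hrr', hK1, one_mul]
  refine ⟨hrfin, ?_⟩
  rw [← sq_eq_sq₀ hh hh']
  rw [← hrfin, mul_pow, hK1, one_mul] at a2
  linarith

theorem eq_of_areCongruent_bounded (hx : xbar ≠ 0) {r' h' : ℝ} (hr : 0 < r) (hh : 0 ≤ h)
    (hr' : 0 < r') (hh' : 0 ≤ h') (hrh : (r, h) ≠ (‖xbar‖, 0)) (hrh' : (r', h') ≠ (‖xbar‖, 0))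
    (hc : AreCongruent (MRH xbar r h) (MRH xbar r' h')) : r = r' ∧ h = h' := by
  obtain ⟨Ψ, hΨ, himg⟩ := hc
  obtain ⟨A, ε, c, hε, hA, hform⟩ := hΨ.exists_split
  have hd := norm_pos_iff.2 hx
  have ht := extremal_ne_zero (m := m) hx (s := r) (h := h) (Or.inl (by positivity))
  have hb := extremal_ne_zero (m := m) hx (s := -r) (h := h) (add_neg_ne_zero_or hrh)
  have ht' := extremal_ne_zero (m := m) hx (s := r') (h := h') (Or.inl (by positivity))
  have hb' := extremal_ne_zero (m := m) hx (s := -r') (h := h') (add_neg_ne_zero_or hrh')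
  have hform' : ∀ p, Ψ p = (A p.1, ε * p.2 + c) := fun p => hform p.1 p.2
  set T := conformalInv _ ht with hT
  set B := conformalInv _ hb with hB
  set T' := conformalInv _ ht' with hT'
  set B' := conformalInv _ hb' with hB'
  have mT : T ∈ MRH xbar r h := by
    have := extremal_mem_MRH hx ht; rwa [abs_of_pos hr] at this
  have mB : B ∈ MRH xbar r h := by
    have := extremal_mem_MRH hx hb; rwa [abs_neg, abs_of_pos hr] at this
  have mT' : T' ∈ MRH xbar r' h' := by
    have := extremal_mem_MRH hx ht'; rwa [abs_of_pos hr'] at this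
  have mB' : B' ∈ MRH xbar r' h' := by
    have := extremal_mem_MRH hx hb'; rwa [abs_neg, abs_of_pos hr'] at this
  have hmap : ∀ p ∈ MRH xbar r h, Ψ p ∈ MRH xbar r' h' := fun p hp => himg ▸ mem_image_of_mem Ψ hp
  obtain ⟨T₁, mT₁, hT₁⟩ : ∃ p ∈ MRH xbar r h, Ψ p = T' := by rw [← himg] at mT'; exact mT'
  obtain ⟨B₁, mB₁, hB₁⟩ : ∃ p ∈ MRH xbar r h, Ψ p = B' := by rw [← himg] at mB'; exact mB'
  have hT₁2 : ε * T₁.2 + c = T'.2 := by rw [← hT₁, hform']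
  have hB₁2 : ε * B₁.2 + c = B'.2 := by rw [← hB₁, hform']
  have hang : ∀ p q, sphAngle (Ψ p).1 (Ψ q).1 = sphAngle p.1 q.1 := fun p q => by
    rw [hform', hform']; exact hA _ _
  -- the isometry preserves the angle between the extremal points and their height difference
  have hinv : T'.2 - B'.2 = T.2 - B.2 ∧ sphAngle T'.1 B'.1 = sphAngle T.1 B.1 := by
    have kT := (height_le_top hx hr' ht' (hmap T mT)).1
    have kB := (bot_le_height hx hr' hb' (hmap B mB)).1
    have kT2 := (height_le_top hx hr' ht' (hmap B mB)).1
    have kB2 := (bot_le_height hx hr' hb' (hmap T mT)).1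
    rw [← hT'] at kT kT2
    rw [← hB'] at kB kB2
    have k1 := (height_le_top hx hr ht mT₁).1
    have k2 := (bot_le_height hx hr hb mB₁).1
    have k3 := (bot_le_height hx hr hb mT₁).1
    have k4 := (height_le_top hx hr ht mB₁).1
    rw [← hT] at k1 k4
    rw [← hB] at k2 k3
    rw [hform'] at kT kB kT2 kB2
    simp only at kT kB kT2 kB2
    rcases hε with rfl | rfl
    · have e1 : Ψ T = T' := (height_le_top hx hr' ht' (hmap T mT)).2 (by
        rw [← hT', hform']; simp only; linarith)
      have e2 : Ψ B = B' := (bot_le_height hx hr' hb' (hmap B mB)).2 (by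
        rw [← hB', hform']; simp only; linarith)
      rw [← e1, ← e2, hang]
      refine ⟨?_, rfl⟩
      rw [hform', hform']; simp only; ring
    · have e1 : Ψ B = T' := (height_le_top hx hr' ht' (hmap B mB)).2 (by
        rw [← hT', hform']; simp only; linarith)
      have e2 : Ψ T = B' := (bot_le_height hx hr' hb' (hmap T mT)).2 (by
        rw [← hB', hform']; simp only; linarith)
      rw [← e1, ← e2, hang]
      refine ⟨?_, InnerProductGeometry.angle_comm _ _⟩
      rw [hform', hform']; simp only; ring
  -- the invariants in terms of `r` and `h`
  have key : ∀ (ρ η : ℝ) (ht : zeroHeight ((1 + ρ / ‖xbar‖) • xbar) + η • lastVec m ≠ 0)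
      (hb : zeroHeight ((1 + -ρ / ‖xbar‖) • xbar) + η • lastVec m ≠ 0), ∀ T B : SphR (m + 1),
      T = conformalInv _ ht → B = conformalInv _ hb →
      Real.exp T.2 ^ 2 = (‖xbar‖ + ρ) ^ 2 + η ^ 2 ∧ Real.exp B.2 ^ 2 = (‖xbar‖ + -ρ) ^ 2 + η ^ 2 ∧
      (2 * ρ) ^ 2 = Real.exp T.2 ^ 2 + Real.exp B.2 ^ 2 -
        2 * (Real.exp T.2 * Real.exp B.2 * Real.cos (sphAngle T.1 B.1)) := by
    rintro ρ η ht hb _ _ rfl rfl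
    refine ⟨?_, ?_, ?_⟩
    · rw [exp_conformalInv_snd, norm_sq_extremal hx]
    · rw [exp_conformalInv_snd, norm_sq_extremal hx]
    · rw [← norm_sq_conformalMap_sub, conformalMap_conformalInv, conformalMap_conformalInv]
      have : zeroHeight ((1 + ρ / ‖xbar‖) • xbar) + η • lastVec m -
          (zeroHeight ((1 + -ρ / ‖xbar‖) • xbar) + η • lastVec m) =
          (2 * ρ / ‖xbar‖) • zeroHeight xbar := by
        simp only [map_smul]
        module
      rw [this, norm_smul, zeroHeight.norm_map, Real.norm_eq_abs, mul_pow |2 * ρ / ‖xbar‖|, sq_abs]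
      field_simp
  obtain ⟨a1, b1, c1⟩ := key r h ht hb T B hT hB
  obtain ⟨a2, b2, c2⟩ := key r' h' ht' hb' T' B' hT' hB'
  have hT'exp : Real.exp T'.2 = Real.exp (T'.2 - T.2) * Real.exp T.2 := by
    rw [← Real.exp_add]; ring_nf
  have hB'exp : Real.exp B'.2 = Real.exp (T'.2 - T.2) * Real.exp B.2 := by
    rw [← Real.exp_add, show T'.2 - T.2 + B.2 = B'.2 by linarith [hinv.1]]
  rw [hinv.2] at c2
  rw [hT'exp, hB'exp] at c2
  rw [hT'exp] at a2
  rw [hB'exp] at b2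
  set K := Real.exp (T'.2 - T.2)
  exact eq_of_scaled_invariants hd hr hh hh' (Real.exp_pos _) a1 b1 c1 a2 b2 c2

/-- The submanifolds `M_{r,h}` are pairwise noncongruent. -/
theorem not_areCongruent_MRH (hm : m ≠ 0) (hx : xbar ≠ 0) {r' h' : ℝ} (hr : 0 < r) (hh : 0 ≤ h)
    (hr' : 0 < r') (hh' : 0 ≤ h') (hne : (r, h) ≠ (r', h')) :
    ¬ AreCongruent (MRH xbar r h) (MRH xbar r' h') := by
  intro hc
  by_cases h1 : (r, h) = (‖xbar‖, 0)
  · obtain ⟨rfl, rfl⟩ := Prod.ext_iff.1 h1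
    exact not_areCongruent_unbounded hm hx hr' hne.symm hc
  · by_cases h2 : (r', h') = (‖xbar‖, 0)
    · obtain ⟨rfl, rfl⟩ := Prod.ext_iff.1 h2
      exact not_areCongruent_unbounded hm hx hr hne hc.symm
    · obtain ⟨h3, h4⟩ := eq_of_areCongruent_bounded hx hr hh hr' hh' h1 h2 hc
      exact hne (Prod.ext h3 h4)

end Noncongruence

/-! ### The submanifolds `M_{r,h}` are rotational -/

section AmbientSpace

variable {n : ℕ}

/-- The inclusion of `ℝⁿ⁺¹` in `ℝⁿ⁺² = ℝⁿ⁺¹ × ℝ`. -/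
noncomputable def sphIncl : EuclideanSpace ℝ (Fin (n + 1)) →ₗᵢ[ℝ] Amb n where
  toFun y := WithLp.toLp 2 (y, 0)
  map_add' x y := WithLp.ofLp_injective 2 (Prod.ext (by simp) (by simp))
  map_smul' c y := WithLp.ofLp_injective 2 (Prod.ext (by simp) (by simp))
  norm_map' y := by
    have : ‖(WithLp.toLp 2 (y, (0 : ℝ)) : Amb n)‖ ^ 2 = ‖y‖ ^ 2 := by
      rw [WithLp.prod_norm_sq_eq_of_L2]; simp
    exact (sq_eq_sq₀ (norm_nonneg _) (norm_nonneg _)).1 this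

theorem sphIncl_apply (y : EuclideanSpace ℝ (Fin (n + 1))) :
    sphIncl y = (WithLp.toLp 2 (y, 0) : Amb n) := rfl

theorem amb_eq (z : Amb n) : z = sphIncl z.fst + z.snd • ddt n := by
  refine WithLp.ofLp_injective 2 (Prod.ext ?_ ?_) <;> simp [sphIncl_apply, ddt]

@[simp] theorem sphIncl_fst (y : EuclideanSpace ℝ (Fin (n + 1))) : (sphIncl y).fst = y := rfl
@[simp] theorem sphIncl_snd (y : EuclideanSpace ℝ (Fin (n + 1))) : (sphIncl y).snd = 0 := rfl
@[simp] theorem ddt_fst : (ddt n).fst = 0 := rfl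
@[simp] theorem ddt_snd : (ddt n).snd = 1 := rfl

theorem amb_inner (z w : Amb n) : ⟪z, w⟫ = ⟪z.fst, w.fst⟫ + z.snd * w.snd := by
  rw [WithLp.prod_inner_apply]
  simp [mul_comm]

theorem norm_ddt : ‖ddt n‖ = 1 := by
  rw [← sq_eq_sq₀ (norm_nonneg _) zero_le_one, ← real_inner_self_eq_norm_sq, amb_inner]
  simp

theorem toAmb_eq (p : SphR n) : toAmb p = sphIncl (p.1 : EuclideanSpace ℝ (Fin (n + 1))) +
    p.2 • ddt n := amb_eq _

/-- The inverse of the conformal map, with values in the ambient Euclidean space. -/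
noncomputable def ambInv (y : EuclideanSpace ℝ (Fin (n + 1))) : Amb n :=
  sphIncl (‖y‖⁻¹ • y) + Real.log ‖y‖ • ddt n

theorem toAmb_conformalInv (y : EuclideanSpace ℝ (Fin (n + 1))) (hy : y ≠ 0) :
    toAmb (conformalInv y hy) = ambInv y := toAmb_eq _

theorem contDiffAt_ambInv {y : EuclideanSpace ℝ (Fin (n + 1))} (hy : y ≠ 0) {k : ℕ∞ω} :
    ContDiffAt ℝ k (ambInv (n := n)) y := by
  have h1 : ContDiffAt ℝ k (fun y : EuclideanSpace ℝ (Fin (n + 1)) => ‖y‖) y := contDiffAt_norm ℝ hy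
  have h2 : ‖y‖ ≠ 0 := norm_ne_zero_iff.2 hy
  have h3 := (sphIncl (n := n)).toContinuousLinearMap.contDiff (n := k)
  have h4 : ContDiffAt ℝ k (fun y : EuclideanSpace ℝ (Fin (n + 1)) => ‖y‖⁻¹ • y) y :=
    (h1.inv h2).smul contDiffAt_id
  exact (h3.contDiffAt.comp y h4).add ((h1.log h2).smul contDiffAt_const)

/-- The extension of the conformal map to the ambient Euclidean space. -/
noncomputable def ambConformal (z : Amb n) : EuclideanSpace ℝ (Fin (n + 1)) :=
  Real.exp z.snd • z.fst

theorem ambConformal_toAmb (p : SphR n) : ambConformal (toAmb p) = conformalMap p := rfl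

theorem ambConformal_ambInv {y : EuclideanSpace ℝ (Fin (n + 1))} (hy : y ≠ 0) :
    ambConformal (ambInv y) = y := by
  rw [← toAmb_conformalInv y hy, ambConformal_toAmb, conformalMap_conformalInv]

theorem contDiff_ambConformal {k : ℕ∞ω} : ContDiff ℝ k (ambConformal (n := n)) := by
  have h1 : ContDiff ℝ k fun z : Amb n => z.fst :=
    (WithLp.fstL 2 ℝ (EuclideanSpace ℝ (Fin (n + 1))) ℝ).contDiff
  have h2 : ContDiff ℝ k fun z : Amb n => z.snd :=
    (WithLp.sndL 2 ℝ (EuclideanSpace ℝ (Fin (n + 1))) ℝ).contDiff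
  exact h2.exp.smul h1

end AmbientSpace

section Rotational

variable {m : ℕ} {xbar : EuclideanSpace ℝ (Fin (m + 1))} {r h : ℝ}

/-- The point of `𝕊_{r,h}` at polar angle `τ` in the direction `w`. -/
noncomputable def polarPoint (xbar : EuclideanSpace ℝ (Fin (m + 1))) (r h : ℝ)
    (w : EuclideanSpace ℝ (Fin (m + 1))) (τ : ℝ) : EuclideanSpace ℝ (Fin (m + 1 + 1)) :=
  (‖xbar‖ + r * Real.cos τ) • zeroHeight (‖xbar‖⁻¹ • xbar) + (r * Real.sin τ) • zeroHeight w +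
    h • lastVec m

theorem polarPoint_eq (hx : xbar ≠ 0) (w : EuclideanSpace ℝ (Fin (m + 1))) (τ : ℝ) :
    polarPoint xbar r h w τ = zeroHeight (xbar + ((r * Real.cos τ) • (‖xbar‖⁻¹ • xbar) +
      (r * Real.sin τ) • w)) + h • lastVec m := by
  have h1 : zeroHeight xbar = ‖xbar‖ • zeroHeight (‖xbar‖⁻¹ • xbar) := by
    rw [← map_smul, smul_inv_smul₀ (norm_ne_zero_iff.2 hx)]
  rw [polarPoint, map_add, h1, map_add, map_smul _ (r * Real.cos τ), map_smul _ (r * Real.sin τ)]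
  module

theorem norm_sq_polar (hx : xbar ≠ 0) {w : EuclideanSpace ℝ (Fin (m + 1))} (hw : ‖w‖ = 1)
    (hxw : ⟪xbar, w⟫ = 0) (a b : ℝ) : ‖a • (‖xbar‖⁻¹ • xbar) + b • w‖ ^ 2 = a ^ 2 + b ^ 2 := by
  rw [norm_add_sq_real, norm_smul a, norm_smul b, norm_normalize hx, hw, real_inner_smul_left,
    real_inner_smul_left, real_inner_smul_right, hxw]
  simp

theorem norm_sq_polarPoint (hx : xbar ≠ 0) {w : EuclideanSpace ℝ (Fin (m + 1))} (hw : ‖w‖ = 1)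
    (hxw : ⟪xbar, w⟫ = 0) (τ : ℝ) : ‖polarPoint xbar r h w τ‖ ^ 2 =
      (‖xbar‖ + r * Real.cos τ) ^ 2 + (r * Real.sin τ) ^ 2 + h ^ 2 := by
  have : polarPoint xbar r h w τ = zeroHeight ((‖xbar‖ + r * Real.cos τ) • (‖xbar‖⁻¹ • xbar) +
      (r * Real.sin τ) • w) + h • lastVec m := by
    rw [polarPoint, map_add, map_smul _ (‖xbar‖ + r * Real.cos τ), map_smul _ (r * Real.sin τ)]
  rw [this, norm_sq_zeroHeight_add, norm_sq_polar hx hw hxw]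

theorem conformalInv_polarPoint_mem (hx : xbar ≠ 0) (hr : 0 < r)
    {w : EuclideanSpace ℝ (Fin (m + 1))} (hw : ‖w‖ = 1) (hxw : ⟪xbar, w⟫ = 0) {τ : ℝ}
    (hne : polarPoint xbar r h w τ ≠ 0) : conformalInv _ hne ∈ MRH xbar r h := by
  rw [mem_MRH_iff, conformalMap_conformalInv, polarPoint_eq hx]
  constructor
  · simp only [map_add, map_smul, initPart_zeroHeight, initPart_lastVec, smul_zero, add_zero,
      add_sub_cancel_left]
    rw [← sq_eq_sq₀ (norm_nonneg _) hr.le, norm_sq_polar hx hw hxw]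
    linear_combination r ^ 2 * Real.sin_sq_add_cos_sq τ
  · simp

/-- Polar coordinates on `M_{r,h}`. -/
theorem exists_polarPoint_eq (hm : m ≠ 0) (hx : xbar ≠ 0) (hr : 0 < r) {p : SphR (m + 1)}
    (hp : p ∈ MRH xbar r h) : ∃ w : EuclideanSpace ℝ (Fin (m + 1)), ‖w‖ = 1 ∧ ⟪xbar, w⟫ = 0 ∧
      ∃ τ ∈ Icc 0 Real.pi, conformalMap p = polarPoint xbar r h w τ := by
  obtain ⟨h1, h2⟩ := mem_MRH_iff.1 hp
  set v := initPart (conformalMap p) - xbar with hv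
  set xh := ‖xbar‖⁻¹ • xbar with hxh
  have hxh1 : ‖xh‖ = 1 := norm_normalize hx
  set c := ⟪v, xh⟫
  set u := v - c • xh
  have hu : ⟪xh, u⟫ = 0 := by
    rw [inner_sub_right, real_inner_smul_right, real_inner_self_eq_norm_sq, hxh1, real_inner_comm]
    simp [c]
  have hxu : ⟪xbar, u⟫ = 0 := by
    rw [hxh, real_inner_smul_left] at hu
    exact (mul_eq_zero.1 hu).resolve_left (inv_ne_zero (norm_ne_zero_iff.2 hx))
  have hcu : c ^ 2 + ‖u‖ ^ 2 = r ^ 2 := by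
    have : v = c • xh + u := by simp [u]
    rw [← h1, this, norm_add_sq_real, real_inner_smul_left, hu, norm_smul, hxh1, Real.norm_eq_abs]
    simp
  obtain ⟨w, hw, hxw, huw⟩ : ∃ w : EuclideanSpace ℝ (Fin (m + 1)), ‖w‖ = 1 ∧ ⟪xbar, w⟫ = 0 ∧
      u = ‖u‖ • w := by
    by_cases hu0 : u = 0
    · obtain ⟨w, hw, hxw⟩ := exists_unit_orthogonal hm hx
      exact ⟨w, hw, hxw, by simp [hu0]⟩
    · refine ⟨‖u‖⁻¹ • u, norm_normalize hu0, ?_, ?_⟩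
      · rw [real_inner_smul_right, hxu, mul_zero]
      · rw [smul_inv_smul₀ (norm_ne_zero_iff.2 hu0)]
  have hcr : (c / r) ^ 2 ≤ 1 := by
    rw [div_pow, div_le_one (by positivity)]
    nlinarith [sq_nonneg ‖u‖]
  obtain ⟨hc1, hc2⟩ := abs_le.1 ((sq_le_one_iff_abs_le_one _).1 hcr)
  refine ⟨w, hw, hxw, Real.arccos (c / r), ⟨Real.arccos_nonneg _, Real.arccos_le_pi _⟩, ?_⟩
  have hcos : r * Real.cos (Real.arccos (c / r)) = c := by
    rw [Real.cos_arccos hc1 hc2]; field_simp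
  have hsin : r * Real.sin (Real.arccos (c / r)) = ‖u‖ := by
    rw [Real.sin_arccos, show 1 - (c / r) ^ 2 = (‖u‖ / r) ^ 2 by field_simp; linarith,
      Real.sqrt_sq (by positivity)]
    field_simp
  rw [polarPoint_eq hx, hcos, hsin, ← huw, ← hxh, eq_zeroHeight_initPart_add (conformalMap p), h2]
  congr 2
  simp [u, hv]

/-- The interval of definition of the profile curve. -/
def profileInterval (d r h : ℝ) : Set ℝ := {τ | τ ∈ Icc 0 Real.pi ∧ (τ = Real.pi → (r, h) ≠ (d, 0))}

theorem convex_profileInterval (d r h : ℝ) : Convex ℝ (profileInterval d r h) := by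
  by_cases hd : (r, h) = (d, 0)
  · have : profileInterval d r h = Ico 0 Real.pi := by
      ext τ
      constructor
      · rintro ⟨h1, h2⟩
        exact ⟨h1.1, lt_of_le_of_ne h1.2 fun h3 => h2 h3 hd⟩
      · rintro ⟨h1, h2⟩
        exact ⟨⟨h1, h2.le⟩, fun h3 => absurd h3 h2.ne⟩
    rw [this]
    exact convex_Ico _ _
  · have : profileInterval d r h = Icc 0 Real.pi := by
      ext τ
      exact ⟨fun h1 => h1.1, fun h1 => ⟨h1, fun _ => hd⟩⟩
    rw [this]
    exact convex_Icc _ _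

theorem interior_profileInterval (d r h : ℝ) : (interior (profileInterval d r h)).Nonempty := by
  refine ⟨Real.pi / 2, mem_interior.2 ⟨Ioo 0 Real.pi, fun τ hτ =>
    ⟨⟨hτ.1.le, hτ.2.le⟩, fun h3 => absurd h3 hτ.2.ne⟩, isOpen_Ioo, ?_⟩⟩
  constructor <;> linarith [Real.pi_pos]

theorem polarPoint_ne_zero (hx : xbar ≠ 0) (hr : 0 < r) {w : EuclideanSpace ℝ (Fin (m + 1))}
    (hw : ‖w‖ = 1) (hxw : ⟪xbar, w⟫ = 0) {τ : ℝ} (hτ : τ ∈ profileInterval ‖xbar‖ r h) :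
    polarPoint xbar r h w τ ≠ 0 := by
  intro h0
  have h1 := norm_sq_polarPoint (r := r) (h := h) hx hw hxw τ
  rw [h0, norm_zero, zero_pow two_ne_zero] at h1
  have hs : r * Real.sin τ = 0 := by
    rw [← sq_eq_zero_iff]
    nlinarith [sq_nonneg h, sq_nonneg (r * Real.sin τ), sq_nonneg (‖xbar‖ + r * Real.cos τ)]
  have hc : ‖xbar‖ + r * Real.cos τ = 0 := by
    rw [← sq_eq_zero_iff]
    nlinarith [sq_nonneg h, sq_nonneg (r * Real.sin τ), sq_nonneg (‖xbar‖ + r * Real.cos τ)]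
  have hh : h = 0 := by
    rw [← sq_eq_zero_iff]
    nlinarith [sq_nonneg h, sq_nonneg (r * Real.sin τ), sq_nonneg (‖xbar‖ + r * Real.cos τ)]
  have hd := norm_pos_iff.2 hx
  have hs' := (mul_eq_zero.1 hs).resolve_left hr.ne'
  have hpi : τ = Real.pi := by
    by_contra hne
    rcases hτ.1.1.eq_or_lt with h2 | h2
    · rw [← h2, Real.cos_zero] at hc
      linarith
    · exact (Real.sin_pos_of_pos_of_lt_pi h2 (lt_of_le_of_ne hτ.1.2 hne)).ne' hs'
  refine hτ.2 hpi (Prod.ext ?_ hh)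
  rw [hpi, Real.cos_pi] at hc
  simp only
  linarith

theorem ambInv_polarPoint (hx : xbar ≠ 0) {w : EuclideanSpace ℝ (Fin (m + 1))} (hw : ‖w‖ = 1)
    (hxw : ⟪xbar, w⟫ = 0) (τ : ℝ) : ambInv (polarPoint xbar r h w τ) =
      (√((‖xbar‖ + r * Real.cos τ) ^ 2 + (r * Real.sin τ) ^ 2 + h ^ 2))⁻¹ •
        ((‖xbar‖ + r * Real.cos τ) • sphIncl (zeroHeight (‖xbar‖⁻¹ • xbar)) +
          h • sphIncl (lastVec m)) +
      Real.log (√((‖xbar‖ + r * Real.cos τ) ^ 2 + (r * Real.sin τ) ^ 2 + h ^ 2)) • ddt (m + 1) +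
      ((√((‖xbar‖ + r * Real.cos τ) ^ 2 + (r * Real.sin τ) ^ 2 + h ^ 2))⁻¹ * (r * Real.sin τ)) •
        sphIncl (zeroHeight w) := by
  rw [← norm_sq_polarPoint (r := r) (h := h) hx hw hxw τ, Real.sqrt_sq (norm_nonneg _), ambInv]
  set N := ‖polarPoint xbar r h w τ‖
  rw [polarPoint, map_smul _ N⁻¹, map_add, map_add, map_smul _ (‖xbar‖ + r * Real.cos τ),
    map_smul _ (r * Real.sin τ), map_smul _ h]
  module

theorem hasDerivAt_polarPoint (w : EuclideanSpace ℝ (Fin (m + 1))) (τ : ℝ) :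
    HasDerivAt (polarPoint xbar r h w)
      ((r * -Real.sin τ) • zeroHeight (‖xbar‖⁻¹ • xbar) + (r * Real.cos τ) • zeroHeight w) τ := by
  have h1 := (((Real.hasDerivAt_cos τ).const_mul r).const_add ‖xbar‖).smul_const
    (zeroHeight (‖xbar‖⁻¹ • xbar))
  have h2 := ((Real.hasDerivAt_sin τ).const_mul r).smul_const (zeroHeight w)
  exact (h1.add h2).add_const (h • lastVec m)

theorem contDiff_polarPoint (w : EuclideanSpace ℝ (Fin (m + 1))) {k : ℕ∞ω} :
    ContDiff ℝ k (polarPoint xbar r h w) := by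
  unfold polarPoint
  have := Real.contDiff_cos (n := k)
  have := Real.contDiff_sin (n := k)
  fun_prop

theorem derivWithin_ambInv_polarPoint_ne_zero (hx : xbar ≠ 0) (hr : 0 < r)
    {w : EuclideanSpace ℝ (Fin (m + 1))} (hw : ‖w‖ = 1) (hxw : ⟪xbar, w⟫ = 0) {τ : ℝ}
    (hτ : τ ∈ profileInterval ‖xbar‖ r h) :
    derivWithin (fun τ => ambInv (polarPoint xbar r h w τ)) (profileInterval ‖xbar‖ r h) τ ≠ 0 := by
  intro h0
  have hne := polarPoint_ne_zero hx hr hw hxw hτ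
  have hd : DifferentiableWithinAt ℝ (fun τ => ambInv (polarPoint xbar r h w τ))
      (profileInterval ‖xbar‖ r h) τ :=
    (((contDiffAt_ambInv hne (k := 1)).differentiableAt one_ne_zero).comp τ
      (hasDerivAt_polarPoint w τ).differentiableAt).differentiableWithinAt
  have h1 := hd.hasDerivWithinAt
  rw [h0] at h1
  have h2 := (((contDiff_ambConformal (n := m + 1) (k := 1)).differentiable
    one_ne_zero) (ambInv (polarPoint xbar r h w τ))).hasFDerivAt.comp_hasDerivWithinAt τ h1
  rw [map_zero] at h2
  have h3 : HasDerivWithinAt (polarPoint xbar r h w) 0 (profileInterval ‖xbar‖ r h) τ := by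
    refine h2.congr (fun σ hσ => ?_) ?_
    · exact (ambConformal_ambInv (polarPoint_ne_zero hx hr hw hxw hσ)).symm
    · exact (ambConformal_ambInv hne).symm
  have hu : UniqueDiffWithinAt ℝ (profileInterval ‖xbar‖ r h) τ :=
    uniqueDiffOn_convex (convex_profileInterval _ _ _) (interior_profileInterval _ _ _) τ hτ
  have h4 := hu.eq_deriv _ (hasDerivAt_polarPoint w τ).hasDerivWithinAt h3
  have h5 : (r * -Real.sin τ) • (‖xbar‖⁻¹ • xbar) + (r * Real.cos τ) • w = 0 := by
    apply zeroHeight.injective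
    rw [map_add, map_smul _ (r * -Real.sin τ), map_smul _ (r * Real.cos τ), h4, map_zero]
  have h6 := norm_sq_polar hx hw hxw (r * -Real.sin τ) (r * Real.cos τ)
  rw [h5, norm_zero] at h6
  have h7 := Real.sin_sq_add_cos_sq τ
  have : 0 < r ^ 2 := by positivity
  nlinarith

/-- The orthonormal frame adapted to the rotation. -/
noncomputable def rotFrame (xbar w : EuclideanSpace ℝ (Fin (m + 1))) : Fin 4 → Amb (m + 1) :=
  ![sphIncl (zeroHeight (‖xbar‖⁻¹ • xbar)), ddt (m + 1), sphIncl (zeroHeight w),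
    sphIncl (lastVec m)]

theorem orthonormal_rotFrame (hx : xbar ≠ 0) {w : EuclideanSpace ℝ (Fin (m + 1))} (hw : ‖w‖ = 1)
    (hxw : ⟪xbar, w⟫ = 0) : Orthonormal ℝ (rotFrame xbar w) := by
  have hwx : ⟪w, xbar⟫ = 0 := by rw [real_inner_comm, hxw]
  have hlz : ∀ x : EuclideanSpace ℝ (Fin (m + 1)), ⟪lastVec m, zeroHeight x⟫ = 0 := fun x => by
    rw [real_inner_comm, inner_zeroHeight_lastVec]
  constructor
  · intro i
    fin_cases i
    · simp [rotFrame, -map_smul, norm_normalize hx]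
    · simp [rotFrame, norm_ddt]
    · simp [rotFrame, hw]
    · simp [rotFrame]
  · intro i j hij
    fin_cases i <;> fin_cases j <;>
      first
      | exact absurd rfl hij
      | simp [rotFrame, real_inner_smul_left, real_inner_smul_right, hxw, hwx, hlz]

theorem finrank_span_range_of_orthonormal {E ι : Type*} [NormedAddCommGroup E]
    [InnerProductSpace ℝ E] [Fintype ι] {e : ι → E} (he : Orthonormal ℝ e) :
    finrank ℝ (Submodule.span ℝ (range e)) = Fintype.card ι :=
  finrank_span_eq_card he.linearIndependent

theorem isRotational_MRH_of_frame (hm : m ≠ 0) (hx : xbar ≠ 0) (hr : 0 < r)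
    {w : EuclideanSpace ℝ (Fin (m + 1))} (hw : ‖w‖ = 1) (hxw : ⟪xbar, w⟫ = 0) {s : ℕ}
    {Q : Submodule ℝ (Amb (m + 1))} (hQ : Q ≤ Submodule.span ℝ (range (rotFrame xbar w)))
    (h0 : rotFrame xbar w 0 ∈ Q) (h1 : rotFrame xbar w 1 ∈ Q) (h2 : rotFrame xbar w 2 ∈ Q)
    (h3 : h ≠ 0 → rotFrame xbar w 3 ∈ Q) (hQs : finrank ℝ Q = s + 2) :
    IsRotational m s (MRH xbar r h) := by
  have hon := orthonormal_rotFrame hx hw hxw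
  have hon3 : Orthonormal ℝ (rotFrame xbar w ∘ ![0, 1, 3]) := hon.comp _ (by decide)
  set P₂ := Submodule.span ℝ (range (rotFrame xbar w ∘ ![0, 1, 3])) with hP₂
  have m0 : sphIncl (zeroHeight (‖xbar‖⁻¹ • xbar)) ∈ P₂ := Submodule.subset_span ⟨0, rfl⟩
  have m1 : ddt (m + 1) ∈ P₂ := Submodule.subset_span ⟨1, rfl⟩
  have m3 : sphIncl (lastVec m) ∈ P₂ := Submodule.subset_span ⟨2, rfl⟩
  have hu : ∀ w' : EuclideanSpace ℝ (Fin (m + 1)), ⟪xbar, w'⟫ = 0 →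
      sphIncl (zeroHeight w') ∈ P₂ᗮ := by
    intro w' hxw'
    rw [Submodule.mem_orthogonal, hP₂]
    intro z hz
    refine Submodule.span_induction ?_ (inner_zero_left _) (fun a b _ _ ha hb => by
      rw [inner_add_left, ha, hb, add_zero]) (fun c a _ ha => by
      rw [real_inner_smul_left, ha, mul_zero]) hz
    rintro _ ⟨i, rfl⟩
    fin_cases i
    · simp [rotFrame, real_inner_smul_left, hxw']
    · simp [rotFrame]
    · change ⟪sphIncl (lastVec m), sphIncl (zeroHeight w')⟫ = 0
      rw [LinearIsometry.inner_map_map, real_inner_comm, inner_zeroHeight_lastVec]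
  have hmemQ : ∀ τ, ambInv (polarPoint xbar r h w τ) ∈ Q := by
    intro τ
    rw [ambInv_polarPoint hx hw hxw]
    refine Q.add_mem (Q.add_mem (Q.smul_mem _ (Q.add_mem (Q.smul_mem _ h0) ?_)) (Q.smul_mem _ h1))
      (Q.smul_mem _ h2)
    by_cases hh : h = 0
    · rw [hh, zero_smul]; exact Q.zero_mem
    · exact Q.smul_mem _ (h3 hh)
  refine ⟨P₂, Submodule.span ℝ (range (rotFrame xbar w)), Q,
    Submodule.span_mono (range_comp_subset_range _ _), m1, ?_, ?_, hQ, h1, hQs,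
    sphIncl (zeroHeight w), Submodule.subset_span ⟨2, rfl⟩, ?_, hu w hxw,
    profileInterval ‖xbar‖ r h, fun τ => ambInv (polarPoint xbar r h w τ),
    (convex_profileInterval _ _ _).ordConnected, interior_profileInterval _ _ _, ?_,
    fun τ hτ => derivWithin_ambInv_polarPoint_ne_zero hx hr hw hxw hτ, fun τ hτ => ⟨?_, hmemQ τ, ?_⟩,
    ?_⟩
  · rw [finrank_span_range_of_orthonormal hon3, Fintype.card_fin]; ring
  · rw [finrank_span_range_of_orthonormal hon, Fintype.card_fin]; ring
  · rw [← norm_pos_iff]; simp [hw]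
  · intro τ hτ
    exact ((contDiffAt_ambInv (polarPoint_ne_zero hx hr hw hxw hτ)).comp τ
      (contDiff_polarPoint w).contDiffAt).contDiffWithinAt
  · exact ⟨_, toAmb_conformalInv _ (polarPoint_ne_zero hx hr hw hxw hτ)⟩
  · beta_reduce
    rw [ambInv_polarPoint hx hw hxw, inner_add_left, inner_add_left, real_inner_smul_left,
      inner_add_left, real_inner_smul_left, real_inner_smul_left, real_inner_smul_left,
      real_inner_smul_left, Submodule.inner_right_of_mem_orthogonal m0 (hu w hxw),
      Submodule.inner_right_of_mem_orthogonal m1 (hu w hxw),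
      Submodule.inner_right_of_mem_orthogonal m3 (hu w hxw), real_inner_self_eq_norm_sq]
    have := Real.sin_nonneg_of_mem_Icc hτ.1
    simp only [mul_zero, add_zero, zero_add]
    positivity
  · ext y
    constructor
    · rintro ⟨p, hp, rfl⟩
      obtain ⟨w', hw', hxw', τ, hτ, hpτ⟩ := exists_polarPoint_eq hm hx hr hp
      have hτ' : τ ∈ profileInterval ‖xbar‖ r h := by
        refine ⟨hτ, fun hpi heq => conformalMap_ne_zero p ?_⟩
        obtain ⟨rfl, rfl⟩ := Prod.ext_iff.1 heq
        rw [hpτ, hpi, polarPoint]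
        simp
      have hpa : toAmb p = ambInv (polarPoint xbar r h w' τ) := by
        rw [← hpτ, ← toAmb_conformalInv _ (conformalMap_ne_zero p), conformalInv_conformalMap]
      set K := (Submodule.span ℝ {sphIncl (zeroHeight w) - sphIncl (zeroHeight w')})ᗮ
      have hfix : ∀ z ∈ P₂, K.reflection z = z := by
        intro z hz
        rw [Submodule.reflection_eq_self_iff, Submodule.mem_orthogonal_singleton_iff_inner_left,
          inner_sub_right, Submodule.inner_right_of_mem_orthogonal hz (hu w hxw),
          Submodule.inner_right_of_mem_orthogonal hz (hu w' hxw'), sub_zero]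
      have hswap : K.reflection (sphIncl (zeroHeight w)) = sphIncl (zeroHeight w') :=
        Submodule.reflection_sub (by simp [hw, hw'])
      refine ⟨K.reflection, hfix, τ, hτ', ?_⟩
      beta_reduce
      rw [hpa, ambInv_polarPoint hx hw hxw, ambInv_polarPoint hx hw' hxw']
      simp only [map_add, LinearIsometryEquiv.map_smul, hfix _ m0, hfix _ m1, hfix _ m3, hswap]
    · rintro ⟨T, hT, τ, hτ, rfl⟩
      have hTo : ∀ z ∈ P₂, ⟪z, T (sphIncl (zeroHeight w))⟫ = 0 := by
        intro z hz
        rw [← hT z hz, LinearIsometryEquiv.inner_map_map]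
        exact Submodule.inner_right_of_mem_orthogonal hz (hu w hxw)
      set z := T (sphIncl (zeroHeight w)) with hz
      have hz2 : z.snd = 0 := by
        have := hTo _ m1
        rw [amb_inner] at this
        simpa using this
      have hz1 : z = sphIncl z.fst := by
        conv_lhs => rw [amb_eq z, hz2, zero_smul, add_zero]
      have hzl : z.fst (Fin.last (m + 1)) = 0 := by
        have := hTo _ m3
        rwa [hz1, LinearIsometry.inner_map_map, real_inner_comm, inner_lastVec] at this
      have hzf : z.fst = zeroHeight (initPart z.fst) := by
        conv_lhs => rw [eq_zeroHeight_initPart_add z.fst, hzl, zero_smul, add_zero]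
      set w' := initPart z.fst
      have hzw : z = sphIncl (zeroHeight w') := by rw [← hzf, ← hz1]
      have hw' : ‖w'‖ = 1 := by
        have : ‖z‖ = 1 := by rw [hz, T.norm_map]; simp [hw]
        rwa [hzw, LinearIsometry.norm_map, LinearIsometry.norm_map] at this
      have hxw' : ⟪xbar, w'⟫ = 0 := by
        have := hTo _ m0
        rw [hzw, LinearIsometry.inner_map_map, LinearIsometry.inner_map_map,
          real_inner_smul_left] at this
        exact (mul_eq_zero.1 this).resolve_left (inv_ne_zero (norm_ne_zero_iff.2 hx))
      have hne := polarPoint_ne_zero hx hr hw' hxw' hτ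
      refine ⟨_, conformalInv_polarPoint_mem hx hr hw' hxw' hne, ?_⟩
      rw [toAmb_conformalInv]
      simp only [ambInv_polarPoint hx hw hxw, ambInv_polarPoint hx hw' hxw', map_add,
        LinearIsometryEquiv.map_smul, hT _ m0, hT _ m1, hT _ m3]
      rw [← hz, hzw]

/-- The profile of `M_{r,h}` is a curve in a totally geodesic `𝕊² × ℝ`. -/
theorem isRotational_two_MRH (hm : m ≠ 0) (hx : xbar ≠ 0) (hr : 0 < r) :
    IsRotational m 2 (MRH xbar r h) := by
  obtain ⟨w, hw, hxw⟩ := exists_unit_orthogonal hm hx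
  refine isRotational_MRH_of_frame hm hx hr hw hxw le_rfl (Submodule.subset_span ⟨0, rfl⟩)
    (Submodule.subset_span ⟨1, rfl⟩) (Submodule.subset_span ⟨2, rfl⟩)
    (fun _ => Submodule.subset_span ⟨3, rfl⟩) ?_
  rw [finrank_span_range_of_orthonormal (orthonormal_rotFrame hx hw hxw), Fintype.card_fin]

/-- The profile of `M_{r,0}` is a curve in a totally geodesic `𝕊¹ × ℝ`. -/
theorem isRotational_one_MRH (hm : m ≠ 0) (hx : xbar ≠ 0) (hr : 0 < r) :
    IsRotational m 1 (MRH xbar r 0) := by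
  obtain ⟨w, hw, hxw⟩ := exists_unit_orthogonal hm hx
  have hon : Orthonormal ℝ (rotFrame xbar w ∘ ![0, 1, 2]) :=
    (orthonormal_rotFrame hx hw hxw).comp _ (by decide)
  refine isRotational_MRH_of_frame hm hx hr hw hxw
    (Submodule.span_mono (range_comp_subset_range ![0, 1, 2] (rotFrame xbar w)))
    (Submodule.subset_span ⟨0, rfl⟩)
    (Submodule.subset_span ⟨1, rfl⟩) (Submodule.subset_span ⟨2, rfl⟩)
    (fun h => absurd rfl h) ?_
  rw [finrank_span_range_of_orthonormal hon, Fintype.card_fin]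

end Rotational

/-! ### Umbilical immersions in Euclidean spaces: local theory -/

section LocalUmbilical

variable {E H : Type*} [NormedAddCommGroup E] [InnerProductSpace ℝ E]
  [NormedAddCommGroup H] [InnerProductSpace ℝ H]

/-- The vector `η` is normal to `Y` at `x`, and the normal part of the second derivative of `Y`
at `x` is the metric times `η`. -/
def UmbilicalWith (Y : E → H) (x : E) (η : H) : Prop :=
  (∀ u, ⟪fderiv ℝ Y x u, η⟫ = 0) ∧ ∀ v w, ∃ z, fderiv ℝ (fderiv ℝ Y) x v w =
    fderiv ℝ Y x z + ⟪fderiv ℝ Y x v, fderiv ℝ Y x w⟫ • η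

theorem two_le_smooth : minSmoothness ℝ 2 ≤ (∞ : ℕ∞ω) := by
  rw [minSmoothness_of_isRCLikeNormedField]
  exact WithTop.coe_le_coe.2 (le_top : (2 : ℕ∞) ≤ ⊤)

theorem contDiffAt_fderiv_of_isOpen {U : Set E} {Y : E → H} (hU : IsOpen U) (hY : ContDiffOn ℝ ∞ Y U) {x : E} (hx : x ∈ U) :
    ContDiffAt ℝ ∞ (fderiv ℝ Y) x :=
  ((hY.contDiffAt (hU.mem_nhds hx)).fderiv_right (m := ∞) (by simp))

theorem second_deriv_symm {U : Set E} {Y : E → H} (hU : IsOpen U) (hY : ContDiffOn ℝ ∞ Y U) {x : E} (hx : x ∈ U) (v w : E) :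
    fderiv ℝ (fderiv ℝ Y) x v w = fderiv ℝ (fderiv ℝ Y) x w v := by
  have h := (hY.contDiffAt (hU.mem_nhds hx)).isSymmSndFDerivAt two_le_smooth
  exact h.eq v w

variable [FiniteDimensional ℝ E] [FiniteDimensional ℝ H]

/-- The adjoint as a linear map. -/
noncomputable def adjointReal : (E →L[ℝ] H) →L[ℝ] (H →L[ℝ] E) :=
  LinearMap.mkContinuous
    { toFun := ContinuousLinearMap.adjoint
      map_add' := fun A B => map_add _ A B
      map_smul' := fun c A => by simp } 1 (fun A => by simp)

theorem inner_adjointReal (A : E →L[ℝ] H) (z : H) (v : E) : ⟪adjointReal A z, v⟫ = ⟪z, A v⟫ :=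
  ContinuousLinearMap.adjoint_inner_left A v z

/-- The orthogonal left inverse of an injective operator. -/
noncomputable def leftInv (A : E →L[ℝ] H) : H →L[ℝ] E :=
  (ContinuousLinearMap.inverse ((adjointReal A).comp A)).comp (adjointReal A)

theorem exists_gram_equiv {A : E →L[ℝ] H} (hA : Function.Injective A) :
    ∃ G : E ≃L[ℝ] E, (G : E →L[ℝ] E) = (adjointReal A).comp A := by
  have hinj : Function.Injective ((adjointReal A).comp A).toLinearMap := by
    rw [injective_iff_map_eq_zero]
    intro v hv
    have h1 : ⟪adjointReal A (A v), v⟫ = 0 := by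
      rw [show adjointReal A (A v) = 0 from hv, inner_zero_left]
    rw [inner_adjointReal, inner_self_eq_zero] at h1
    exact hA (by rw [h1, map_zero])
  refine ⟨(LinearEquiv.ofInjectiveEndo _ hinj).toContinuousLinearEquiv, ?_⟩
  ext v
  rfl

theorem leftInv_apply {A : E →L[ℝ] H} (hA : Function.Injective A) (v : E) :
    leftInv A (A v) = v := by
  obtain ⟨G, hG⟩ := exists_gram_equiv hA
  have h1 : leftInv A (A v) = ContinuousLinearMap.inverse ((adjointReal A).comp A)
    (((adjointReal A).comp A) v) := rfl
  rw [h1, ← hG, ContinuousLinearMap.inverse_equiv]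
  simp

theorem leftInv_of_orthogonal {A : E →L[ℝ] H} {η : H} (hη : ∀ u, ⟪A u, η⟫ = 0) :
    leftInv A η = 0 := by
  have h1 : adjointReal A η = 0 := by
    refine ext_inner_right ℝ fun v => ?_
    rw [inner_adjointReal, inner_zero_left, real_inner_comm, hη]
  rw [leftInv, ContinuousLinearMap.comp_apply, h1, map_zero]

theorem contDiffAt_leftInv {A : E →L[ℝ] H} (hA : Function.Injective A) {k : ℕ∞ω} :
    ContDiffAt ℝ k (leftInv (E := E) (H := H)) A := by
  obtain ⟨G, hG⟩ := exists_gram_equiv hA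
  have h1 : ContDiff ℝ k fun A : E →L[ℝ] H => adjointReal A :=
    (adjointReal (E := E) (H := H)).contDiff
  have h2 : ContDiff ℝ k fun A : E →L[ℝ] H => (adjointReal A).comp A := h1.clm_comp contDiff_id
  have h3 : ContDiffAt ℝ k (ContinuousLinearMap.inverse (R := ℝ) (M := E) (M₂ := E))
      ((adjointReal A).comp A) := by
    rw [← hG]
    exact contDiffAt_map_inverse G
  exact ContDiffAt.clm_comp (ContDiffAt.comp (f := fun A : E →L[ℝ] H => (adjointReal A).comp A) A h3
    h2.contDiffAt) h1.contDiffAt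

theorem UmbilicalWith.second_deriv_eq {Y : E → H} {x : E} {η : H} (h : UmbilicalWith Y x η)
    (hinj : Function.Injective (fderiv ℝ Y x)) (v w : E) :
    fderiv ℝ (fderiv ℝ Y) x v w =
      fderiv ℝ Y x (leftInv (fderiv ℝ Y x) (fderiv ℝ (fderiv ℝ Y) x v w)) +
        ⟪fderiv ℝ Y x v, fderiv ℝ Y x w⟫ • η := by
  obtain ⟨z, hz⟩ := h.2 v w
  have : leftInv (fderiv ℝ Y x) (fderiv ℝ (fderiv ℝ Y) x v w) = z := by
    rw [hz, map_add, map_smul, leftInv_apply hinj, leftInv_of_orthogonal h.1, smul_zero, add_zero]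
  rw [this, hz]

variable {U : Set E} {Y : E → H} {ζ : E → H}

theorem differentiableAt_umbilicalNormal [Nontrivial E] (hU : IsOpen U) (hY : ContDiffOn ℝ ∞ Y U)
    (hinj : ∀ x ∈ U, Function.Injective (fderiv ℝ Y x)) (hζ : ∀ x ∈ U, UmbilicalWith Y x (ζ x))
    {x : E} (hx : x ∈ U) : DifferentiableAt ℝ ζ x := by
  obtain ⟨e, he⟩ := exists_ne (0 : E)
  have h1 := contDiffAt_fderiv_of_isOpen hU hY hx
  have h2 : ContDiffAt ℝ ∞ (fderiv ℝ (fderiv ℝ Y)) x := h1.fderiv_right (m := ∞) (by simp)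
  have hL : ContDiffAt ℝ ∞ (fun x => leftInv (fderiv ℝ Y x)) x :=
    (contDiffAt_leftInv (hinj x hx)).comp x h1
  have d1 := h1.differentiableAt (by simp)
  have d2 := h2.differentiableAt (by simp)
  have dL := hL.differentiableAt (by simp)
  have dD : DifferentiableAt ℝ (fun x => fderiv ℝ (fderiv ℝ Y) x e e) x :=
    (d2.clm_apply (differentiableAt_const e)).clm_apply (differentiableAt_const e)
  have dY : DifferentiableAt ℝ (fun x => fderiv ℝ Y x e) x := d1.clm_apply (differentiableAt_const e)
  have hne : ∀ y ∈ U, ⟪fderiv ℝ Y y e, fderiv ℝ Y y e⟫ ≠ 0 := fun y hy h0 => by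
    rw [inner_self_eq_zero] at h0
    exact he (hinj y hy (by rw [h0, map_zero]))
  have hd : DifferentiableAt ℝ (fun x => (⟪fderiv ℝ Y x e, fderiv ℝ Y x e⟫)⁻¹ •
      (fderiv ℝ (fderiv ℝ Y) x e e - fderiv ℝ Y x (leftInv (fderiv ℝ Y x)
        (fderiv ℝ (fderiv ℝ Y) x e e)))) x :=
    ((dY.inner ℝ dY).inv (hne x hx)).smul (dD.sub (d1.clm_apply (dL.clm_apply dD)))
  refine hd.congr_of_eventuallyEq ?_
  filter_upwards [hU.mem_nhds hx] with y hy
  rw [eq_inv_smul_iff₀ (hne y hy), eq_sub_iff_add_eq, add_comm]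
  exact ((hζ y hy).second_deriv_eq (hinj y hy) e e).symm

/-- The Codazzi equation: the umbilical normal field is parallel in the normal bundle. -/
theorem fderiv_umbilicalNormal (hE : 2 ≤ finrank ℝ E) (hU : IsOpen U) (hY : ContDiffOn ℝ ∞ Y U)
    (hinj : ∀ x ∈ U, Function.Injective (fderiv ℝ Y x)) (hζ : ∀ x ∈ U, UmbilicalWith Y x (ζ x))
    {x : E} (hx : x ∈ U) (u : E) : fderiv ℝ ζ x u = -(‖ζ x‖ ^ 2) • fderiv ℝ Y x u := by
  have hnt : Nontrivial E := nontrivial_of_finrank_pos (R := ℝ) (by omega)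
  have h1 := contDiffAt_fderiv_of_isOpen hU hY hx
  have h2 : ContDiffAt ℝ ∞ (fderiv ℝ (fderiv ℝ Y)) x := h1.fderiv_right (m := ∞) (by simp)
  have hL : ContDiffAt ℝ ∞ (fun x => leftInv (fderiv ℝ Y x)) x :=
    (contDiffAt_leftInv (hinj x hx)).comp x h1
  have d1 := h1.differentiableAt (by simp)
  have d2 := h2.differentiableAt (by simp)
  have dL := hL.differentiableAt (by simp)
  have dζ := differentiableAt_umbilicalNormal hU hY hinj hζ hx
  have dDw : ∀ w, HasFDerivAt (fun x => fderiv ℝ Y x w)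
      ((fderiv ℝ (fderiv ℝ Y) x).flip w) x := fun w => by
    simpa using! d1.hasFDerivAt.clm_apply (hasFDerivAt_const w x)
  set A := fderiv ℝ Y x with hA
  set B := fderiv ℝ (fderiv ℝ Y) x with hB
  set Γ : E → E → E := fun v w => leftInv A (B v w)
  have hΓ : ∀ v w, B v w = A (Γ v w) + ⟪A v, A w⟫ • ζ x := (hζ x hx).second_deriv_eq (hinj x hx)
  have hN : ∀ u, ⟪A u, ζ x⟫ = 0 := (hζ x hx).1
  have hsymm : ∀ v w, B v w = B w v := second_deriv_symm hU hY hx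
  -- the derivative of the Gauss formula, in a normal direction
  have hcod : ∀ u v w N, (∀ z, ⟪A z, N⟫ = 0) →
      ⟪fderiv ℝ (fun x => fderiv ℝ (fderiv ℝ Y) x v w) x u, N⟫ =
        (⟪A u, A (Γ v w)⟫ + ⟪A (Γ u v), A w⟫ + ⟪A v, A (Γ u w)⟫) * ⟪ζ x, N⟫ +
          ⟪A v, A w⟫ * ⟪fderiv ℝ ζ x u, N⟫ := by
    intro u v w N hNN
    have dΓ : DifferentiableAt ℝ (fun x => leftInv (fderiv ℝ Y x) (fderiv ℝ (fderiv ℝ Y) x v w)) x :=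
      dL.clm_apply ((d2.clm_apply (differentiableAt_const v)).clm_apply (differentiableAt_const w))
    have e1 := d1.hasFDerivAt.clm_apply dΓ.hasFDerivAt
    have e2 := ((dDw v).inner ℝ (dDw w)).smul dζ.hasFDerivAt
    have e3 := e1.add e2
    have e4 : (fun x => fderiv ℝ (fderiv ℝ Y) x v w) =ᶠ[𝓝 x] fun x =>
        fderiv ℝ Y x (leftInv (fderiv ℝ Y x) (fderiv ℝ (fderiv ℝ Y) x v w)) +
        ⟪fderiv ℝ Y x v, fderiv ℝ Y x w⟫ • ζ x := by
      filter_upwards [hU.mem_nhds hx] with y hy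
      exact (hζ y hy).second_deriv_eq (hinj y hy) v w
    have e5 := (e3.congr_of_eventuallyEq e4).fderiv
    rw [e5]
    simp only [add_apply, ContinuousLinearMap.comp_apply,
      smul_apply, ContinuousLinearMap.smulRight_apply,
      ContinuousLinearMap.flip_apply, fderivInnerCLM_apply, ContinuousLinearMap.prod_apply,
      inner_add_left, real_inner_smul_left]
    rw [← hA, ← hB]
    have e6 : ⟪B u (Γ v w), N⟫ = ⟪A u, A (Γ v w)⟫ * ⟪ζ x, N⟫ := by
      rw [hΓ, inner_add_left, hNN, real_inner_smul_left, zero_add]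
    have e7 : ⟪A v, B u w⟫ = ⟪A v, A (Γ u w)⟫ := by
      rw [hΓ, inner_add_right, real_inner_smul_right, hN, mul_zero, add_zero]
    have e8 : ⟪B u v, A w⟫ = ⟪A (Γ u v), A w⟫ := by
      rw [hΓ, inner_add_left, real_inner_smul_left, real_inner_comm, real_inner_comm (A w) (ζ x),
        hN, mul_zero, add_zero, real_inner_comm]
    rw [hNN, e7, e8, show leftInv A (B v w) = Γ v w from rfl, e6]
    ring
  have hthird : ∀ u v w, fderiv ℝ (fun x => fderiv ℝ (fderiv ℝ Y) x v w) x u =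
      fderiv ℝ (fun x => fderiv ℝ (fderiv ℝ Y) x u w) x v := by
    intro u v w
    have hsnd : IsSymmSndFDerivAt ℝ (fun x => fderiv ℝ Y x w) x :=
      (h1.clm_apply contDiffAt_const).isSymmSndFDerivAt two_le_smooth
    have hee : ∀ v, (fun y => fderiv ℝ (fderiv ℝ Y) y v w) =ᶠ[𝓝 x]
        fun y => fderiv ℝ (fun x => fderiv ℝ Y x w) y v := by
      intro v
      filter_upwards [hU.mem_nhds hx] with y hy
      have dy := (contDiffAt_fderiv_of_isOpen hU hY hy).differentiableAt (by simp)
      have := (dy.hasFDerivAt.clm_apply (hasFDerivAt_const w y)).fderiv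
      rw [this]
      simp
    have hd : DifferentiableAt ℝ (fderiv ℝ (fun x => fderiv ℝ Y x w)) x :=
      ((h1.clm_apply contDiffAt_const).fderiv_right (m := ∞) (by simp)).differentiableAt (by simp)
    have happ : ∀ a b, fderiv ℝ (fun y => fderiv ℝ (fun x => fderiv ℝ Y x w) y a) x b =
        fderiv ℝ (fderiv ℝ (fun x => fderiv ℝ Y x w)) x b a := by
      intro a b
      rw [(hd.hasFDerivAt.clm_apply (hasFDerivAt_const a x)).fderiv]
      simp
    rw [(hee v).fderiv_eq, (hee u).fderiv_eq, happ, happ]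
    exact hsnd.eq u v
  -- the derivative of the normal field has no normal component
  have hnormal : ∀ N, (∀ z, ⟪A z, N⟫ = 0) → ⟪fderiv ℝ ζ x u, N⟫ = 0 := by
    intro N hNN
    obtain ⟨v, hv, huv⟩ : ∃ v : E, v ≠ 0 ∧ ⟪A u, A v⟫ = 0 := by
      have hker : 0 < finrank ℝ (LinearMap.ker
          (((innerSL ℝ (A u)).comp A : E →L[ℝ] ℝ) : E →ₗ[ℝ] ℝ)) := by
        have h1 := LinearMap.finrank_range_add_finrank_ker
          (((innerSL ℝ (A u)).comp A : E →L[ℝ] ℝ) : E →ₗ[ℝ] ℝ)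
        have h2 := Submodule.finrank_le (LinearMap.range
          (((innerSL ℝ (A u)).comp A : E →L[ℝ] ℝ) : E →ₗ[ℝ] ℝ))
        rw [finrank_self] at h2
        omega
      obtain ⟨⟨v, hv⟩, hv0⟩ := finrank_pos_iff_exists_ne_zero.1 hker
      exact ⟨v, fun h => hv0 (Subtype.ext h), hv⟩
    have c1 := hcod u v v N hNN
    have c2 := hcod v u v N hNN
    rw [hthird u v v, c2, huv, show Γ v u = Γ u v by simp only [Γ, hsymm]] at c1
    have hvv : ⟪A v, A v⟫ ≠ 0 := fun h0 => by
      rw [inner_self_eq_zero] at h0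
      exact hv (hinj x hx (by rw [← hA, h0, map_zero]))
    have : ⟪A v, A v⟫ * ⟪fderiv ℝ ζ x u, N⟫ = 0 := by linarith
    exact (mul_eq_zero.1 this).resolve_left hvv
  have htan : ∀ w, ⟪fderiv ℝ ζ x u, A w⟫ = -(‖ζ x‖ ^ 2) * ⟪A u, A w⟫ := by
    intro w
    have e1 := ((dDw w).inner ℝ dζ.hasFDerivAt).fderiv
    have e2 : (fun x => ⟪fderiv ℝ Y x w, ζ x⟫) =ᶠ[𝓝 x] fun _ => 0 := by
      filter_upwards [hU.mem_nhds hx] with y hy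
      exact (hζ y hy).1 w
    rw [e2.fderiv_eq] at e1
    have e3 := congrArg (fun f : E →L[ℝ] ℝ => f u) e1
    simp only [fderiv_fun_const, Pi.zero_apply, zero_apply,
      ContinuousLinearMap.comp_apply, fderivInnerCLM_apply, ContinuousLinearMap.prod_apply,
      ContinuousLinearMap.flip_apply] at e3
    rw [hΓ, inner_add_left, hN, real_inner_smul_left, real_inner_self_eq_norm_sq,
      real_inner_comm] at e3
    linarith
  have hmem : fderiv ℝ ζ x u ∈ LinearMap.range (A : E →ₗ[ℝ] H) := by
    rw [← Submodule.orthogonal_orthogonal (LinearMap.range (A : E →ₗ[ℝ] H)),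
      Submodule.mem_orthogonal]
    intro N hN'
    rw [real_inner_comm]
    exact hnormal N fun z => Submodule.inner_right_of_mem_orthogonal
      (K := LinearMap.range (A : E →ₗ[ℝ] H)) (LinearMap.mem_range_self _ z) hN'
  obtain ⟨z, hz⟩ := hmem
  have hz' : A z = fderiv ℝ ζ x u := hz
  have hfin : ⟪fderiv ℝ ζ x u + ‖ζ x‖ ^ 2 • A u, fderiv ℝ ζ x u + ‖ζ x‖ ^ 2 • A u⟫ = 0 := by
    have : fderiv ℝ ζ x u + ‖ζ x‖ ^ 2 • A u = A (z + ‖ζ x‖ ^ 2 • u) := by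
      rw [map_add, map_smul, hz']
    conv_lhs => arg 3; rw [this]
    rw [inner_add_left, htan, real_inner_smul_left]
    ring
  rw [inner_self_eq_zero, add_eq_zero_iff_eq_neg] at hfin
  rw [hfin, neg_smul]

end LocalUmbilical

/-! ### Local constancy of the sphere or plane carrying an umbilical immersion -/

section LocalConstancy

variable {E H : Type*} [NormedAddCommGroup E] [InnerProductSpace ℝ E]
  [NormedAddCommGroup H] [InnerProductSpace ℝ H]

theorem finrank_sup_span_of_orthogonal {H : Type*} [NormedAddCommGroup H] [InnerProductSpace ℝ H]
    [FiniteDimensional ℝ H] {V : Submodule ℝ H} {N : H} (hN : N ∈ Vᗮ) (hN0 : N ≠ 0) :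
    finrank ℝ (V ⊔ Submodule.span ℝ {N} : Submodule ℝ H) = finrank ℝ V + 1 := by
  have hsum := Submodule.finrank_sup_add_finrank_inf_eq V (Submodule.span ℝ {N})
  have hinf : V ⊓ Submodule.span ℝ {N} = ⊥ := by
    rw [Submodule.eq_bot_iff]
    rintro z ⟨hzV, hz⟩
    obtain ⟨a, rfl⟩ := Submodule.mem_span_singleton.1 hz
    have h0 : ⟪a • N, N⟫ = 0 := hN _ hzV
    rw [real_inner_smul_left, real_inner_self_eq_norm_sq, mul_eq_zero] at h0
    rw [h0.resolve_right (pow_ne_zero 2 (norm_ne_zero_iff.2 hN0)), zero_smul]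
  rwa [hinf, finrank_bot, finrank_span_singleton hN0, add_zero] at hsum

/-- The span of the tangent space of `Y` at `x` and of the vector `η`. -/
noncomputable def osculatingSpace (Y : E → H) (x : E) (η : H) : Submodule ℝ H :=
  LinearMap.range (fderiv ℝ Y x : E →ₗ[ℝ] H) ⊔ Submodule.span ℝ {η}

theorem mem_orthogonal_osculatingSpace {Y : E → H} {x : E} {η N : H} :
    N ∈ (osculatingSpace Y x η)ᗮ ↔ (∀ u, ⟪N, fderiv ℝ Y x u⟫ = 0) ∧ ⟪N, η⟫ = 0 := by
  rw [osculatingSpace, ← Submodule.inf_orthogonal, Submodule.mem_inf, Submodule.mem_orthogonal',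
    Submodule.mem_orthogonal_singleton_iff_inner_left]
  refine and_congr_left fun _ => ⟨fun h u => h _ ⟨u, rfl⟩, ?_⟩
  rintro h _ ⟨u, rfl⟩
  exact h u

theorem mem_osculatingSpace_self (Y : E → H) (x : E) (η : H) : η ∈ osculatingSpace Y x η :=
  Submodule.mem_sup_right (Submodule.mem_span_singleton_self η)

variable [FiniteDimensional ℝ E] [FiniteDimensional ℝ H] {U : Set E} {Y : E → H} {ζ : E → H}

/-- A linear differential inequality along a segment. -/
theorem orthogonal_osculatingSpace_of_segment {N : H} {x u : E} {C : ℝ}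
    (hU : IsOpen U) (hY : ContDiffOn ℝ ∞ Y U)
    (hinj : ∀ x ∈ U, Function.Injective (fderiv ℝ Y x)) (hζ : ∀ x ∈ U, UmbilicalWith Y x (ζ x))
    (hdζ : ∀ x ∈ U, HasFDerivAt ζ (-(‖ζ x‖ ^ 2) • fderiv ℝ Y x) x)
    (hseg : ∀ t ∈ Icc (0 : ℝ) 1, x + t • u ∈ U)
    (hC : ∀ t ∈ Icc (0 : ℝ) 1, ‖leftInv (fderiv ℝ Y (x + t • u))‖ ≤ C ∧
      ‖fderiv ℝ (fderiv ℝ Y) (x + t • u)‖ ≤ C ∧ ‖fderiv ℝ Y (x + t • u)‖ ≤ C ∧ ‖ζ (x + t • u)‖ ≤ C)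
    (hN : N ∈ (osculatingSpace Y x (ζ x))ᗮ) : N ∈ (osculatingSpace Y (x + u) (ζ (x + u)))ᗮ := by
  have hC0 : 0 ≤ C := (norm_nonneg _).trans (hC 0 (by simp)).2.2.2
  set L : H →L[ℝ] ℝ := innerSL ℝ N with hL
  set a : ℝ → (E →L[ℝ] ℝ) × ℝ := fun t => (L.comp (fderiv ℝ Y (x + t • u)), L (ζ (x + t • u)))
  set a' : ℝ → (E →L[ℝ] ℝ) × ℝ := fun t => (L.comp (fderiv ℝ (fderiv ℝ Y) (x + t • u) u),
    L ((-(‖ζ (x + t • u)‖ ^ 2) • fderiv ℝ Y (x + t • u)) u))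
  have hline : ∀ t : ℝ, HasDerivAt (fun t : ℝ => x + t • u) u t := fun t => by
    simpa using ((hasDerivAt_id t).smul_const u).const_add x
  have hder : ∀ t ∈ Icc (0 : ℝ) 1, HasDerivAt a (a' t) t := by
    intro t ht
    have hd := ((contDiffAt_fderiv_of_isOpen hU hY (hseg t ht)).differentiableAt
      (by simp)).hasFDerivAt
    have h1 := hd.comp_hasDerivAt t (hline t)
    have h2 := (hdζ _ (hseg t ht)).comp_hasDerivAt t (hline t)
    have h3 : HasDerivAt (fun t => L.comp (fderiv ℝ Y (x + t • u)))
        (L.comp (fderiv ℝ (fderiv ℝ Y) (x + t • u) u)) t :=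
      (ContinuousLinearMap.compL ℝ E H ℝ L).hasFDerivAt.comp_hasDerivAt t h1
    exact h3.prodMk (L.hasFDerivAt.comp_hasDerivAt t h2)
  have hbound : ∀ t ∈ Icc (0 : ℝ) 1, ‖a' t‖ ≤ (2 * C ^ 2 * ‖u‖) * ‖a t‖ := by
    intro t ht
    obtain ⟨c1, c2, c3, c4⟩ := hC t ht
    set y := x + t • u
    have hfst : ‖L.comp (fderiv ℝ Y y)‖ ≤ ‖a t‖ := le_max_left _ _
    have hsnd : ‖L (ζ y)‖ ≤ ‖a t‖ := le_max_right _ _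
    have hu : 0 ≤ C ^ 2 * ‖u‖ * ‖a t‖ := by positivity
    refine max_le ?_ ?_
    · refine ContinuousLinearMap.opNorm_le_bound _ (by positivity) fun w => ?_
      have hsplit := (hζ y (hseg t ht)).second_deriv_eq (hinj y (hseg t ht)) u w
      have e1 : (L.comp (fderiv ℝ (fderiv ℝ Y) y u)) w = (L.comp (fderiv ℝ Y y))
          (leftInv (fderiv ℝ Y y) (fderiv ℝ (fderiv ℝ Y) y u w)) +
            ⟪fderiv ℝ Y y u, fderiv ℝ Y y w⟫ * L (ζ y) := by
        rw [ContinuousLinearMap.comp_apply, hsplit, map_add, map_smul, smul_eq_mul, ← hsplit,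
          ContinuousLinearMap.comp_apply]
      have e2 : ‖leftInv (fderiv ℝ Y y) (fderiv ℝ (fderiv ℝ Y) y u w)‖ ≤ C * (C * ‖u‖ * ‖w‖) :=
        (ContinuousLinearMap.le_of_opNorm_le _ c1 _).trans (mul_le_mul_of_nonneg_left
          (((fderiv ℝ (fderiv ℝ Y) y).le_opNorm₂ u w).trans (by gcongr)) hC0)
      have e3 : ‖(⟪fderiv ℝ Y y u, fderiv ℝ Y y w⟫ : ℝ)‖ ≤ (C * ‖u‖) * (C * ‖w‖) :=
        (norm_inner_le_norm _ _).trans (mul_le_mul (ContinuousLinearMap.le_of_opNorm_le _ c3 _)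
          (ContinuousLinearMap.le_of_opNorm_le _ c3 _) (norm_nonneg _) (by positivity))
      rw [e1]
      refine (norm_add_le _ _).trans ?_
      have e4 := mul_le_mul hfst e2 (norm_nonneg _) (norm_nonneg _)
      have e5 := mul_le_mul e3 hsnd (norm_nonneg _) (by positivity)
      have e6 := (L.comp (fderiv ℝ Y y)).le_opNorm
        (leftInv (fderiv ℝ Y y) (fderiv ℝ (fderiv ℝ Y) y u w))
      rw [norm_mul]
      linarith
    · change ‖L ((-(‖ζ y‖ ^ 2) • fderiv ℝ Y y) u)‖ ≤ _
      have e1 : L ((-(‖ζ y‖ ^ 2) • fderiv ℝ Y y) u) =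
          -(‖ζ y‖ ^ 2) * (L.comp (fderiv ℝ Y y)) u := by
        rw [smul_apply, map_smul, smul_eq_mul, ContinuousLinearMap.comp_apply]
      have e2 := ContinuousLinearMap.le_of_opNorm_le _ hfst u
      have e3 : ‖ζ y‖ ^ 2 ≤ C ^ 2 := by gcongr
      rw [e1, norm_mul, norm_neg, norm_pow, norm_norm]
      have := mul_le_mul e3 e2 (norm_nonneg _) (by positivity)
      linarith
  have ha0 : ‖a 0‖ ≤ 0 := by
    rw [mem_orthogonal_osculatingSpace] at hN
    refine le_of_eq (norm_eq_zero.2 (Prod.ext ?_ ?_))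
    · ext w
      simpa [a, hL] using hN.1 w
    · simpa [a, hL] using hN.2
  have hgr := norm_le_gronwallBound_of_norm_deriv_right_le (f := a) (f' := a') (δ := 0)
    (K := 2 * C ^ 2 * ‖u‖) (ε := 0) (a := 0) (b := 1)
    (fun t ht => (hder t ht).continuousAt.continuousWithinAt)
    (fun t ht => (hder t ⟨ht.1, ht.2.le⟩).hasDerivWithinAt) ha0
    (fun t ht => by simpa using hbound t ⟨ht.1, ht.2.le⟩) 1 (by simp)
  rw [gronwallBound_ε0, zero_mul] at hgr
  have h1 : a 1 = 0 := norm_eq_zero.1 (le_antisymm hgr (norm_nonneg _))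
  rw [mem_orthogonal_osculatingSpace]
  constructor
  · intro w
    have := congrArg (fun b : (E →L[ℝ] ℝ) × ℝ => b.1 w) h1
    simpa [a, hL] using this
  · have := congrArg Prod.snd h1
    simpa [a, hL] using this

/-- The data of the sphere (or plane) that carries an umbilical immersion are locally constant. -/
theorem eventually_umbilical_data_eq (hE : 2 ≤ finrank ℝ E) (hU : IsOpen U)
    (hY : ContDiffOn ℝ ∞ Y U) (hinj : ∀ x ∈ U, Function.Injective (fderiv ℝ Y x))
    (hζ : ∀ x ∈ U, UmbilicalWith Y x (ζ x)) {x₀ : E} (hx₀ : x₀ ∈ U) :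
    ∀ᶠ x in 𝓝 x₀, ‖ζ x‖ = ‖ζ x₀‖ ∧ ‖ζ x‖ ^ 2 • Y x + ζ x = ‖ζ x₀‖ ^ 2 • Y x₀ + ζ x₀ ∧
      osculatingSpace Y x (ζ x) = osculatingSpace Y x₀ (ζ x₀) ∧
      Y x - Y x₀ ∈ osculatingSpace Y x₀ (ζ x₀) := by
  have hnt : Nontrivial E := nontrivial_of_finrank_pos (R := ℝ) (by omega)
  have hdζ : ∀ x ∈ U, HasFDerivAt ζ (-(‖ζ x‖ ^ 2) • fderiv ℝ Y x) x := fun x hx => by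
    convert (differentiableAt_umbilicalNormal hU hY hinj hζ hx).hasFDerivAt
    ext u
    rw [fderiv_umbilicalNormal hE hU hY hinj hζ hx, smul_apply]
  have hdY : ∀ x ∈ U, HasFDerivAt Y (fderiv ℝ Y x) x := fun x hx =>
    ((hY.contDiffAt (hU.mem_nhds hx)).differentiableAt (by simp)).hasFDerivAt
  have h1 := contDiffAt_fderiv_of_isOpen hU hY hx₀
  have h2 : ContDiffAt ℝ ∞ (fderiv ℝ (fderiv ℝ Y)) x₀ := h1.fderiv_right (m := ∞) (by simp)
  have hL : ContDiffAt ℝ ∞ (fun x => leftInv (fderiv ℝ Y x)) x₀ :=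
    (contDiffAt_leftInv (hinj x₀ hx₀)).comp x₀ h1
  set C := ‖leftInv (fderiv ℝ Y x₀)‖ + ‖fderiv ℝ (fderiv ℝ Y) x₀‖ + ‖fderiv ℝ Y x₀‖ + ‖ζ x₀‖ + 1
  have hev : ∀ᶠ x in 𝓝 x₀, x ∈ U ∧ ‖leftInv (fderiv ℝ Y x)‖ ≤ C ∧
      ‖fderiv ℝ (fderiv ℝ Y) x‖ ≤ C ∧ ‖fderiv ℝ Y x‖ ≤ C ∧ ‖ζ x‖ ≤ C := by
    have n1 := norm_nonneg (leftInv (fderiv ℝ Y x₀))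
    have n2 := norm_nonneg (fderiv ℝ (fderiv ℝ Y) x₀)
    have n3 := norm_nonneg (fderiv ℝ Y x₀)
    have n4 := norm_nonneg (ζ x₀)
    have hc2 : ContinuousAt (fun x => ‖fderiv ℝ (fderiv ℝ Y) x‖) x₀ :=
      (continuous_norm (E := E →L[ℝ] E →L[ℝ] H)).continuousAt.comp h2.continuousAt
    refine (hU.eventually_mem hx₀).and ((hL.continuousAt.norm.eventually_le_const ?_).and
      ((hc2.eventually_le_const ?_).and ((h1.continuousAt.norm.eventually_le_const ?_).and
      ((hdζ x₀ hx₀).continuousAt.norm.eventually_le_const ?_)))) <;> linarith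
  obtain ⟨ε, hε, hball⟩ := Metric.eventually_nhds_iff_ball.1 hev
  have hBo : IsOpen (Metric.ball x₀ ε) := Metric.isOpen_ball
  have hBc : IsPreconnected (Metric.ball x₀ ε) := (convex_ball x₀ ε).isPreconnected
  have hx₀B : x₀ ∈ Metric.ball x₀ ε := Metric.mem_ball_self hε
  have hle : ∀ x ∈ Metric.ball x₀ ε, ∀ y ∈ Metric.ball x₀ ε,
      (osculatingSpace Y x (ζ x))ᗮ ≤ (osculatingSpace Y y (ζ y))ᗮ := by
    intro x hx y hy N hN
    have hseg : ∀ t ∈ Icc (0 : ℝ) 1, x + t • (y - x) ∈ Metric.ball x₀ ε := fun t ht =>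
      (convex_ball x₀ ε).add_smul_sub_mem hx hy ht
    have := orthogonal_osculatingSpace_of_segment (u := y - x) hU hY hinj hζ hdζ
      (fun t ht => (hball _ (hseg t ht)).1) (fun t ht => (hball _ (hseg t ht)).2) hN
    rwa [add_sub_cancel] at this
  have hV : ∀ x ∈ Metric.ball x₀ ε, osculatingSpace Y x (ζ x) = osculatingSpace Y x₀ (ζ x₀) := by
    intro x hx
    rw [← Submodule.orthogonal_orthogonal (osculatingSpace Y x (ζ x)),
      le_antisymm (hle x hx x₀ hx₀B) (hle x₀ hx₀B x hx), Submodule.orthogonal_orthogonal]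
  have hk : ∀ x ∈ Metric.ball x₀ ε, ‖ζ x‖ ^ 2 = ‖ζ x₀‖ ^ 2 := by
    intro x hx
    have hd : ∀ y ∈ Metric.ball x₀ ε, HasFDerivAt (fun x => ‖ζ x‖ ^ 2) (0 : E →L[ℝ] ℝ) y := by
      intro y hy
      have := (hdζ y (hball y hy).1).norm_sq
      convert this
      ext u
      simp [real_inner_comm (fderiv ℝ Y y u), (hζ y (hball y hy).1).1 u]
    exact hBo.is_const_of_fderiv_eq_zero hBc
      (fun y hy => (hd y hy).differentiableAt.differentiableWithinAt)
      (fun y hy => (hd y hy).fderiv) hx hx₀B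
  filter_upwards [hBo.mem_nhds hx₀B] with x hx
  refine ⟨(sq_eq_sq₀ (norm_nonneg _) (norm_nonneg _)).1 (hk x hx), ?_, hV x hx, ?_⟩
  · rw [hk x hx]
    have hd : ∀ y ∈ Metric.ball x₀ ε,
        HasFDerivAt (fun x => ‖ζ x₀‖ ^ 2 • Y x + ζ x) (0 : E →L[ℝ] H) y := by
      intro y hy
      have := ((hdY y (hball y hy).1).fun_const_smul (‖ζ x₀‖ ^ 2)).fun_add (hdζ y (hball y hy).1)
      rwa [hk y hy, neg_smul, add_neg_cancel] at this
    exact hBo.is_const_of_fderiv_eq_zero hBc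
      (fun y hy => (hd y hy).differentiableAt.differentiableWithinAt)
      (fun y hy => (hd y hy).fderiv) hx hx₀B
  · rw [← Submodule.orthogonal_orthogonal (osculatingSpace Y x₀ (ζ x₀)), Submodule.mem_orthogonal]
    intro N hN
    have hd : ∀ y ∈ Metric.ball x₀ ε,
        HasFDerivAt (fun x => innerSL ℝ N (Y x)) (0 : E →L[ℝ] ℝ) y := by
      intro y hy
      have h := (innerSL ℝ N).hasFDerivAt.comp y (hdY y (hball y hy).1)
      have h0 : (innerSL ℝ N).comp (fderiv ℝ Y y) = 0 := by
        ext u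
        simpa using (mem_orthogonal_osculatingSpace.1 (hle x₀ hx₀B y hy hN)).1 u
      rwa [h0] at h
    have := hBo.is_const_of_fderiv_eq_zero hBc
      (fun y hy => (hd y hy).differentiableAt.differentiableWithinAt)
      (fun y hy => (hd y hy).fderiv) hx hx₀B
    rw [inner_sub_right, sub_eq_zero]
    simpa using this

end LocalConstancy

/-! ### Second order jets and the conformal map -/

section Jets

variable {E H H' : Type*} [NormedAddCommGroup E] [InnerProductSpace ℝ E]
  [NormedAddCommGroup H] [InnerProductSpace ℝ H] [NormedAddCommGroup H'] [InnerProductSpace ℝ H']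

theorem ContDiffAt.hasFDerivAt_fderiv {F : E → H} {x : E} (hF : ContDiffAt ℝ ∞ F x) :
    HasFDerivAt (fderiv ℝ F) (fderiv ℝ (fderiv ℝ F) x) x :=
  ((hF.fderiv_right (m := ∞) (by simp)).differentiableAt (by simp)).hasFDerivAt

theorem ContDiffAt.hasFDerivAt_fderiv_apply {F : E → H} {x : E} (hF : ContDiffAt ℝ ∞ F x) (w : E) :
    HasFDerivAt (fun y => fderiv ℝ F y w) ((fderiv ℝ (fderiv ℝ F) x).flip w) x := by
  simpa using! hF.hasFDerivAt_fderiv.clm_apply (hasFDerivAt_const w x)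

theorem ContDiffAt.second_deriv_of_eventually {F : E → H} {x : E} (hF : ContDiffAt ℝ ∞ F x) {w : E}
    {φ : E → H} {φ' : E →L[ℝ] H} (hφ : ∀ᶠ y in 𝓝 x, fderiv ℝ F y w = φ y)
    (hφ' : HasFDerivAt φ φ' x) (v : E) : fderiv ℝ (fderiv ℝ F) x v w = φ' v := by
  have h1 := (hF.hasFDerivAt_fderiv_apply w).unique (hφ'.congr_of_eventuallyEq hφ)
  rw [← h1, ContinuousLinearMap.flip_apply]

theorem ContDiffAt.eventually_smooth {F : E → H} {x : E} (hF : ContDiffAt ℝ ∞ F x) :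
    ∀ᶠ y in 𝓝 x, HasFDerivAt F (fderiv ℝ F y) y := by
  have h1 : ContDiffAt ℝ 1 F x := hF.of_le (by exact_mod_cast le_top)
  filter_upwards [h1.eventually (by simp)] with y hy
  exact (hy.differentiableAt (by simp)).hasFDerivAt

theorem fderiv_comp_of_smooth (L : H →L[ℝ] H') {F : E → H} {x : E} (hF : ContDiffAt ℝ ∞ F x) :
    fderiv ℝ (fun y => L (F y)) x = L.comp (fderiv ℝ F x) :=
  (L.hasFDerivAt.comp x (hF.differentiableAt (by simp)).hasFDerivAt).fderiv

theorem second_deriv_comp_of_clm (L : H →L[ℝ] H') {F : E → H} {x : E} (hF : ContDiffAt ℝ ∞ F x)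
    (v w : E) : fderiv ℝ (fderiv ℝ fun y => L (F y)) x v w = L (fderiv ℝ (fderiv ℝ F) x v w) := by
  refine (L.contDiff.contDiffAt.comp x hF : ContDiffAt ℝ ∞ (fun y => L (F y)) x)
    |>.second_deriv_of_eventually (φ := fun y => L (fderiv ℝ F y w)) ?_
    (L.hasFDerivAt.comp x (hF.hasFDerivAt_fderiv_apply w)) v
  filter_upwards [hF.eventually_smooth] with y hy
  have h : HasFDerivAt (L ∘ F) _ y := L.hasFDerivAt.comp y hy
  rw [h.fderiv]
  rfl

section Composition

variable {E' : Type*} [NormedAddCommGroup E'] [InnerProductSpace ℝ E']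

theorem second_deriv_comp {G : E → H} {ψ : E' → E} {x : E'} (hG : ContDiffAt ℝ ∞ G (ψ x))
    (hψ : ContDiffAt ℝ ∞ ψ x) (v w : E') : fderiv ℝ (fderiv ℝ fun y => G (ψ y)) x v w =
      fderiv ℝ (fderiv ℝ G) (ψ x) (fderiv ℝ ψ x v) (fderiv ℝ ψ x w) +
        fderiv ℝ G (ψ x) (fderiv ℝ (fderiv ℝ ψ) x v w) := by
  have hd := (hψ.differentiableAt (by simp)).hasFDerivAt
  have h1 := (hG.hasFDerivAt_fderiv.comp x hd).clm_apply (hψ.hasFDerivAt_fderiv_apply w)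
  have h0 : ContDiffAt ℝ ∞ (fun y => G (ψ y)) x := hG.comp x hψ
  rw [h0.second_deriv_of_eventually (w := w) ?_ h1 v]
  · simp [add_comm]
  · filter_upwards [hψ.eventually_smooth,
      hψ.continuousAt.eventually hG.eventually_smooth] with y hy hy'
    have h : HasFDerivAt (fun y => G (ψ y)) _ y := hy'.comp y hy
    rw [h.fderiv]
    rfl

variable {G : E → H} {ψ : E' → E} {x : E'}

theorem fderiv_comp_apply_of_smooth (hG : ContDiffAt ℝ ∞ G (ψ x)) (hψ : ContDiffAt ℝ ∞ ψ x)
    (v : E') : fderiv ℝ (fun y => G (ψ y)) x v = fderiv ℝ G (ψ x) (fderiv ℝ ψ x v) := by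
  have h : HasFDerivAt (fun y => G (ψ y)) _ x :=
    (hG.differentiableAt (by simp)).hasFDerivAt.comp x (hψ.differentiableAt (by simp)).hasFDerivAt
  rw [h.fderiv]
  rfl

theorem UmbilicalWith.comp {η : H} (h : UmbilicalWith G (ψ x) η) (hG : ContDiffAt ℝ ∞ G (ψ x))
    (hψ : ContDiffAt ℝ ∞ ψ x) (hs : Function.Surjective (fderiv ℝ ψ x)) :
    UmbilicalWith (fun y => G (ψ y)) x η := by
  refine ⟨fun u => by rw [fderiv_comp_apply_of_smooth hG hψ]; exact h.1 _, fun v w => ?_⟩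
  obtain ⟨z, hz⟩ := h.2 (fderiv ℝ ψ x v) (fderiv ℝ ψ x w)
  obtain ⟨z', hz'⟩ := hs (z + fderiv ℝ (fderiv ℝ ψ) x v w)
  refine ⟨z', ?_⟩
  simp only [fderiv_comp_apply_of_smooth hG hψ, second_deriv_comp hG hψ, hz, hz', map_add]
  abel

theorem osculatingSpace_comp (η : H) (hG : ContDiffAt ℝ ∞ G (ψ x))
    (hψ : ContDiffAt ℝ ∞ ψ x) (hs : Function.Surjective (fderiv ℝ ψ x)) :
    osculatingSpace (fun y => G (ψ y)) x η = osculatingSpace G (ψ x) η := by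
  rw [osculatingSpace, osculatingSpace]
  congr 1
  ext z
  constructor
  · rintro ⟨v, rfl⟩
    exact ⟨fderiv ℝ ψ x v, (fderiv_comp_apply_of_smooth hG hψ v).symm⟩
  · rintro ⟨v, rfl⟩
    obtain ⟨v', rfl⟩ := hs v
    exact ⟨v', fderiv_comp_apply_of_smooth hG hψ v'⟩

end Composition

/-- The second derivative of `G` at `x` is, modulo the tangent space of `G` and the space `K`, the
metric times a vector. -/
def WeaklyUmbilicalAt (G : E → H) (K : Submodule ℝ H) (x : E) : Prop :=
  ∃ η, ∀ v w, fderiv ℝ (fderiv ℝ G) x v w - ⟪fderiv ℝ G x v, fderiv ℝ G x w⟫ • η ∈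
    LinearMap.range (fderiv ℝ G x : E →ₗ[ℝ] H) ⊔ K

theorem exists_umbilicalWith [FiniteDimensional ℝ H] {G : E → H} {x : E} {η : H}
    (h : ∀ v w, ∃ z, fderiv ℝ (fderiv ℝ G) x v w =
      fderiv ℝ G x z + ⟪fderiv ℝ G x v, fderiv ℝ G x w⟫ • η) : ∃ η, UmbilicalWith G x η := by
  set R := LinearMap.range (fderiv ℝ G x : E →ₗ[ℝ] H)
  obtain ⟨u, hu⟩ : R.starProjection η ∈ R := Submodule.starProjection_apply_mem _ _
  refine ⟨η - R.starProjection η, fun v => ?_, fun v w => ?_⟩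
  · exact Submodule.inner_right_of_mem_orthogonal (K := R) ⟨v, rfl⟩
      (Submodule.sub_starProjection_mem_orthogonal η)
  · obtain ⟨z, hz⟩ := h v w
    have hu' : fderiv ℝ G x u = R.starProjection η := hu
    refine ⟨z + ⟪fderiv ℝ G x v, fderiv ℝ G x w⟫ • u, ?_⟩
    rw [hz, map_add, map_smul, hu']
    module

section Sphere

variable {X : E → H} {T : E → ℝ} {x : E}

theorem eventually_inner_fderiv_sphere (hX : ContDiffAt ℝ ∞ X x) (h1 : ∀ᶠ y in 𝓝 x, ‖X y‖ = 1)
    (v : E) : ∀ᶠ y in 𝓝 x, ⟪fderiv ℝ X y v, X y⟫ = 0 := by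
  filter_upwards [h1.eventually_nhds, hX.eventually_smooth] with y hy hd
  have h2 := (hd.inner ℝ hd).unique ((hasFDerivAt_const (1 : ℝ) y).congr_of_eventuallyEq (by
    filter_upwards [hy] with y hy
    rw [real_inner_self_eq_norm_sq, hy, one_pow]))
  have h3 := congrArg (fun L : E →L[ℝ] ℝ => L v) h2
  simp only [ContinuousLinearMap.comp_apply, fderivInnerCLM_apply, ContinuousLinearMap.prod_apply,
    zero_apply] at h3
  linarith [real_inner_comm (X y) (fderiv ℝ X y v)]

theorem inner_fderiv_sphere (hX : ContDiffAt ℝ ∞ X x) (h1 : ∀ᶠ y in 𝓝 x, ‖X y‖ = 1) (v : E) :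
    ⟪fderiv ℝ X x v, X x⟫ = 0 :=
  (eventually_inner_fderiv_sphere hX h1 v).self_of_nhds

theorem inner_second_deriv_sphere (hX : ContDiffAt ℝ ∞ X x) (h1 : ∀ᶠ y in 𝓝 x, ‖X y‖ = 1)
    (v w : E) : ⟪fderiv ℝ (fderiv ℝ X) x v w, X x⟫ = -⟪fderiv ℝ X x v, fderiv ℝ X x w⟫ := by
  have hd := (hX.differentiableAt (by simp)).hasFDerivAt
  have h2 := ((hX.hasFDerivAt_fderiv_apply w).inner ℝ hd).unique
    ((hasFDerivAt_const (0 : ℝ) x).congr_of_eventuallyEq (eventually_inner_fderiv_sphere hX h1 w))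
  have h3 := congrArg (fun L : E →L[ℝ] ℝ => L v) h2
  simp only [ContinuousLinearMap.comp_apply, fderivInnerCLM_apply, ContinuousLinearMap.prod_apply,
    zero_apply, ContinuousLinearMap.flip_apply] at h3
  linarith [real_inner_comm (fderiv ℝ X x v) (fderiv ℝ X x w)]

theorem fderiv_exp_smul (hX : ContDiffAt ℝ ∞ X x) (hT : ContDiffAt ℝ ∞ T x) (w : E) :
    fderiv ℝ (fun y => Real.exp (T y) • X y) x w =
      Real.exp (T x) • (fderiv ℝ T x w • X x + fderiv ℝ X x w) := by
  have h := ((hT.differentiableAt (by simp)).hasFDerivAt.exp).fun_smul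
    (hX.differentiableAt (by simp)).hasFDerivAt
  rw [h.fderiv]
  simp only [add_apply, smul_apply, ContinuousLinearMap.smulRight_apply, smul_eq_mul]
  module

theorem second_deriv_exp_smul (hX : ContDiffAt ℝ ∞ X x) (hT : ContDiffAt ℝ ∞ T x) (v w : E) :
    fderiv ℝ (fderiv ℝ fun y => Real.exp (T y) • X y) x v w =
      Real.exp (T x) • ((fderiv ℝ T x v * fderiv ℝ T x w + fderiv ℝ (fderiv ℝ T) x v w) • X x +
        fderiv ℝ T x v • fderiv ℝ X x w + fderiv ℝ T x w • fderiv ℝ X x v +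
        fderiv ℝ (fderiv ℝ X) x v w) := by
  have dX := (hX.differentiableAt (by simp)).hasFDerivAt
  have dT := (hT.differentiableAt (by simp)).hasFDerivAt
  have h := dT.exp.fun_smul (((hT.hasFDerivAt_fderiv_apply w).fun_smul dX).fun_add
    (hX.hasFDerivAt_fderiv_apply w))
  have hY : ContDiffAt ℝ ∞ (fun y => Real.exp (T y) • X y) x := hT.exp.smul hX
  rw [hY.second_deriv_of_eventually ?_ h v]
  · simp only [add_apply, smul_apply, ContinuousLinearMap.smulRight_apply, smul_eq_mul,
      ContinuousLinearMap.flip_apply]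
    module
  · filter_upwards [hX.eventually_smooth, hT.eventually_smooth] with y hy hy'
    rw [(hy'.exp.fun_smul hy).fderiv]
    simp only [add_apply, smul_apply, ContinuousLinearMap.smulRight_apply, smul_eq_mul]
    module

theorem inner_fderiv_exp_smul (hX : ContDiffAt ℝ ∞ X x) (hT : ContDiffAt ℝ ∞ T x)
    (h1 : ∀ᶠ y in 𝓝 x, ‖X y‖ = 1) (v w : E) :
    ⟪fderiv ℝ (fun y => Real.exp (T y) • X y) x v, fderiv ℝ (fun y => Real.exp (T y) • X y) x w⟫ =
      Real.exp (T x) ^ 2 *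
        (⟪fderiv ℝ X x v, fderiv ℝ X x w⟫ + fderiv ℝ T x v * fderiv ℝ T x w) := by
  rw [fderiv_exp_smul hX hT, fderiv_exp_smul hX hT]
  simp only [inner_add_left, inner_add_right, real_inner_smul_left, real_inner_smul_right,
    inner_fderiv_sphere hX h1, real_inner_comm (fderiv ℝ X x w) (X x),
    real_inner_self_eq_norm_sq, h1.self_of_nhds]
  ring

theorem injective_fderiv_exp_smul (hX : ContDiffAt ℝ ∞ X x) (hT : ContDiffAt ℝ ∞ T x)
    (h1 : ∀ᶠ y in 𝓝 x, ‖X y‖ = 1)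
    (hinj : ∀ v, fderiv ℝ X x v = 0 → fderiv ℝ T x v = 0 → v = 0) :
    Function.Injective (fderiv ℝ (fun y => Real.exp (T y) • X y) x) := by
  rw [injective_iff_map_eq_zero]
  intro v hv
  have h := inner_fderiv_exp_smul hX hT h1 v v
  rw [hv, inner_zero_left, eq_comm, mul_eq_zero] at h
  have h' := h.resolve_left (by positivity)
  rw [real_inner_self_eq_norm_sq] at h'
  exact hinj v (norm_eq_zero.1 (by nlinarith [norm_nonneg (fderiv ℝ X x v)])) (by nlinarith)

/-- An umbilical map into `𝕊 × ℝ` stays umbilical after the conformal map `(x, t) ↦ eᵗ x`. -/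
theorem second_deriv_exp_smul_of_umbilical (hX : ContDiffAt ℝ ∞ X x) (hT : ContDiffAt ℝ ∞ T x)
    (h1 : ∀ᶠ y in 𝓝 x, ‖X y‖ = 1) {η₁ : H} {η₂ a : ℝ} {v w z : E}
    (e1 : fderiv ℝ (fderiv ℝ X) x v w = fderiv ℝ X x z +
      (⟪fderiv ℝ X x v, fderiv ℝ X x w⟫ + fderiv ℝ T x v * fderiv ℝ T x w) • η₁ + a • X x)
    (e2 : fderiv ℝ (fderiv ℝ T) x v w = fderiv ℝ T x z +
      (⟪fderiv ℝ X x v, fderiv ℝ X x w⟫ + fderiv ℝ T x v * fderiv ℝ T x w) * η₂) :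
    fderiv ℝ (fderiv ℝ fun y => Real.exp (T y) • X y) x v w =
      fderiv ℝ (fun y => Real.exp (T y) • X y) x (z + fderiv ℝ T x v • w + fderiv ℝ T x w • v) +
      ⟪fderiv ℝ (fun y => Real.exp (T y) • X y) x v, fderiv ℝ (fun y => Real.exp (T y) • X y) x w⟫ •
        (Real.exp (T x))⁻¹ • (η₁ + (η₂ - 1 - ⟪η₁, X x⟫) • X x) := by
  have ha := inner_second_deriv_sphere hX h1 v w
  rw [e1, inner_add_left, inner_add_left, inner_fderiv_sphere hX h1, real_inner_smul_left,
    real_inner_smul_left, real_inner_self_eq_norm_sq, h1.self_of_nhds] at ha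
  rw [inner_fderiv_exp_smul hX hT h1, second_deriv_exp_smul hX hT, e1, e2, map_add, map_add,
    map_smul, map_smul, fderiv_exp_smul hX hT, fderiv_exp_smul hX hT, fderiv_exp_smul hX hT]
  have he : Real.exp (T x) ^ 2 * (Real.exp (T x))⁻¹ = Real.exp (T x) := by
    rw [sq, mul_assoc, mul_inv_cancel₀ (Real.exp_pos _).ne', mul_one]
  set g := ⟪fderiv ℝ X x v, fderiv ℝ X x w⟫ + fderiv ℝ T x v * fderiv ℝ T x w with hg
  have hfin : ∀ B : H, (Real.exp (T x) ^ 2 * g) • (Real.exp (T x))⁻¹ • B =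
      (Real.exp (T x) * g) • B := fun B => by
    rw [smul_smul, mul_right_comm, he]
  have ha' : a = -⟪fderiv ℝ X x v, fderiv ℝ X x w⟫ - g * ⟪η₁, X x⟫ := by linarith
  rw [hfin, ha', hg]
  module

/-- The converse: umbilicity can be checked after the conformal map. -/
theorem second_deriv_of_umbilical_exp_smul (hX : ContDiffAt ℝ ∞ X x) (hT : ContDiffAt ℝ ∞ T x)
    (h1 : ∀ᶠ y in 𝓝 x, ‖X y‖ = 1) {η : H} {v w z : E}
    (e : fderiv ℝ (fderiv ℝ fun y => Real.exp (T y) • X y) x v w =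
      fderiv ℝ (fun y => Real.exp (T y) • X y) x z +
      ⟪fderiv ℝ (fun y => Real.exp (T y) • X y) x v,
        fderiv ℝ (fun y => Real.exp (T y) • X y) x w⟫ • η) :
    fderiv ℝ (fderiv ℝ T) x v w =
      fderiv ℝ T x (z - fderiv ℝ T x v • w - fderiv ℝ T x w • v) +
      (⟪fderiv ℝ X x v, fderiv ℝ X x w⟫ + fderiv ℝ T x v * fderiv ℝ T x w) *
        (Real.exp (T x) * ⟪η, X x⟫ + 1) ∧
    ∃ a : ℝ, fderiv ℝ (fderiv ℝ X) x v w =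
      fderiv ℝ X x (z - fderiv ℝ T x v • w - fderiv ℝ T x w • v) +
      (⟪fderiv ℝ X x v, fderiv ℝ X x w⟫ + fderiv ℝ T x v * fderiv ℝ T x w) •
        Real.exp (T x) • η + a • X x := by
  rw [inner_fderiv_exp_smul hX hT h1, second_deriv_exp_smul hX hT, fderiv_exp_smul hX hT] at e
  set g := ⟪fderiv ℝ X x v, fderiv ℝ X x w⟫ + fderiv ℝ T x v * fderiv ℝ T x w with hg
  have he : (fderiv ℝ T x v * fderiv ℝ T x w + fderiv ℝ (fderiv ℝ T) x v w) • X x +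
        fderiv ℝ T x v • fderiv ℝ X x w + fderiv ℝ T x w • fderiv ℝ X x v +
        fderiv ℝ (fderiv ℝ X) x v w =
      fderiv ℝ T x z • X x + fderiv ℝ X x z + (Real.exp (T x) * g) • η := by
    refine smul_right_injective H (Real.exp_pos (T x)).ne' ?_
    simp only
    rw [e]
    module
  have hi := congrArg (fun y => ⟪y, X x⟫) he
  simp only [inner_add_left, real_inner_smul_left, inner_fderiv_sphere hX h1,
    inner_second_deriv_sphere hX h1, real_inner_self_eq_norm_sq, h1.self_of_nhds] at hi
  refine ⟨?_, fderiv ℝ T x z - (fderiv ℝ T x v * fderiv ℝ T x w + fderiv ℝ (fderiv ℝ T) x v w), ?_⟩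
  · simp only [map_sub, map_smul, smul_eq_mul]
    linear_combination hi - hg
  · simp only [map_sub, map_smul]
    have := eq_sub_of_add_eq' he
    rw [this]
    module

end Sphere

end Jets

/-! ### Umbilical maps of a connected manifold -/

section Charts

variable (m : ℕ) {M : Type*} [TopologicalSpace M] [ChartedSpace (EuclideanSpace ℝ (Fin m)) M]
  {H : Type*} [NormedAddCommGroup H] [InnerProductSpace ℝ H]

/-- A map read in the preferred chart at `p`. -/
noncomputable def chartRep (g : M → H) (p : M) : EuclideanSpace ℝ (Fin m) → H :=
  fun y => g ((extChartAt (𝓡 m) p).symm y)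

/-- The change of coordinates between the preferred charts at `p` and at `q`. -/
noncomputable def coordChange (p q : M) : EuclideanSpace ℝ (Fin m) → EuclideanSpace ℝ (Fin m) :=
  fun y => extChartAt (𝓡 m) q ((extChartAt (𝓡 m) p).symm y)

variable {m}

theorem chartRep_eventuallyEq {F : Type*} (g : M → F) {p q : M} (hq : q ∈ (extChartAt (𝓡 m) p).source) :
    chartRep m g p =ᶠ[𝓝 (extChartAt (𝓡 m) p q)] fun y => chartRep m g q (coordChange m p q y) := by
  have hs : ∀ᶠ y in 𝓝 (extChartAt (𝓡 m) p q),
      (extChartAt (𝓡 m) p).symm y ∈ (extChartAt (𝓡 m) q).source := by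
    refine (continuousAt_extChartAt_symm' hq).eventually_mem ?_
    rw [(extChartAt (𝓡 m) p).left_inv hq]
    exact (isOpen_extChartAt_source q).mem_nhds (mem_extChartAt_source q)
  filter_upwards [hs] with y hy
  rw [chartRep, chartRep, coordChange, (extChartAt (𝓡 m) q).left_inv hy]

variable [IsManifold (𝓡 m) ∞ M] {g : M → H}

theorem contDiffOn_chartRep (hg : ContMDiff (𝓡 m) 𝓘(ℝ, H) ∞ g) (p : M) :
    ContDiffOn ℝ ∞ (chartRep m g p) (extChartAt (𝓡 m) p).target :=
  (hg.comp_contMDiffOn (contMDiffOn_extChartAt_symm p)).contDiffOn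

theorem contDiffAt_chartRep (hg : ContMDiff (𝓡 m) 𝓘(ℝ, H) ∞ g) {p : M}
    {x : EuclideanSpace ℝ (Fin m)} (hx : x ∈ (extChartAt (𝓡 m) p).target) :
    ContDiffAt ℝ ∞ (chartRep m g p) x :=
  (contDiffOn_chartRep hg p).contDiffAt ((isOpen_extChartAt_target p).mem_nhds hx)

theorem contDiffAt_coordChange {p q : M} (hq : q ∈ (extChartAt (𝓡 m) p).source) :
    ContDiffAt ℝ ∞ (coordChange m p q)
      (extChartAt (𝓡 m) p q) := by
  have h := contDiffWithinAt_ext_coord_change (n := ∞) (I := 𝓡 m) q p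
    (y := extChartAt (𝓡 m) p q) (by
      rw [PartialEquiv.trans_source, PartialEquiv.symm_source]
      refine ⟨(extChartAt (𝓡 m) p).map_source hq, ?_⟩
      rw [mem_preimage, (extChartAt (𝓡 m) p).left_inv hq]
      exact mem_extChartAt_source q)
  rwa [ModelWithCorners.range_eq_univ, contDiffWithinAt_univ] at h

theorem contDiffAt_coordChange' {p q : M} (hq : q ∈ (extChartAt (𝓡 m) p).source) :
    ContDiffAt ℝ ∞ (coordChange m q p)
      (extChartAt (𝓡 m) q q) := by
  have h := contDiffWithinAt_ext_coord_change (n := ∞) (I := 𝓡 m) p q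
    (y := extChartAt (𝓡 m) q q) (by
      rw [PartialEquiv.trans_source, PartialEquiv.symm_source]
      refine ⟨mem_extChartAt_target q, ?_⟩
      rw [mem_preimage, extChartAt_to_inv]
      exact hq)
  rwa [ModelWithCorners.range_eq_univ, contDiffWithinAt_univ] at h

theorem surjective_fderiv_coordChange {p q : M} (hq : q ∈ (extChartAt (𝓡 m) p).source) :
    Function.Surjective (fderiv ℝ (coordChange m p q) (extChartAt (𝓡 m) p q)) := by
  have h1 := contDiffAt_coordChange hq
  have h2 := contDiffAt_coordChange' hq
  have e1 : coordChange m q p (extChartAt (𝓡 m) q q) = extChartAt (𝓡 m) p q := by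
    rw [coordChange, extChartAt_to_inv]
  have h1' := h1
  rw [← e1] at h1'
  have hev : (fun y => coordChange m p q (coordChange m q p y)) =ᶠ[𝓝 (extChartAt (𝓡 m) q q)] id := by
    have hs : ∀ᶠ y in 𝓝 (extChartAt (𝓡 m) q q),
        (extChartAt (𝓡 m) q).symm y ∈ (extChartAt (𝓡 m) p).source := by
      refine (continuousAt_extChartAt_symm q).eventually_mem ?_
      rw [extChartAt_to_inv]
      exact (isOpen_extChartAt_source p).mem_nhds hq
    filter_upwards [hs, (isOpen_extChartAt_target q).mem_nhds (mem_extChartAt_target q)] with y hy hy'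
    rw [coordChange, coordChange, (extChartAt (𝓡 m) p).left_inv hy,
      (extChartAt (𝓡 m) q).right_inv hy', id]
  intro v
  refine ⟨fderiv ℝ (coordChange m q p) (extChartAt (𝓡 m) q q) v, ?_⟩
  have h3 := fderiv_comp_apply_of_smooth h1' h2 v
  rw [hev.fderiv_eq, fderiv_id, e1] at h3
  exact h3.symm

theorem UmbilicalWith.congr {E : Type*} [NormedAddCommGroup E] [InnerProductSpace ℝ E]
    {Y Y' : E → H} {x : E} {η : H} (h : UmbilicalWith Y x η) (he : Y' =ᶠ[𝓝 x] Y) :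
    UmbilicalWith Y' x η := by
  rw [UmbilicalWith, he.fderiv.fderiv_eq, he.fderiv_eq]
  exact h

theorem osculatingSpace_congr {E : Type*} [NormedAddCommGroup E] [InnerProductSpace ℝ E]
    {Y Y' : E → H} {x : E} (η : H) (he : Y' =ᶠ[𝓝 x] Y) :
    osculatingSpace Y' x η = osculatingSpace Y x η := by
  rw [osculatingSpace, he.fderiv_eq, osculatingSpace]

theorem umbilicalWith_chartRep_of_center (hg : ContMDiff (𝓡 m) 𝓘(ℝ, H) ∞ g) {p q : M}
    (hq : q ∈ (extChartAt (𝓡 m) p).source) {η : H}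
    (h : UmbilicalWith (chartRep m g q) (extChartAt (𝓡 m) q q) η)
    (hinj : Function.Injective (fderiv ℝ (chartRep m g q) (extChartAt (𝓡 m) q q))) :
    UmbilicalWith (chartRep m g p) (extChartAt (𝓡 m) p q) η ∧
    Function.Injective (fderiv ℝ (chartRep m g p) (extChartAt (𝓡 m) p q)) ∧
    osculatingSpace (chartRep m g p) (extChartAt (𝓡 m) p q) η =
      osculatingSpace (chartRep m g q) (extChartAt (𝓡 m) q q) η := by
  have hψ := contDiffAt_coordChange hq
  have hs := surjective_fderiv_coordChange hq
  have he := chartRep_eventuallyEq g hq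
  have e1 : coordChange m p q (extChartAt (𝓡 m) p q) = extChartAt (𝓡 m) q q := by
    rw [coordChange, (extChartAt (𝓡 m) p).left_inv hq]
  have hG : ContDiffAt ℝ ∞ (chartRep m g q) (coordChange m p q (extChartAt (𝓡 m) p q)) := by
    rw [e1]
    exact contDiffAt_chartRep hg (mem_extChartAt_target q)
  rw [← e1] at h hinj ⊢
  refine ⟨(h.comp hG hψ hs).congr he, ?_,
    (osculatingSpace_congr η he).trans (osculatingSpace_comp η hG hψ hs)⟩
  rw [he.fderiv_eq]
  intro v w hvw
  rw [fderiv_comp_apply_of_smooth hG hψ, fderiv_comp_apply_of_smooth hG hψ] at hvw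
  exact (LinearMap.injective_iff_surjective.2 hs) (hinj hvw)

/-- An umbilical map of a connected manifold lies in a plane or in a sphere of its dimension. -/
theorem exists_plane_or_sphere [FiniteDimensional ℝ H] [ConnectedSpace M] (hm : 2 ≤ m)
    (hg : ContMDiff (𝓡 m) 𝓘(ℝ, H) ∞ g)
    (hinj : ∀ p, Function.Injective (fderiv ℝ (chartRep m g p) (extChartAt (𝓡 m) p p)))
    (humb : ∀ p, ∃ η, UmbilicalWith (chartRep m g p) (extChartAt (𝓡 m) p p) η) :
    (∃ V : Submodule ℝ H, finrank ℝ V = m ∧ ∀ p q, g p - g q ∈ V) ∨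
    ∃ (W : Submodule ℝ H) (c : H) (ρ : ℝ), finrank ℝ W = m + 1 ∧ 0 < ρ ∧
      ∀ p, g p - c ∈ W ∧ ‖g p - c‖ = ρ := by
  choose ζ hζ using humb
  have hloc : ∀ p, ∀ᶠ q in 𝓝 p, ‖ζ q‖ = ‖ζ p‖ ∧
      ‖ζ q‖ ^ 2 • g q + ζ q = ‖ζ p‖ ^ 2 • g p + ζ p ∧
      osculatingSpace (chartRep m g q) (extChartAt (𝓡 m) q q) (ζ q) =
        osculatingSpace (chartRep m g p) (extChartAt (𝓡 m) p p) (ζ p) ∧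
      g q - g p ∈ osculatingSpace (chartRep m g p) (extChartAt (𝓡 m) p p) (ζ p) := by
    intro p
    have hE : 2 ≤ finrank ℝ (EuclideanSpace ℝ (Fin m)) := by simpa using hm
    have htr : ∀ x ∈ (extChartAt (𝓡 m) p).target,
        UmbilicalWith (chartRep m g p) x (ζ ((extChartAt (𝓡 m) p).symm x)) ∧
        Function.Injective (fderiv ℝ (chartRep m g p) x) := by
      intro x hx
      have h := umbilicalWith_chartRep_of_center hg ((extChartAt (𝓡 m) p).map_target hx)
        (hζ _) (hinj _)
      rw [(extChartAt (𝓡 m) p).right_inv hx] at h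
      exact ⟨h.1, h.2.1⟩
    have hmain := eventually_umbilical_data_eq (ζ := fun x => ζ ((extChartAt (𝓡 m) p).symm x)) hE
      (isOpen_extChartAt_target p) (contDiffOn_chartRep hg p) (fun x hx => (htr x hx).2)
      (fun x hx => (htr x hx).1) (mem_extChartAt_target p)
    have hpull := (continuousAt_extChartAt (I := 𝓡 m) p).eventually hmain
    filter_upwards [hpull, (isOpen_extChartAt_source (I := 𝓡 m) p).mem_nhds
      (mem_extChartAt_source p)] with q hq hqs
    simp only [chartRep, (extChartAt (𝓡 m) p).left_inv hqs, extChartAt_to_inv] at hq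
    have h := umbilicalWith_chartRep_of_center hg hqs (hζ _) (hinj _)
    exact ⟨hq.1, hq.2.1, h.2.2.symm.trans hq.2.2.1, hq.2.2.2⟩
  obtain ⟨p₀⟩ : Nonempty M := inferInstance
  have hk : ∀ p, ‖ζ p‖ = ‖ζ p₀‖ := fun p =>
    ((IsLocallyConstant.iff_eventually_eq _).2 fun p => (hloc p).mono fun q hq => hq.1)
      |>.apply_eq_of_preconnectedSpace p p₀
  have hc : ∀ p, ‖ζ p‖ ^ 2 • g p + ζ p = ‖ζ p₀‖ ^ 2 • g p₀ + ζ p₀ := fun p =>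
    ((IsLocallyConstant.iff_eventually_eq (fun p => ‖ζ p‖ ^ 2 • g p + ζ p)).2
      fun p => (hloc p).mono fun q hq => hq.2.1) |>.apply_eq_of_preconnectedSpace p p₀
  set V := osculatingSpace (chartRep m g p₀) (extChartAt (𝓡 m) p₀ p₀) (ζ p₀) with hVdef
  have hV : ∀ p, osculatingSpace (chartRep m g p) (extChartAt (𝓡 m) p p) (ζ p) = V := fun p =>
    ((IsLocallyConstant.iff_eventually_eq
      (fun p => osculatingSpace (chartRep m g p) (extChartAt (𝓡 m) p p) (ζ p))).2
      fun p => (hloc p).mono fun q hq => hq.2.2.1) |>.apply_eq_of_preconnectedSpace p p₀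
  have hmem : ∀ p q, g p - g q ∈ V := fun p q => by
    rw [← Submodule.Quotient.eq V]
    refine ((IsLocallyConstant.iff_eventually_eq
      (fun p => (Submodule.Quotient.mk (g p) : H ⧸ V))).2
      fun p => (hloc p).mono fun q hq => ?_) |>.apply_eq_of_preconnectedSpace p q
    rw [Submodule.Quotient.eq V, ← hV p]
    exact hq.2.2.2
  have hR : finrank ℝ (LinearMap.range (fderiv ℝ (chartRep m g p₀) (extChartAt (𝓡 m) p₀ p₀) :
      EuclideanSpace ℝ (Fin m) →ₗ[ℝ] H)) = m := by
    rw [LinearMap.finrank_range_of_inj (hinj p₀), finrank_euclideanSpace_fin]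
  by_cases hk0 : ζ p₀ = 0
  · refine Or.inl ⟨V, ?_, hmem⟩
    rw [hVdef, hk0, osculatingSpace, Submodule.span_zero_singleton, sup_bot_eq, hR]
  · have hk1 : ‖ζ p₀‖ ≠ 0 := norm_ne_zero_iff.2 hk0
    refine Or.inr ⟨V, g p₀ + (‖ζ p₀‖ ^ 2)⁻¹ • ζ p₀, ‖ζ p₀‖⁻¹, ?_, by positivity, fun p => ?_⟩
    · rw [hVdef, osculatingSpace, finrank_sup_span_of_orthogonal ?_ hk0, hR]
      rintro _ ⟨v, rfl⟩
      exact (hζ p₀).1 v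
    · have h1 : g p - (g p₀ + (‖ζ p₀‖ ^ 2)⁻¹ • ζ p₀) = -(‖ζ p₀‖ ^ 2)⁻¹ • ζ p := by
        have h2 := hc p
        rw [hk p] at h2
        have h3 : g p₀ + (‖ζ p₀‖ ^ 2)⁻¹ • ζ p₀ = g p + (‖ζ p₀‖ ^ 2)⁻¹ • ζ p := by
          have := congrArg (fun y => (‖ζ p₀‖ ^ 2)⁻¹ • y) h2
          simp only [smul_add, inv_smul_smul₀ (pow_ne_zero 2 hk1)] at this
          exact this.symm
        rw [h3]
        module
      rw [h1]
      refine ⟨V.smul_mem _ ?_, ?_⟩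
      · rw [← hV p]
        exact mem_osculatingSpace_self _ _ _
      · rw [norm_smul, hk p, norm_neg, norm_inv, norm_pow, norm_norm]
        field_simp

end Charts

/-! ### Immersions into `𝕊ⁿ × ℝ` and the conformal map -/

section Immersion

variable {m n : ℕ} {M : Type*} [TopologicalSpace M] [ChartedSpace (EuclideanSpace ℝ (Fin m)) M]
  {f : M → SphR n}

theorem contMDiff_toAmb {k : ℕ∞ω} : ContMDiff (modelSphR n) 𝓘(ℝ, Amb n) k (toAmb (n := n)) := by
  have h1 : ContMDiff (modelSphR n) 𝓘(ℝ, EuclideanSpace ℝ (Fin (n + 1))) k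
      fun p : SphR n => (p.1 : EuclideanSpace ℝ (Fin (n + 1))) :=
    contMDiff_coe_sphere.comp contMDiff_fst
  have h2 : ContMDiff (modelSphR n) 𝓘(ℝ, ℝ) k fun p : SphR n => p.2 := contMDiff_snd
  have h3 : ContDiff ℝ k fun z : EuclideanSpace ℝ (Fin (n + 1)) × ℝ =>
      (WithLp.toLp 2 z : Amb n) :=
    (WithLp.prodContinuousLinearEquiv 2 ℝ (EuclideanSpace ℝ (Fin (n + 1))) ℝ).symm.contDiff
  exact h3.contMDiff.comp (h1.prodMk_space h2)

theorem injective_mfderiv_toAmb (p : SphR n) :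
    Function.Injective (mfderiv (modelSphR n) 𝓘(ℝ, Amb n) (toAmb (n := n)) p) := by
  have hd : MDifferentiableAt (modelSphR n) 𝓘(ℝ, Amb n) (toAmb (n := n)) p :=
    (contMDiff_toAmb (k := 1)).mdifferentiable (by simp) p
  rw [injective_iff_map_eq_zero]
  intro v hv
  have h1 : mfderiv (modelSphR n) 𝓘(ℝ, EuclideanSpace ℝ (Fin (n + 1)))
      (WithLp.fstL 2 ℝ (EuclideanSpace ℝ (Fin (n + 1))) ℝ ∘ toAmb (n := n)) p v = 0 := by
    rw [mfderiv_comp p (WithLp.fstL 2 ℝ (EuclideanSpace ℝ (Fin (n + 1))) ℝ).mdifferentiableAt hd]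
    change mfderiv _ _ _ _ (mfderiv (modelSphR n) 𝓘(ℝ, Amb n) (toAmb (n := n)) p v) = 0
    rw [hv, map_zero]
  have h2 : mfderiv (modelSphR n) 𝓘(ℝ, ℝ)
      (WithLp.sndL 2 ℝ (EuclideanSpace ℝ (Fin (n + 1))) ℝ ∘ toAmb (n := n)) p v = 0 := by
    rw [mfderiv_comp p (WithLp.sndL 2 ℝ (EuclideanSpace ℝ (Fin (n + 1))) ℝ).mdifferentiableAt hd]
    change mfderiv _ _ _ _ (mfderiv (modelSphR n) 𝓘(ℝ, Amb n) (toAmb (n := n)) p v) = 0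
    rw [hv, map_zero]
  have h1' : (WithLp.fstL 2 ℝ (EuclideanSpace ℝ (Fin (n + 1))) ℝ ∘ toAmb (n := n)) =
      (Subtype.val : Sph n → EuclideanSpace ℝ (Fin (n + 1))) ∘ Prod.fst := rfl
  have h2' : (WithLp.sndL 2 ℝ (EuclideanSpace ℝ (Fin (n + 1))) ℝ ∘ toAmb (n := n)) =
      Prod.snd := rfl
  rw [h1', mfderiv_comp p ((contMDiff_coe_sphere (m := 1)).mdifferentiable (by simp) _)
    mdifferentiableAt_fst, mfderiv_fst] at h1
  rw [h2', mfderiv_snd] at h2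
  refine Prod.ext ?_ h2
  exact mfderiv_coe_sphere_injective p.1 (h1.trans (map_zero _).symm)

theorem mfderiv_toAmb_comp_eq (hf : ContMDiff (𝓡 m) (modelSphR n) ∞ f) (p : M)
    (v : EuclideanSpace ℝ (Fin m)) : dImm m f p v =
      mfderiv (modelSphR n) 𝓘(ℝ, Amb n) (toAmb (n := n)) (f p) (mfderiv (𝓡 m) (modelSphR n) f p v) := by
  have hfd := hf.mdifferentiable (by simp) p
  have hd : MDifferentiableAt (modelSphR n) 𝓘(ℝ, Amb n) (toAmb (n := n)) (f p) :=
    (contMDiff_toAmb (k := 1)).mdifferentiable (by simp) (f p)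
  have h1 : mfderiv (𝓡 m) 𝓘(ℝ, Amb n) (toAmb ∘ f) p = dImm m f p := by
    rw [(hd.comp p hfd).mfderiv, dImm, ModelWithCorners.range_eq_univ, fderivWithin_univ]
    rfl
  rw [← h1, mfderiv_comp p hd hfd]
  rfl

theorem IsSmoothImmersion.injective_dImm (hf : IsSmoothImmersion m f) (p : M) :
    Function.Injective (dImm m f p) := by
  intro v w h
  rw [mfderiv_toAmb_comp_eq hf.contMDiff, mfderiv_toAmb_comp_eq hf.contMDiff] at h
  exact hf.injective_mfderiv p (injective_mfderiv_toAmb _ h)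

theorem isSmoothImmersion_of_injective_dImm (hf : ContMDiff (𝓡 m) (modelSphR n) ∞ f)
    (hinj : ∀ p, Function.Injective (dImm m f p)) : IsSmoothImmersion m f := by
  refine ⟨hf, fun p v w h => hinj p ?_⟩
  exact (mfderiv_toAmb_comp_eq hf p v).trans ((congrArg _ h).trans
    (mfderiv_toAmb_comp_eq hf p w).symm)

theorem isUmbilical_iff : IsUmbilical m f ↔ ∀ p, WeaklyUmbilicalAt (localRep m f p)
    (Submodule.span ℝ {nuAmb (f p)}) (extChartAt (𝓡 m) p p) := by
  constructor
  · rintro ⟨ζ, hζ⟩ p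
    refine ⟨ζ p, fun v w => ?_⟩
    obtain ⟨h1, h2⟩ := hζ p
    have h3 := h2 v w
    rw [secondFundamentalForm, dImm] at h3
    rw [← Submodule.orthogonal_orthogonal (_ ⊔ _), ← Submodule.starProjection_apply_eq_zero_iff,
      map_sub, map_smul]
    change (normalSpace m f p).starProjection _ - _ • (normalSpace m f p).starProjection _ = 0
    rw [h3, Submodule.starProjection_eq_self_iff.2 h1, sub_self]
  · intro h
    choose η hη using h
    refine ⟨fun p => (normalSpace m f p).starProjection (η p), fun p =>
      ⟨Submodule.starProjection_apply_mem _ _, fun v w => ?_⟩⟩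
    have h1 := hη p v w
    rw [← Submodule.orthogonal_orthogonal (_ ⊔ _), ← Submodule.starProjection_apply_eq_zero_iff,
      map_sub, map_smul, sub_eq_zero] at h1
    exact h1

theorem chartRep_conformalMap (p : M) : chartRep m (fun q => conformalMap (f q)) p =
    fun y => Real.exp (localRep m f p y).snd • (localRep m f p y).fst := rfl

theorem eventually_norm_localRep_fst (p : M) :
    ∀ᶠ y in 𝓝 (extChartAt (𝓡 m) p p), ‖(localRep m f p y).fst‖ = 1 :=
  Eventually.of_forall fun _ => norm_sph _

variable [IsManifold (𝓡 m) ∞ M]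

theorem contDiffAt_localRep (hf : ContMDiff (𝓡 m) (modelSphR n) ∞ f) (p : M) :
    ContDiffAt ℝ ∞ (localRep m f p) (extChartAt (𝓡 m) p p) :=
  contDiffAt_chartRep (contMDiff_toAmb.comp hf) (mem_extChartAt_target p)

theorem contDiffAt_localRep_fst (hf : ContMDiff (𝓡 m) (modelSphR n) ∞ f) (p : M) :
    ContDiffAt ℝ ∞ (fun y => (localRep m f p y).fst) (extChartAt (𝓡 m) p p) :=
  (WithLp.fstL 2 ℝ (EuclideanSpace ℝ (Fin (n + 1))) ℝ).contDiff.contDiffAt.comp _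
    (contDiffAt_localRep hf p)

theorem contDiffAt_localRep_snd (hf : ContMDiff (𝓡 m) (modelSphR n) ∞ f) (p : M) :
    ContDiffAt ℝ ∞ (fun y => (localRep m f p y).snd) (extChartAt (𝓡 m) p p) :=
  ContDiffAt.comp (f := localRep m f p) _
    (WithLp.sndL 2 ℝ (EuclideanSpace ℝ (Fin (n + 1))) ℝ).contDiff.contDiffAt
    (contDiffAt_localRep hf p)

theorem fderiv_localRep_fst (hf : ContMDiff (𝓡 m) (modelSphR n) ∞ f) (p : M)
    (v : EuclideanSpace ℝ (Fin m)) :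
    fderiv ℝ (fun y => (localRep m f p y).fst) (extChartAt (𝓡 m) p p) v =
      (fderiv ℝ (localRep m f p) (extChartAt (𝓡 m) p p) v).fst :=
  congrArg (fun L : _ →L[ℝ] _ => L v) (fderiv_comp_of_smooth
    (WithLp.fstL 2 ℝ (EuclideanSpace ℝ (Fin (n + 1))) ℝ) (contDiffAt_localRep hf p))

theorem fderiv_localRep_snd (hf : ContMDiff (𝓡 m) (modelSphR n) ∞ f) (p : M)
    (v : EuclideanSpace ℝ (Fin m)) :
    fderiv ℝ (fun y => (localRep m f p y).snd) (extChartAt (𝓡 m) p p) v =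
      (fderiv ℝ (localRep m f p) (extChartAt (𝓡 m) p p) v).snd :=
  congrArg (fun L : _ →L[ℝ] _ => L v) (fderiv_comp_of_smooth
    (WithLp.sndL 2 ℝ (EuclideanSpace ℝ (Fin (n + 1))) ℝ) (contDiffAt_localRep hf p))

theorem second_deriv_localRep_fst (hf : ContMDiff (𝓡 m) (modelSphR n) ∞ f) (p : M)
    (v w : EuclideanSpace ℝ (Fin m)) :
    fderiv ℝ (fderiv ℝ (fun y => (localRep m f p y).fst)) (extChartAt (𝓡 m) p p) v w =
      (fderiv ℝ (fderiv ℝ (localRep m f p)) (extChartAt (𝓡 m) p p) v w).fst :=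
  second_deriv_comp_of_clm (WithLp.fstL 2 ℝ (EuclideanSpace ℝ (Fin (n + 1))) ℝ)
    (contDiffAt_localRep hf p) v w

theorem second_deriv_localRep_snd (hf : ContMDiff (𝓡 m) (modelSphR n) ∞ f) (p : M)
    (v w : EuclideanSpace ℝ (Fin m)) :
    fderiv ℝ (fderiv ℝ (fun y => (localRep m f p y).snd)) (extChartAt (𝓡 m) p p) v w =
      (fderiv ℝ (fderiv ℝ (localRep m f p)) (extChartAt (𝓡 m) p p) v w).snd :=
  second_deriv_comp_of_clm (WithLp.sndL 2 ℝ (EuclideanSpace ℝ (Fin (n + 1))) ℝ)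
    (contDiffAt_localRep hf p) v w

theorem contMDiff_conformalMap {k : ℕ∞ω} : ContMDiff (modelSphR n)
    𝓘(ℝ, EuclideanSpace ℝ (Fin (n + 1))) k (conformalMap (n := n)) :=
  contDiff_ambConformal.contMDiff.comp contMDiff_toAmb

theorem IsSmoothImmersion.injective_fderiv_conformalMap (hf : IsSmoothImmersion m f) (p : M) :
    Function.Injective (fderiv ℝ (chartRep m (fun q => conformalMap (f q)) p)
      (extChartAt (𝓡 m) p p)) := by
  rw [chartRep_conformalMap]
  refine injective_fderiv_exp_smul (contDiffAt_localRep_fst hf.contMDiff p)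
    (contDiffAt_localRep_snd hf.contMDiff p) (eventually_norm_localRep_fst p) fun v h1 h2 => ?_
  rw [fderiv_localRep_fst hf.contMDiff] at h1
  rw [fderiv_localRep_snd hf.contMDiff] at h2
  refine hf.injective_dImm p ?_
  rw [map_zero, dImm, amb_eq (fderiv ℝ _ _ v), h1, h2, map_zero, zero_smul, add_zero]

theorem injective_dImm_of_conformalMap (hf : ContMDiff (𝓡 m) (modelSphR n) ∞ f) {p : M}
    (hinj : Function.Injective (fderiv ℝ (chartRep m (fun q => conformalMap (f q)) p)
      (extChartAt (𝓡 m) p p))) : Function.Injective (dImm m f p) := by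
  rw [chartRep_conformalMap] at hinj
  rw [injective_iff_map_eq_zero]
  intro v hv
  refine hinj ?_
  rw [dImm] at hv
  rw [map_zero, fderiv_exp_smul (contDiffAt_localRep_fst hf p) (contDiffAt_localRep_snd hf p),
    fderiv_localRep_fst hf, fderiv_localRep_snd hf, hv]
  simp

/-- The conformal map sends umbilical immersions to umbilical immersions. -/
theorem IsUmbilical.exists_umbilicalWith_conformalMap (hf : IsSmoothImmersion m f)
    (hu : IsUmbilical m f) (p : M) : ∃ η, UmbilicalWith
      (chartRep m (fun q => conformalMap (f q)) p) (extChartAt (𝓡 m) p p) η := by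
  obtain ⟨η, hη⟩ := isUmbilical_iff.1 hu p
  have hX := contDiffAt_localRep_fst hf.contMDiff p
  have hT := contDiffAt_localRep_snd hf.contMDiff p
  rw [chartRep_conformalMap]
  refine exists_umbilicalWith (η := (Real.exp (localRep m f p (extChartAt (𝓡 m) p p)).snd)⁻¹ •
    (η.fst + (η.snd - 1 - ⟪η.fst, (localRep m f p (extChartAt (𝓡 m) p p)).fst⟫) •
      (localRep m f p (extChartAt (𝓡 m) p p)).fst)) fun v w => ?_
  obtain ⟨_, ⟨z, rfl⟩, b, hb, he⟩ := Submodule.mem_sup.1 (hη v w)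
  obtain ⟨a, rfl⟩ := Submodule.mem_span_singleton.1 hb
  rw [eq_sub_iff_add_eq, amb_inner] at he
  have h1 := congrArg (fun z : Amb n => z.fst) he
  have h2 := congrArg (fun z : Amb n => z.snd) he
  refine ⟨_, second_deriv_exp_smul_of_umbilical hX hT (eventually_norm_localRep_fst p) (z := z)
    (a := a) (η₁ := η.fst) (η₂ := η.snd) ?_ ?_⟩
  · rw [second_deriv_localRep_fst hf.contMDiff, ← h1]
    simp only [fderiv_localRep_fst hf.contMDiff, fderiv_localRep_snd hf.contMDiff]
    have : (localRep m f p (extChartAt (𝓡 m) p p)).fst = (nuAmb (f p)).fst := by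
      rw [localRep, extChartAt_to_inv]
      rfl
    rw [this]
    simp only [WithLp.add_fst, WithLp.smul_fst]
    simp only [ContinuousLinearMap.coe_coe]
    abel
  · rw [second_deriv_localRep_snd hf.contMDiff, ← h2]
    simp only [fderiv_localRep_fst hf.contMDiff, fderiv_localRep_snd hf.contMDiff]
    simp [nuAmb]

/-- Umbilicity can be checked after the conformal map. -/
theorem isUmbilical_of_conformalMap (hf : ContMDiff (𝓡 m) (modelSphR n) ∞ f)
    (h : ∀ p, ∃ η, ∀ v w, ∃ z, fderiv ℝ (fderiv ℝ (chartRep m (fun q => conformalMap (f q)) p))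
      (extChartAt (𝓡 m) p p) v w = fderiv ℝ (chartRep m (fun q => conformalMap (f q)) p)
        (extChartAt (𝓡 m) p p) z + ⟪fderiv ℝ (chartRep m (fun q => conformalMap (f q)) p)
        (extChartAt (𝓡 m) p p) v, fderiv ℝ (chartRep m (fun q => conformalMap (f q)) p)
        (extChartAt (𝓡 m) p p) w⟫ • η) : IsUmbilical m f := by
  refine isUmbilical_iff.2 fun p => ?_
  obtain ⟨η, hη⟩ := h p
  have hX := contDiffAt_localRep_fst hf p
  have hT := contDiffAt_localRep_snd hf p
  have a1 := second_deriv_localRep_fst hf p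
  have a2 := second_deriv_localRep_snd hf p
  have b1 := fderiv_localRep_fst hf p
  have b2 := fderiv_localRep_snd hf p
  set x := extChartAt (𝓡 m) p p
  set F := localRep m f p with hF
  have hν : sphIncl (F x).fst = nuAmb (f p) := by
    rw [hF, localRep, extChartAt_to_inv]
    rfl
  refine ⟨sphIncl (Real.exp (F x).snd • η) + (Real.exp (F x).snd * ⟪η, (F x).fst⟫ + 1) • ddt n,
    fun v w => ?_⟩
  obtain ⟨z, hz⟩ := hη v w
  rw [chartRep_conformalMap] at hz
  obtain ⟨h2, a, h1⟩ := second_deriv_of_umbilical_exp_smul hX hT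
    (eventually_norm_localRep_fst p) hz
  simp only [a1, a2, b1, b2] at h1 h2
  refine Submodule.mem_sup.2 ⟨_, LinearMap.mem_range_self _ (z - (fderiv ℝ F x v).snd • w -
    (fderiv ℝ F x w).snd • v), a • nuAmb (f p), Submodule.smul_mem _ _
      (Submodule.mem_span_singleton_self _), ?_⟩
  rw [amb_inner]
  refine WithLp.ofLp_injective 2 (Prod.ext ?_ ?_)
  · change WithLp.fst _ = WithLp.fst _
    rw [← hν]
    simp only [WithLp.add_fst, WithLp.sub_fst, WithLp.smul_fst, ContinuousLinearMap.coe_coe, h1,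
      sphIncl_fst, ddt_fst, smul_zero, add_zero]
    abel
  · change WithLp.snd _ = WithLp.snd _
    rw [← hν]
    simp only [WithLp.add_snd, WithLp.sub_snd, WithLp.smul_snd, ContinuousLinearMap.coe_coe, h2,
      sphIncl_snd, ddt_snd, smul_eq_mul, mul_one, zero_add]
    ring

end Immersion

/-! ### Totally geodesic immersions and open subsets of spheres -/

section Geometry

variable {m n : ℕ} {M : Type*} [TopologicalSpace M] [ChartedSpace (EuclideanSpace ℝ (Fin m)) M]
  [IsManifold (𝓡 m) ∞ M] {f : M → SphR n}

theorem nuAmb_eq (p : SphR n) :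
    nuAmb p = sphIncl (p.1 : EuclideanSpace ℝ (Fin (n + 1))) := rfl

theorem norm_nuAmb (p : SphR n) : ‖nuAmb p‖ = 1 := by
  rw [nuAmb_eq, LinearIsometry.norm_map, norm_sph]

theorem inner_dImm_nuAmb (hf : ContMDiff (𝓡 m) (modelSphR n) ∞ f) (p : M)
    (v : EuclideanSpace ℝ (Fin m)) : ⟪dImm m f p v, nuAmb (f p)⟫ = 0 := by
  have h := inner_fderiv_sphere (contDiffAt_localRep_fst hf p) (eventually_norm_localRep_fst p) v
  rw [fderiv_localRep_fst hf, localRep, extChartAt_to_inv] at h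
  rw [amb_inner, nuAmb_eq, sphIncl_snd, mul_zero, add_zero]
  exact h

/-- An immersion into an affine subspace of dimension `m + 1` containing the normal vectors of
`𝕊ⁿ × ℝ` is totally geodesic. -/
theorem isTotallyGeodesic_of_mem (hf : IsSmoothImmersion m f) {L : Submodule ℝ (Amb n)}
    (hL : finrank ℝ L = m + 1) (hmem : ∀ p q, toAmb (f p) - toAmb (f q) ∈ L)
    (hν : ∀ p, nuAmb (f p) ∈ L) : IsTotallyGeodesic m f := by
  intro p v w
  have hF := contDiffAt_localRep hf.contMDiff p
  have hconst : ∀ N ∈ Lᗮ, (fun y => innerSL ℝ N (localRep m f p y)) =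
      fun _ => innerSL ℝ N (toAmb (f p)) := by
    intro N hN
    funext y
    have h := Submodule.inner_left_of_mem_orthogonal (hmem ((extChartAt (𝓡 m) p).symm y) p) hN
    rw [inner_sub_right, sub_eq_zero] at h
    exact h
  have h1 : ∀ u, dImm m f p u ∈ L := by
    intro u
    rw [← Submodule.orthogonal_orthogonal L, Submodule.mem_orthogonal]
    intro N hN
    have h := fderiv_comp_of_smooth (innerSL ℝ N) hF
    rw [hconst N hN, fderiv_fun_const] at h
    exact (congrArg (fun A : EuclideanSpace ℝ (Fin m) →L[ℝ] ℝ => A u) h).symm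
  have h2 : fderiv ℝ (fderiv ℝ (localRep m f p)) (extChartAt (𝓡 m) p p) v w ∈ L := by
    rw [← Submodule.orthogonal_orthogonal L, Submodule.mem_orthogonal]
    intro N hN
    have h := second_deriv_comp_of_clm (innerSL ℝ N) hF v w
    rw [hconst N hN, fderiv_fun_const] at h
    simpa using h.symm
  have hle : (dImm m f p).toLinearMap.range ⊔ Submodule.span ℝ {nuAmb (f p)} ≤ L := by
    refine sup_le ?_ ((Submodule.span_singleton_le_iff_mem _ _).2 (hν p))
    rintro _ ⟨u, rfl⟩
    exact h1 u
  have heq : (dImm m f p).toLinearMap.range ⊔ Submodule.span ℝ {nuAmb (f p)} = L := by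
    refine Submodule.eq_of_le_of_finrank_eq hle ?_
    have hort : nuAmb (f p) ∈ ((dImm m f p).toLinearMap.range)ᗮ := by
      rintro _ ⟨u, rfl⟩
      exact inner_dImm_nuAmb hf.contMDiff p u
    rw [finrank_sup_span_of_orthogonal hort
      (norm_ne_zero_iff.1 (by rw [norm_nuAmb]; exact one_ne_zero)), hL,
      LinearMap.finrank_range_of_inj (hf.injective_dImm p), finrank_euclideanSpace_fin]
  rw [secondFundamentalForm, Submodule.starProjection_apply_eq_zero_iff, normalSpace, heq,
    Submodule.orthogonal_orthogonal]
  exact h2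

/-- The part of `𝕊ⁿ × ℝ` sent by the conformal map to the sphere of centre `c` and radius `ρ` of the
affine subspace `c + W`. -/
def conformalSphere (W : Submodule ℝ (EuclideanSpace ℝ (Fin (n + 1))))
    (c : EuclideanSpace ℝ (Fin (n + 1))) (ρ : ℝ) : Set (SphR n) :=
  {q | conformalMap q - c ∈ W ∧ ‖conformalMap q - c‖ = ρ}

theorem eq_of_sphere_of_projection_eq {H : Type*} [NormedAddCommGroup H] [InnerProductSpace ℝ H]
    {R W : Submodule ℝ H} {e z z' : H} (hW : R ⊔ Submodule.span ℝ {e} = W)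
    (heR : e ∈ Rᗮ) (hz : z ∈ W) (hz' : z' ∈ W) (hn : ‖z‖ = ‖z'‖) (hp : z - z' ∈ Rᗮ)
    (h1 : 0 < ⟪z, e⟫) (h2 : 0 < ⟪z', e⟫) : z = z' := by
  have hd := W.sub_mem hz hz'
  rw [← hW] at hd
  obtain ⟨u, hu, b, hb, hub⟩ := Submodule.mem_sup.1 hd
  obtain ⟨a, rfl⟩ := Submodule.mem_span_singleton.1 hb
  have hu0 : u = 0 := by
    have h3 : ⟪u, z - z'⟫ = 0 := hp u hu
    rw [← hub, inner_add_right, real_inner_smul_right, heR u hu, mul_zero, add_zero,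
      inner_self_eq_zero] at h3
    exact h3
  rw [hu0, zero_add] at hub
  have hz2 : z = z' + a • e := by rw [hub]; abel
  have hsum : ⟪z + z', z - z'⟫ = 0 := by
    rw [inner_add_left, inner_sub_right, inner_sub_right, real_inner_self_eq_norm_sq,
      real_inner_self_eq_norm_sq, hn, real_inner_comm]
    ring
  rw [← hub, real_inner_smul_right, inner_add_left, mul_eq_zero] at hsum
  have ha : a = 0 := hsum.resolve_right (by positivity)
  rw [hz2, ha, zero_smul, add_zero]

theorem isOpenSubsetOf_of_forall_mem_nhds {X : Type*} [TopologicalSpace X] {A B : Set X}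
    (hAB : A ⊆ B) (h : ∀ x ∈ A, ∀ᶠ y in 𝓝 x, y ∈ B → y ∈ A) : IsOpenSubsetOf A B := by
  refine ⟨interior (A ∪ Bᶜ), isOpen_interior, Subset.antisymm (fun x hx => ⟨hAB hx, ?_⟩) ?_⟩
  · rw [mem_interior_iff_mem_nhds]
    filter_upwards [h x hx] with y hy
    by_cases hyB : y ∈ B
    · exact Or.inl (hy hyB)
    · exact Or.inr hyB
  · rintro x ⟨hxB, hx⟩
    exact (interior_subset hx).resolve_right fun h => h hxB

/-- An immersion into an `m`-sphere has relatively open image. -/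
theorem isOpenSubsetOf_conformalSphere (hf : IsSmoothImmersion m f)
    {W : Submodule ℝ (EuclideanSpace ℝ (Fin (n + 1)))} {c : EuclideanSpace ℝ (Fin (n + 1))} {ρ : ℝ}
    (hW : finrank ℝ W = m + 1) (hρ : 0 < ρ) (hS : ∀ p, f p ∈ conformalSphere W c ρ) :
    IsOpenSubsetOf (range f) (conformalSphere W c ρ) := by
  refine isOpenSubsetOf_of_forall_mem_nhds (by rintro _ ⟨p, rfl⟩; exact hS p) ?_
  rintro _ ⟨p, rfl⟩
  set g : M → EuclideanSpace ℝ (Fin (n + 1)) := fun q => conformalMap (f q) with hg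
  have hgs : ContMDiff (𝓡 m) 𝓘(ℝ, EuclideanSpace ℝ (Fin (n + 1))) ∞ g :=
    contMDiff_conformalMap.comp hf.contMDiff
  set x₀ := extChartAt (𝓡 m) p p with hx₀
  set G := chartRep m g p with hGdef
  have hG : ContDiffAt ℝ ∞ G x₀ := contDiffAt_chartRep hgs (mem_extChartAt_target p)
  have hGx : G x₀ = g p := by rw [hGdef, chartRep, hx₀, extChartAt_to_inv]
  have hinj : Function.Injective (fderiv ℝ G x₀) := hf.injective_fderiv_conformalMap p
  set R := LinearMap.range (fderiv ℝ G x₀ : EuclideanSpace ℝ (Fin m) →ₗ[ℝ]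
    EuclideanSpace ℝ (Fin (n + 1))) with hR
  have hGd := (hG.differentiableAt (by simp)).hasFDerivAt
  have hGmem : ∀ y, G y - c ∈ W ∧ ‖G y - c‖ = ρ := fun y => hS _
  set e := g p - c with he
  have hne : e ≠ 0 := norm_ne_zero_iff.1 (by rw [he, (hS p).2]; exact hρ.ne')
  have heR : e ∈ Rᗮ := by
    rintro _ ⟨v, rfl⟩
    have h1 : HasFDerivAt (fun y => ‖G y - c‖ ^ 2) _ x₀ := (hGd.sub_const c).norm_sq
    have h2 : (fun y => ‖G y - c‖ ^ 2) = fun _ => ρ ^ 2 := by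
      funext y
      rw [(hGmem y).2]
    rw [h2] at h1
    have h3 := congrArg (fun A : EuclideanSpace ℝ (Fin m) →L[ℝ] ℝ => A v)
      (h1.unique (hasFDerivAt_const _ _))
    simp only [smul_apply, ContinuousLinearMap.comp_apply, zero_apply, innerSL_apply_apply,
      hGx] at h3
    rw [real_inner_comm]
    simpa [he] using h3
  have hRW : R ⊔ Submodule.span ℝ {e} = W := by
    have hle : R ⊔ Submodule.span ℝ {e} ≤ W := by
      refine sup_le ?_ ((Submodule.span_singleton_le_iff_mem _ _).2 (hS p).1)
      rintro _ ⟨v, rfl⟩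
      rw [← Submodule.orthogonal_orthogonal W, Submodule.mem_orthogonal]
      intro N hN
      have h1 := fderiv_comp_of_smooth (innerSL ℝ N) hG
      have h2 : (fun y => innerSL ℝ N (G y)) = fun _ => innerSL ℝ N c := by
        funext y
        have h := Submodule.inner_left_of_mem_orthogonal (hGmem y).1 hN
        rw [inner_sub_right, sub_eq_zero] at h
        exact h
      rw [h2, fderiv_fun_const] at h1
      exact (congrArg (fun A : EuclideanSpace ℝ (Fin m) →L[ℝ] ℝ => A v) h1).symm
    refine Submodule.eq_of_le_of_finrank_eq hle ?_
    rw [finrank_sup_span_of_orthogonal heR hne, hW, LinearMap.finrank_range_of_inj hinj,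
      finrank_euclideanSpace_fin]
  set P := R.orthogonalProjectionOnto with hP
  have hstrict : HasStrictFDerivAt (fun y => P (G y)) (P.comp (fderiv ℝ G x₀)) x₀ :=
    P.hasStrictFDerivAt.comp x₀ (hG.hasStrictFDerivAt (by simp))
  have hsurj : LinearMap.range (P.comp (fderiv ℝ G x₀) : EuclideanSpace ℝ (Fin m) →ₗ[ℝ] R) = ⊤ := by
    rw [LinearMap.range_eq_top]
    rintro ⟨_, ⟨v, rfl⟩⟩
    refine ⟨v, ?_⟩
    exact Submodule.orthogonalProjectionOnto_mem_subspace_eq_self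
      (⟨fderiv ℝ G x₀ v, ⟨v, rfl⟩⟩ : R)
  have hmap := hstrict.map_nhds_eq_of_surj hsurj
  have hpos : ∀ᶠ y in 𝓝 x₀, 0 < ⟪G y - c, e⟫ := by
    have hc : ContinuousAt (fun y => ⟪G y - c, e⟫) x₀ :=
      (hG.continuousAt.sub continuousAt_const).inner continuousAt_const
    refine hc.eventually_const_lt ?_
    beta_reduce
    rw [hGx, ← he, real_inner_self_eq_norm_sq]
    positivity
  have himg : (fun y => P (G y)) '' {y | 0 < ⟪G y - c, e⟫} ∈ 𝓝 (P (G x₀)) := by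
    rw [← hmap]
    exact image_mem_map hpos
  have hc1 : ContinuousAt (fun q : SphR n => P (conformalMap q)) (f p) :=
    (P.continuous.comp continuous_conformalMap).continuousAt
  have hev1 : ∀ᶠ q in 𝓝 (f p), P (conformalMap q) ∈
      (fun y => P (G y)) '' {y | 0 < ⟪G y - c, e⟫} := by
    refine hc1.eventually_mem ?_
    rw [hGx] at himg
    exact himg
  have hev2 : ∀ᶠ q in 𝓝 (f p), 0 < ⟪conformalMap q - c, e⟫ := by
    have hc : ContinuousAt (fun q : SphR n => ⟪conformalMap q - c, e⟫) (f p) :=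
      (continuous_conformalMap.continuousAt.sub continuousAt_const).inner continuousAt_const
    refine hc.eventually_const_lt ?_
    change 0 < ⟪e, e⟫
    rw [real_inner_self_eq_norm_sq]
    positivity
  filter_upwards [hev1, hev2] with q hq1 hq2 hqS
  obtain ⟨y, hy, hyq⟩ := hq1
  refine ⟨(extChartAt (𝓡 m) p).symm y, ?_⟩
  refine conformalMap_injective ?_
  have hfin : G y - c = conformalMap q - c := by
    refine eq_of_sphere_of_projection_eq hRW heR (hGmem y).1 hqS.1
      ((hGmem y).2.trans hqS.2.symm) ?_ hy hq2
    rw [sub_sub_sub_cancel_right, ← Submodule.orthogonalProjectionOnto_eq_zero_iff, map_sub]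
    exact sub_eq_zero.2 hyq
  exact sub_left_injective hfin

end Geometry

/-! ### Classification of umbilical immersions -/

section Isometries

variable {n : ℕ}

/-- The isometry of `𝕊ⁿ × ℝ` given by a rotation of `ℝⁿ⁺¹` and a translation of `ℝ`. -/
noncomputable def rotTrans (A : EuclideanSpace ℝ (Fin (n + 1)) ≃ₗᵢ[ℝ] EuclideanSpace ℝ (Fin (n + 1)))
    (a : ℝ) : SphR n ≃ SphR n where
  toFun p := (⟨A p.1, by simp⟩, p.2 + a)
  invFun p := (⟨A.symm p.1, by simp⟩, p.2 - a)
  left_inv p := Prod.ext (Subtype.ext (by simp)) (by simp)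
  right_inv p := Prod.ext (Subtype.ext (by simp)) (by simp)

variable (A : EuclideanSpace ℝ (Fin (n + 1)) ≃ₗᵢ[ℝ] EuclideanSpace ℝ (Fin (n + 1))) (a : ℝ)

theorem rotTrans_apply_fst (p : SphR n) :
    ((rotTrans A a p).1 : EuclideanSpace ℝ (Fin (n + 1))) = A p.1 := rfl

theorem rotTrans_apply_snd (p : SphR n) : (rotTrans A a p).2 = p.2 + a := rfl

theorem isAmbientIsometry_rotTrans : IsAmbientIsometry (rotTrans A a) := by
  intro p q
  rw [riemDist, riemDist, rotTrans_apply_fst, rotTrans_apply_fst, rotTrans_apply_snd,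
    rotTrans_apply_snd, add_sub_add_right_eq_sub]
  congr 3
  exact A.toLinearIsometry.angle_map _ _

theorem conformalMap_rotTrans (p : SphR n) :
    conformalMap (rotTrans A a p) = Real.exp a • A (conformalMap p) := by
  rw [conformalMap, conformalMap, rotTrans_apply_fst, rotTrans_apply_snd, map_smul, smul_smul,
    Real.exp_add, mul_comm]

theorem continuous_rotTrans_symm : Continuous (rotTrans A a).symm :=
  ((A.symm.continuous.comp (continuous_subtype_val.comp continuous_fst)).subtype_mk _).prodMk
    (continuous_snd.sub continuous_const)

theorem IsOpenSubsetOf.image_rotTrans {S T : Set (SphR n)} (h : IsOpenSubsetOf S T) :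
    IsOpenSubsetOf (rotTrans A a '' S) (rotTrans A a '' T) := by
  obtain ⟨U, hU, rfl⟩ := h
  refine ⟨(rotTrans A a).symm ⁻¹' U, hU.preimage (continuous_rotTrans_symm A a), ?_⟩
  rw [image_inter (rotTrans A a).injective, Equiv.image_eq_preimage_symm _ U]

/-- The reflection of `𝕊ⁿ × ℝ` in `𝕊ⁿ × {0}`. -/
def timeReflect : SphR n ≃ SphR n where
  toFun p := (p.1, -p.2)
  invFun p := (p.1, -p.2)
  left_inv _ := Prod.ext rfl (neg_neg _)
  right_inv _ := Prod.ext rfl (neg_neg _)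

theorem timeReflect_apply (p : SphR n) : timeReflect p = (p.1, -p.2) := rfl

theorem isAmbientIsometry_timeReflect : IsAmbientIsometry (timeReflect (n := n)) := by
  intro p q
  rw [riemDist, riemDist, timeReflect_apply, timeReflect_apply]
  congr 2
  ring

theorem IsAmbientIsometry.trans {Ψ Φ : SphR n ≃ SphR n} (h1 : IsAmbientIsometry Ψ)
    (h2 : IsAmbientIsometry Φ) : IsAmbientIsometry (Ψ.trans Φ) := fun p q => by
  rw [Equiv.trans_apply, Equiv.trans_apply, h2, h1]

theorem conformalMap_timeReflect (p : SphR n) :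
    conformalMap (timeReflect p) = (‖conformalMap p‖ ^ 2)⁻¹ • conformalMap p := by
  rw [norm_conformalMap, conformalMap, conformalMap, timeReflect_apply, smul_smul, Real.exp_neg]
  congr 1
  field_simp

theorem contMDiff_timeReflect {k : ℕ∞ω} :
    ContMDiff (modelSphR n) (modelSphR n) k (timeReflect (n := n)) :=
  contMDiff_fst.prodMk (contDiff_neg.contMDiff.comp contMDiff_snd)

theorem IsSmoothImmersion.timeReflect_comp {m : ℕ} {M : Type*} [TopologicalSpace M]
    [ChartedSpace (EuclideanSpace ℝ (Fin m)) M] [IsManifold (𝓡 m) ∞ M] {f : M → SphR n}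
    (hf : IsSmoothImmersion m f) : IsSmoothImmersion m (fun p => timeReflect (f p)) := by
  have hs : ContMDiff (𝓡 m) (modelSphR n) ∞ (fun p => timeReflect (f p)) :=
    contMDiff_timeReflect.comp hf.contMDiff
  refine isSmoothImmersion_of_injective_dImm hs fun p => ?_
  rw [injective_iff_map_eq_zero]
  intro v hv
  have h1 := fderiv_localRep_fst hs p v
  have h2 := fderiv_localRep_snd hs p v
  rw [dImm] at hv
  rw [hv] at h1 h2
  have h2' : fderiv ℝ (fun y => -(localRep m f p y).snd) (extChartAt (𝓡 m) p p) v = 0 := h2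
  have h1' : fderiv ℝ (fun y => (localRep m f p y).fst) (extChartAt (𝓡 m) p p) v = 0 := h1
  rw [fderiv_fun_neg, neg_apply, neg_eq_zero, fderiv_localRep_snd hf.contMDiff] at h2'
  rw [fderiv_localRep_fst hf.contMDiff] at h1'
  refine hf.injective_dImm p ?_
  rw [map_zero, dImm, amb_eq (fderiv ℝ _ _ v), h1', h2', map_zero, zero_smul, add_zero]

end Isometries

section ZeroExtension

theorem zeroExt_injective {k : ℕ} : Function.Injective (zeroExt (k := k)) := by
  intro x y h
  ext i
  have := congrFun h i.1
  simpa [zeroExt, i.2] using this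

/-- The standard inclusion of `ℝᵏ` in `ℝˡ`. -/
noncomputable def zeroExtIsom {k l : ℕ} (hkl : k ≤ l) :
    EuclideanSpace ℝ (Fin k) →ₗᵢ[ℝ] EuclideanSpace ℝ (Fin l) where
  toFun x := WithLp.toLp 2 fun i => zeroExt x i
  map_add' x y := by
    ext i
    by_cases hi : i.1 < k <;> simp [zeroExt, hi]
  map_smul' c x := by
    ext i
    by_cases hi : i.1 < k <;> simp [zeroExt, hi]
  norm_map' x := by
    simp only [LinearMap.coe_mk, AddHom.coe_mk, EuclideanSpace.norm_eq, Real.norm_eq_abs, sq_abs]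
    congr 1
    rw [Fin.sum_univ_eq_sum_range (fun i => zeroExt x i ^ 2)]
    have h1 : ∑ i : Fin k, x i ^ 2 = ∑ i ∈ Finset.range k, zeroExt x i ^ 2 := by
      rw [← Fin.sum_univ_eq_sum_range (fun i => zeroExt x i ^ 2)]
      exact Finset.sum_congr rfl fun i _ => by simp [zeroExt]
    rw [h1]
    refine (Finset.sum_subset (Finset.range_mono hkl) fun i _ hi => ?_).symm
    rw [Finset.mem_range] at hi
    simp [zeroExt, hi]

theorem zeroExt_zeroExtIsom {k l : ℕ} (hkl : k ≤ l) (x : EuclideanSpace ℝ (Fin k)) :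
    zeroExt (zeroExtIsom hkl x) = zeroExt x := by
  funext i
  by_cases hi : i < l
  · simp [zeroExt, hi, zeroExtIsom]
  · have : ¬ i < k := fun h => hi (h.trans_le hkl)
    simp [zeroExt, hi, this]

variable {m : ℕ} {xbar : EuclideanSpace ℝ (Fin (m + 1))} {r h : ℝ}

theorem zeroExt_zeroHeight (x : EuclideanSpace ℝ (Fin (m + 1))) :
    zeroExt (zeroHeight x) = zeroExt x := by
  rw [← zeroExt_zeroExtIsom (Nat.le_succ (m + 1)) x]
  congr 1

/-- The image of a point by a linear isometry of the sphere factor. -/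
noncomputable def SphR.mapIsom {k n : ℕ} (j : EuclideanSpace ℝ (Fin (k + 1)) →ₗᵢ[ℝ] EuclideanSpace ℝ (Fin (n + 1)))
    (q : SphR k) : SphR n :=
  (⟨j q.1, by simp⟩, q.2)

theorem SphR.conformalMap_mapIsom {k n : ℕ}
    (j : EuclideanSpace ℝ (Fin (k + 1)) →ₗᵢ[ℝ] EuclideanSpace ℝ (Fin (n + 1))) (q : SphR k) :
    conformalMap (SphR.mapIsom j q) = j (conformalMap q) := (map_smul _ _ _).symm

theorem mem_inSphR_MRH_self {p : SphR m} :
    p ∈ inSphR m (MRH xbar r 0) ↔ ∃ y, ‖y - xbar‖ = r ∧ conformalMap p = y := by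
  have hkey : ∀ q : SphR (m + 1), q.2 = p.2 ∧ zeroExt (q.1 : EuclideanSpace ℝ (Fin (m + 1 + 1))) =
      zeroExt (p.1 : EuclideanSpace ℝ (Fin (m + 1))) ↔ q = SphR.mapIsom zeroHeight p := by
    intro q
    rw [← zeroExt_zeroHeight p.1.1, zeroExt_injective.eq_iff, Prod.ext_iff, Subtype.ext_iff]
    exact and_comm
  have hmem : SphR.mapIsom zeroHeight p ∈ MRH xbar r 0 ↔ ‖conformalMap p - xbar‖ = r := by
    rw [mem_MRH_iff, SphR.conformalMap_mapIsom, initPart_zeroHeight, zeroHeight_last]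
    simp
  constructor
  · rintro ⟨q, hq, h⟩
    rw [hkey] at h
    rw [h, hmem] at hq
    exact ⟨_, hq, rfl⟩
  · rintro ⟨y, hy, rfl⟩
    exact ⟨_, hmem.2 hy, (hkey _).2 rfl⟩

theorem mem_inSphR_MRH {n : ℕ} (hn : m + 1 ≤ n) {p : SphR n} :
    p ∈ inSphR n (MRH xbar r h) ↔ ∃ y, ‖y - xbar‖ = r ∧ conformalMap p =
      (zeroExtIsom (Nat.succ_le_succ hn)).comp zeroHeight y +
        h • zeroExtIsom (Nat.succ_le_succ hn) (lastVec m) := by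
  set j := zeroExtIsom (Nat.succ_le_succ hn) with hj
  have hkey : ∀ q : SphR (m + 1), q.2 = p.2 ∧ zeroExt (q.1 : EuclideanSpace ℝ (Fin (m + 1 + 1))) =
      zeroExt (p.1 : EuclideanSpace ℝ (Fin (n + 1))) ↔ SphR.mapIsom j q = p := by
    intro q
    rw [← zeroExt_zeroExtIsom (Nat.succ_le_succ hn) q.1.1, zeroExt_injective.eq_iff, Prod.ext_iff,
      Subtype.ext_iff]
    exact and_comm
  have hkey' : ∀ q : SphR (m + 1), SphR.mapIsom j q = p ↔ j (conformalMap q) = conformalMap p :=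
    fun q => by rw [← SphR.conformalMap_mapIsom, conformalMap_injective.eq_iff]
  constructor
  · rintro ⟨q, hq, h1⟩
    rw [hkey, hkey'] at h1
    obtain ⟨h2, h3⟩ := mem_MRH_iff.1 hq
    refine ⟨_, h2, ?_⟩
    rw [← h1]
    conv_lhs => rw [eq_zeroHeight_initPart_add (conformalMap q), h3]
    rw [map_add, map_smul, LinearIsometry.coe_comp, Function.comp_apply]
  · rintro ⟨y, hy, hp⟩
    have hne : zeroHeight y + h • lastVec m ≠ 0 := by
      intro h0
      refine conformalMap_ne_zero p ?_
      rw [hp, LinearIsometry.coe_comp, Function.comp_apply, ← map_smul j h, ← map_add, h0, map_zero]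
    refine ⟨conformalInv _ hne, ?_, (hkey _).2 ((hkey' _).2 ?_)⟩
    · rw [mem_MRH_iff, conformalMap_conformalInv]
      simp [hy]
    · rw [conformalMap_conformalInv, hp, map_add, map_smul, LinearIsometry.coe_comp,
        Function.comp_apply]

end ZeroExtension

section Adapted

/-- A rotation that carries a subspace, a vector in it and a vector orthogonal to it to prescribed
positions. -/
theorem exists_adapted_isometry {V : Type*} [NormedAddCommGroup V] [InnerProductSpace ℝ V]
    [FiniteDimensional ℝ V] {k : ℕ} {W : Submodule ℝ V} (hW : finrank ℝ W = k)
    (ι : EuclideanSpace ℝ (Fin k) →ₗᵢ[ℝ] V) {c₀ c₁ N : V} (hc₀ : c₀ ∈ W) (hc₁ : c₁ ∈ Wᗮ)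
    {x : EuclideanSpace ℝ (Fin k)} (hx : ‖x‖ = ‖c₀‖) (hN : ∀ u, ⟪ι u, N⟫ = 0) (hNn : ‖N‖ = ‖c₁‖) :
    ∃ A : V ≃ₗᵢ[ℝ] V, A c₀ = ι x ∧ A c₁ = N ∧ ∀ z, z ∈ W ↔ ∃ u, A z = ι u := by
  set B₀ : W ≃ₗᵢ[ℝ] EuclideanSpace ℝ (Fin k) :=
    ((stdOrthonormalBasis ℝ W).reindex (finCongr hW)).repr
  set B₁ : W ≃ₗᵢ[ℝ] EuclideanSpace ℝ (Fin k) :=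
    B₀.trans (Submodule.reflection (ℝ ∙ (B₀ ⟨c₀, hc₀⟩ - x))ᗮ)
  have hB₁ : B₁ ⟨c₀, hc₀⟩ = x := Submodule.reflection_sub (by
    rw [LinearIsometryEquiv.norm_map, hx]
    rfl)
  set B : V ≃ₗᵢ[ℝ] V := (ι.comp B₁.toLinearIsometry).extend.toLinearIsometryEquiv rfl
  have hB : ∀ w : W, B w = ι (B₁ w) := fun w => LinearIsometry.extend_apply _ w
  have hperp : ∀ u, ⟪ι u, B c₁⟫ = 0 := fun u => by
    rw [← B₁.apply_symm_apply u, ← hB, LinearIsometryEquiv.inner_map_map]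
    exact hc₁ _ (B₁.symm u).2
  set Q : V ≃ₗᵢ[ℝ] V := Submodule.reflection (ℝ ∙ (B c₁ - N))ᗮ
  have hQ : Q (B c₁) = N := Submodule.reflection_sub (by rw [LinearIsometryEquiv.norm_map, hNn])
  have hQι : ∀ u, Q (ι u) = ι u := fun u => by
    refine Submodule.reflection_mem_subspace_eq_self ?_
    rw [Submodule.mem_orthogonal_singleton_iff_inner_left, inner_sub_right, hperp, hN, sub_zero]
  refine ⟨B.trans Q, ?_, hQ, fun z => ⟨fun hz => ⟨B₁ ⟨z, hz⟩, ?_⟩, ?_⟩⟩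
  · rw [LinearIsometryEquiv.trans_apply, hB ⟨c₀, hc₀⟩, hB₁, hQι]
  · rw [LinearIsometryEquiv.trans_apply, hB ⟨z, hz⟩, hQι]
  · rintro ⟨u, hu⟩
    have h1 : (B.trans Q) (B₁.symm u : V) = ι u := by
      rw [LinearIsometryEquiv.trans_apply, hB, B₁.apply_symm_apply, hQι]
    rw [(B.trans Q).injective (hu.trans h1.symm)]
    exact (B₁.symm u).2

variable {m n : ℕ} {xbar : EuclideanSpace ℝ (Fin (m + 1))}

theorem image_conformalSphere {W : Submodule ℝ (EuclideanSpace ℝ (Fin (n + 1)))}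
    {c₀ c₁ N : EuclideanSpace ℝ (Fin (n + 1))} {ρ s : ℝ} (hs : 0 < s)
    (ι : EuclideanSpace ℝ (Fin (m + 1)) →ₗᵢ[ℝ] EuclideanSpace ℝ (Fin (n + 1)))
    {A : EuclideanSpace ℝ (Fin (n + 1)) ≃ₗᵢ[ℝ] EuclideanSpace ℝ (Fin (n + 1))}
    (hA₀ : A c₀ = ι (s⁻¹ • xbar)) (hA₁ : A c₁ = s⁻¹ • N) (hA : ∀ z, z ∈ W ↔ ∃ u, A z = ι u) :
    rotTrans A (Real.log s) '' conformalSphere W (c₀ + c₁) ρ =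
      {p | ∃ y, ‖y - xbar‖ = s * ρ ∧ conformalMap p = ι y + N} := by
  have hs' := hs.ne'
  have hA₀' : s • A c₀ = ι xbar := by rw [hA₀, ← map_smul ι s, smul_inv_smul₀ hs']
  have hA₁' : s • A c₁ = N := by rw [hA₁, smul_inv_smul₀ hs']
  ext p
  constructor
  · rintro ⟨q, ⟨hq1, hq2⟩, rfl⟩
    obtain ⟨u, hu⟩ := (hA _).1 hq1
    refine ⟨xbar + s • u, ?_, ?_⟩
    · rw [add_sub_cancel_left, norm_smul, ← ι.norm_map u, ← hu, A.norm_map, hq2, Real.norm_eq_abs,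
        abs_of_pos hs]
    · rw [conformalMap_rotTrans, Real.exp_log hs, map_add, map_smul ι s, ← hu, map_sub, map_add,
        smul_sub, smul_add, hA₀', hA₁']
      abel
  · rintro ⟨y, hy, hp⟩
    refine ⟨(rotTrans A (Real.log s)).symm p, ?_, Equiv.apply_symm_apply _ _⟩
    set q := (rotTrans A (Real.log s)).symm p with hq
    have h1 : conformalMap p = s • A (conformalMap q) := by
      rw [← Equiv.apply_symm_apply (rotTrans A (Real.log s)) p, ← hq, conformalMap_rotTrans,
        Real.exp_log hs]
    have h2 : A (conformalMap q - (c₀ + c₁)) = ι (s⁻¹ • (y - xbar)) := by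
      rw [map_smul ι s⁻¹, map_sub, map_sub, map_add, eq_inv_smul_iff₀ hs', smul_sub, smul_add, ← h1,
        hA₀', hA₁', hp]
      abel
    refine ⟨(hA _).2 ⟨_, h2⟩, ?_⟩
    rw [← A.norm_map, h2, ι.norm_map, norm_smul, hy, norm_inv, Real.norm_eq_abs, abs_of_pos hs,
      inv_mul_cancel_left₀ hs']

end Adapted

section Classification

variable {m n : ℕ}

theorem norm_sq_of_orthogonal_center {W : Submodule ℝ (EuclideanSpace ℝ (Fin (n + 1)))}
    {c y : EuclideanSpace ℝ (Fin (n + 1))} (hc : c ∈ Wᗮ) (hy : y - c ∈ W) :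
    ‖y‖ ^ 2 = ‖y - c‖ ^ 2 + ‖c‖ ^ 2 := by
  have h1 : ⟪y - c, c⟫ = 0 := hc _ hy
  have h2 := norm_add_sq_real (y - c) c
  rw [sub_add_cancel, h1] at h2
  linarith

/-- If the centre of the sphere is orthogonal to its directions, one gets a small sphere. -/
theorem isSmallSphere_image_conformalSphere {W : Submodule ℝ (EuclideanSpace ℝ (Fin (n + 1)))}
    {c : EuclideanSpace ℝ (Fin (n + 1))} {ρ : ℝ} (hW : finrank ℝ W = m + 1) (hρ : 0 < ρ)
    (hc : c ∈ Wᗮ) (hc0 : c ≠ 0) :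
    IsSmallSphere m (rotTrans (LinearIsometryEquiv.refl ℝ _)
      (-Real.log (Real.sqrt (ρ ^ 2 + ‖c‖ ^ 2))) '' conformalSphere W c ρ) := by
  set R := Real.sqrt (ρ ^ 2 + ‖c‖ ^ 2) with hRdef
  have hcn : 0 < ‖c‖ := norm_pos_iff.2 hc0
  have hR : 0 < R := Real.sqrt_pos.2 (by positivity)
  have hR2 : R ^ 2 = ρ ^ 2 + ‖c‖ ^ 2 := Real.sq_sqrt (by positivity)
  have hcR : ‖c‖ < R := by
    rw [← sq_lt_sq₀ hcn.le hR.le, hR2]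
    have : 0 < ρ ^ 2 := by positivity
    linarith
  have hnorm : ‖R⁻¹ • c‖ = ‖c‖ / R := by
    rw [norm_smul, norm_inv, Real.norm_eq_abs, abs_of_pos hR]
    field_simp
  refine ⟨W, R⁻¹ • c, hW, Wᗮ.smul_mem _ hc, ?_, ?_, ?_⟩
  · rw [hnorm]
    positivity
  · rw [hnorm, div_lt_one hR]
    exact hcR
  · ext p
    constructor
    · rintro ⟨q, ⟨hq1, hq2⟩, rfl⟩
      have h1 := norm_sq_of_orthogonal_center hc hq1
      rw [hq2, ← hR2, norm_conformalMap, sq_eq_sq₀ (Real.exp_pos _).le hR.le] at h1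
      refine ⟨?_, ?_⟩
      · rw [rotTrans_apply_fst]
        have h2 : (q.1 : EuclideanSpace ℝ (Fin (n + 1))) - R⁻¹ • c =
            R⁻¹ • (conformalMap q - c) := by
          rw [smul_sub, conformalMap, h1, inv_smul_smul₀ hR.ne']
        change (q.1 : EuclideanSpace ℝ (Fin (n + 1))) - R⁻¹ • c ∈ W
        rw [h2]
        exact W.smul_mem _ hq1
      · rw [rotTrans_apply_snd, ← h1, Real.log_exp, add_neg_cancel]
    · rintro ⟨hp1, hp2⟩
      have hq1 : conformalMap ((p.1, Real.log R) : SphR n) - c ∈ W := by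
        have h2 : conformalMap ((p.1, Real.log R) : SphR n) - c =
            R • ((p.1 : EuclideanSpace ℝ (Fin (n + 1))) - R⁻¹ • c) := by
          rw [smul_sub, smul_inv_smul₀ hR.ne', conformalMap, Real.exp_log hR]
        rw [h2]
        exact W.smul_mem _ hp1
      refine ⟨(p.1, Real.log R), ⟨hq1, ?_⟩, Prod.ext (Subtype.ext rfl) ?_⟩
      · have h1 := norm_sq_of_orthogonal_center hc hq1
        rw [norm_conformalMap, Real.exp_log hR, hR2, add_left_inj] at h1
        exact ((sq_eq_sq₀ hρ.le (norm_nonneg _)).1 h1).symm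
      · rw [rotTrans_apply_snd, add_neg_cancel]
        exact hp2.symm

variable {M : Type*} [TopologicalSpace M] [ChartedSpace (EuclideanSpace ℝ (Fin m)) M]
  [IsManifold (𝓡 m) ∞ M] {f : M → SphR n}

theorem exists_isometry_of_conformalSphere {xbar : EuclideanSpace ℝ (Fin (m + 1))} (hx : xbar ≠ 0)
    (hf : IsSmoothImmersion m f) {W : Submodule ℝ (EuclideanSpace ℝ (Fin (n + 1)))}
    {c : EuclideanSpace ℝ (Fin (n + 1))} {ρ : ℝ} (hW : finrank ℝ W = m + 1) (hρ : 0 < ρ)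
    (hc : c ≠ 0) (hS : ∀ p, f p ∈ conformalSphere W c ρ) :
    ∃ Ψ : SphR n ≃ SphR n, IsAmbientIsometry Ψ ∧
      ((∃ S : Set (SphR n), IsSmallSphere m S ∧ IsOpenSubsetOf (Ψ '' range f) S) ∨
       (n = m ∧ ∃ r : ℝ, 0 < r ∧ IsOpenSubsetOf (Ψ '' range f) (inSphR n (MRH xbar r 0))) ∨
       (m + 1 ≤ n ∧ ∃ r h : ℝ, 0 < r ∧ 0 ≤ h ∧
         IsOpenSubsetOf (Ψ '' range f) (inSphR n (MRH xbar r h)))) := by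
  have hopen := isOpenSubsetOf_conformalSphere hf hW hρ hS
  set c₀ := W.starProjection c with hc₀
  set c₁ := c - c₀ with hc₁
  have hm₀ : c₀ ∈ W := Submodule.starProjection_apply_mem _ _
  have hm₁ : c₁ ∈ Wᗮ := Submodule.sub_starProjection_mem_orthogonal _
  have hcc : c = c₀ + c₁ := by rw [hc₁]; abel
  by_cases h0 : c₀ = 0
  · have hcW : c ∈ Wᗮ := by rwa [hc₁, h0, sub_zero] at hm₁
    exact ⟨_, isAmbientIsometry_rotTrans _ _, Or.inl ⟨_,
      isSmallSphere_image_conformalSphere hW hρ hcW hc, hopen.image_rotTrans _ _⟩⟩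
  have hx' : 0 < ‖xbar‖ := norm_pos_iff.2 hx
  have h0' : 0 < ‖c₀‖ := norm_pos_iff.2 h0
  set s := ‖xbar‖ / ‖c₀‖ with hs
  have hspos : 0 < s := by positivity
  have hxn : ‖s⁻¹ • xbar‖ = ‖c₀‖ := by
    rw [norm_smul, norm_inv, Real.norm_eq_abs, abs_of_pos hspos, hs]
    field_simp
  have hfin : m + 1 ≤ n + 1 := by
    have := Submodule.finrank_le W
    rwa [hW, finrank_euclideanSpace_fin] at this
  rcases (Nat.le_of_succ_le_succ hfin).eq_or_lt with hmn | hmn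
  · subst hmn
    have hWt : W = ⊤ := Submodule.eq_top_of_finrank_eq (by rw [hW, finrank_euclideanSpace_fin])
    have hc₁0 : c₁ = 0 := by rwa [hWt, Submodule.top_orthogonal_eq_bot, Submodule.mem_bot] at hm₁
    obtain ⟨A, hA₀, hA₁, hA⟩ := exists_adapted_isometry hW LinearIsometry.id hm₀ hm₁ hxn (N := 0)
      (fun u => inner_zero_right _) (by rw [hc₁0])
    refine ⟨_, isAmbientIsometry_rotTrans A (Real.log s), Or.inr (Or.inl ⟨rfl, s * ρ, by positivity,
      ?_⟩)⟩
    have himg := image_conformalSphere (ρ := ρ) (N := 0) hspos LinearIsometry.id hA₀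
      (by rw [hA₁, smul_zero]) hA
    have htarget : inSphR m (MRH xbar (s * ρ) 0) =
        rotTrans A (Real.log s) '' conformalSphere W c ρ := by
      rw [hcc, himg]
      ext p
      rw [mem_inSphR_MRH_self]
      simp
    rw [htarget]
    exact hopen.image_rotTrans _ _
  · set j := zeroExtIsom (Nat.succ_le_succ (Nat.succ_le_of_lt hmn)) with hj
    have hNn : ‖s⁻¹ • (s * ‖c₁‖) • j (lastVec m)‖ = ‖c₁‖ := by
      rw [smul_smul, inv_mul_cancel_left₀ hspos.ne', norm_smul, j.norm_map, norm_lastVec, mul_one,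
        norm_norm]
    obtain ⟨A, hA₀, hA₁, hA⟩ := exists_adapted_isometry hW (j.comp zeroHeight) hm₀ hm₁ hxn
      (N := s⁻¹ • (s * ‖c₁‖) • j (lastVec m)) (fun u => by
        rw [real_inner_smul_right, real_inner_smul_right, LinearIsometry.coe_comp,
          Function.comp_apply, j.inner_map_map, inner_zeroHeight_lastVec, mul_zero, mul_zero]) hNn
    refine ⟨_, isAmbientIsometry_rotTrans A (Real.log s), Or.inr (Or.inr ⟨hmn, s * ρ, s * ‖c₁‖,
      by positivity, by positivity, ?_⟩)⟩
    have himg := image_conformalSphere (ρ := ρ) hspos (j.comp zeroHeight) hA₀ hA₁ hA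
    have htarget : inSphR n (MRH xbar (s * ρ) (s * ‖c₁‖)) =
        rotTrans A (Real.log s) '' conformalSphere W c ρ := by
      rw [hcc, himg]
      ext p
      rw [mem_inSphR_MRH (Nat.succ_le_of_lt hmn)]
      rfl
    rw [htarget]
    exact hopen.image_rotTrans _ _

theorem fst_mem_of_conformalMap_mem {W : Submodule ℝ (EuclideanSpace ℝ (Fin (n + 1)))} {p : SphR n}
    (h : conformalMap p ∈ W) : (p.1 : EuclideanSpace ℝ (Fin (n + 1))) ∈ W := by
  rwa [conformalMap, W.smul_mem_iff (Real.exp_pos _).ne'] at h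

theorem finrank_map_sphIncl (W : Submodule ℝ (EuclideanSpace ℝ (Fin (n + 1)))) :
    finrank ℝ (W.map (sphIncl (n := n)).toLinearMap) = finrank ℝ W :=
  (Submodule.equivMapOfInjective _ sphIncl.injective W).finrank_eq.symm

theorem isTotallyGeodesic_of_centered_sphere (hf : IsSmoothImmersion m f)
    {W : Submodule ℝ (EuclideanSpace ℝ (Fin (n + 1)))} {ρ : ℝ} (hW : finrank ℝ W = m + 1)
    (hS : ∀ p, f p ∈ conformalSphere W 0 ρ) : IsTotallyGeodesic m f := by
  have hmem : ∀ p, ((f p).1 : EuclideanSpace ℝ (Fin (n + 1))) ∈ W := fun p =>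
    fst_mem_of_conformalMap_mem (by simpa using (hS p).1)
  have hT : ∀ p q, (f p).2 = (f q).2 := fun p q => by
    have h1 := (hS p).2
    rw [← (hS q).2, sub_zero, sub_zero, norm_conformalMap, norm_conformalMap] at h1
    exact Real.exp_injective h1
  refine isTotallyGeodesic_of_mem hf (L := W.map (sphIncl (n := n)).toLinearMap) ?_ ?_ ?_
  · rw [finrank_map_sphIncl, hW]
  · intro p q
    rw [toAmb_eq, toAmb_eq, hT p q, add_sub_add_right_eq_sub, ← map_sub]
    exact Submodule.mem_map_of_mem (W.sub_mem (hmem p) (hmem q))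
  · intro p
    rw [nuAmb_eq]
    exact Submodule.mem_map_of_mem (hmem p)

theorem isTotallyGeodesic_of_linear (hf : IsSmoothImmersion m f)
    {V : Submodule ℝ (EuclideanSpace ℝ (Fin (n + 1)))} (hV : finrank ℝ V = m)
    (hS : ∀ p, conformalMap (f p) ∈ V) : IsTotallyGeodesic m f := by
  have hmem : ∀ p, ((f p).1 : EuclideanSpace ℝ (Fin (n + 1))) ∈ V := fun p =>
    fst_mem_of_conformalMap_mem (hS p)
  have hν : ∀ p, sphIncl ((f p).1 : EuclideanSpace ℝ (Fin (n + 1))) ∈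
      V.map (sphIncl (n := n)).toLinearMap ⊔ Submodule.span ℝ {ddt n} := fun p =>
    Submodule.mem_sup_left (Submodule.mem_map_of_mem (hmem p))
  have hA : ∀ p, toAmb (f p) ∈
      V.map (sphIncl (n := n)).toLinearMap ⊔ Submodule.span ℝ {ddt n} := fun p => by
    rw [toAmb_eq]
    exact Submodule.add_mem _ (hν p) (Submodule.smul_mem _ _ (Submodule.mem_sup_right
      (Submodule.mem_span_singleton_self _)))
  refine isTotallyGeodesic_of_mem hf ?_ (fun p q => Submodule.sub_mem _ (hA p) (hA q)) hν
  have hort : ddt n ∈ (V.map (sphIncl (n := n)).toLinearMap)ᗮ := by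
    rintro _ ⟨u, _, rfl⟩
    simp
  have hne : ddt n ≠ 0 := norm_ne_zero_iff.1 (by rw [norm_ddt]; exact one_ne_zero)
  rw [finrank_sup_span_of_orthogonal hort hne, finrank_map_sphIncl, hV]

/-- The inversion sends a plane that misses the origin to a sphere through the origin. -/
theorem timeReflect_mem_conformalSphere {V : Submodule ℝ (EuclideanSpace ℝ (Fin (n + 1)))}
    {N : EuclideanSpace ℝ (Fin (n + 1))} (hN : N ∈ Vᗮ) (hN0 : N ≠ 0) {p : SphR n}
    (hp : conformalMap p - N ∈ V) : timeReflect p ∈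
      conformalSphere (V ⊔ Submodule.span ℝ {N}) ((2 * ‖N‖ ^ 2)⁻¹ • N) (2 * ‖N‖)⁻¹ := by
  have hn : 0 < ‖N‖ := norm_pos_iff.2 hN0
  have hg : 0 < ‖conformalMap p‖ := norm_pos_iff.2 (conformalMap_ne_zero p)
  set g := conformalMap p with hgdef
  have hNm : N ∈ V ⊔ Submodule.span ℝ {N} :=
    Submodule.mem_sup_right (Submodule.mem_span_singleton_self _)
  have hgm : g ∈ V ⊔ Submodule.span ℝ {N} := by
    rw [← sub_add_cancel g N]
    exact Submodule.add_mem _ (Submodule.mem_sup_left hp) hNm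
  have hgN : ⟪g, N⟫ = ‖N‖ ^ 2 := by
    have h1 : ⟪g - N, N⟫ = 0 := hN _ hp
    rw [inner_sub_left, real_inner_self_eq_norm_sq] at h1
    linarith
  constructor
  · rw [conformalMap_timeReflect]
    exact Submodule.sub_mem _ (Submodule.smul_mem _ _ hgm) (Submodule.smul_mem _ _ hNm)
  · rw [conformalMap_timeReflect, ← sq_eq_sq₀ (norm_nonneg _) (by positivity), norm_sub_sq_real,
      real_inner_smul_left, real_inner_smul_right, ← hgdef, hgN, norm_smul, norm_smul, norm_inv,
      norm_inv, Real.norm_of_nonneg (by positivity), Real.norm_of_nonneg (by positivity)]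
    field_simp
    ring

/-- The classification of the umbilical immersions that are not totally geodesic. -/
theorem IsUmbilical.classification [ConnectedSpace M] (hm : 2 ≤ m)
    {xbar : EuclideanSpace ℝ (Fin (m + 1))} (hx : xbar ≠ 0) (hf : IsSmoothImmersion m f)
    (hu : IsUmbilical m f) (hng : ¬ IsTotallyGeodesic m f) :
    ∃ Ψ : SphR n ≃ SphR n, IsAmbientIsometry Ψ ∧
      ((∃ S : Set (SphR n), IsSmallSphere m S ∧ IsOpenSubsetOf (Ψ '' range f) S) ∨
       (n = m ∧ ∃ r : ℝ, 0 < r ∧ IsOpenSubsetOf (Ψ '' range f) (inSphR n (MRH xbar r 0))) ∨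
       (m + 1 ≤ n ∧ ∃ r h : ℝ, 0 < r ∧ 0 ≤ h ∧
         IsOpenSubsetOf (Ψ '' range f) (inSphR n (MRH xbar r h)))) := by
  have hgs : ContMDiff (𝓡 m) 𝓘(ℝ, EuclideanSpace ℝ (Fin (n + 1))) ∞
      (fun p => conformalMap (f p)) := contMDiff_conformalMap.comp hf.contMDiff
  rcases exists_plane_or_sphere hm hgs hf.injective_fderiv_conformalMap
    (hu.exists_umbilicalWith_conformalMap hf) with ⟨V, hV, hplane⟩ | ⟨W, c, ρ, hW, hρ, hsph⟩
  · obtain ⟨p₀⟩ : Nonempty M := inferInstance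
    set N := conformalMap (f p₀) - V.starProjection (conformalMap (f p₀)) with hNdef
    have hN : N ∈ Vᗮ := Submodule.sub_starProjection_mem_orthogonal _
    have hmem : ∀ p, conformalMap (f p) - N ∈ V := fun p => by
      have : conformalMap (f p) - N = (conformalMap (f p) - conformalMap (f p₀)) +
          V.starProjection (conformalMap (f p₀)) := by rw [hNdef]; abel
      rw [this]
      exact V.add_mem (hplane p p₀) (Submodule.starProjection_apply_mem _ _)
    by_cases hN0 : N = 0
    · refine absurd (isTotallyGeodesic_of_linear hf hV fun p => ?_) hng
      simpa [hN0] using hmem p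
    · have hn : 0 < ‖N‖ := norm_pos_iff.2 hN0
      obtain ⟨Ψ, hΨ, hcases⟩ := exists_isometry_of_conformalSphere hx hf.timeReflect_comp
        (by rw [finrank_sup_span_of_orthogonal hN hN0, hV]) (by positivity)
        (smul_ne_zero (by positivity) hN0)
        (fun p => timeReflect_mem_conformalSphere hN hN0 (hmem p))
      refine ⟨timeReflect.trans Ψ, isAmbientIsometry_timeReflect.trans hΨ, ?_⟩
      have himg : (timeReflect.trans Ψ) '' range f = Ψ '' range (fun p => timeReflect (f p)) := by
        rw [Equiv.coe_trans, image_comp, ← range_comp]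
        rfl
      rw [himg]
      exact hcases
  · by_cases hc : c = 0
    · subst hc
      exact absurd (isTotallyGeodesic_of_centered_sphere hf hW hsph) hng
    · exact exists_isometry_of_conformalSphere hx hf hW hρ hc hsph

end Classification

/-! ### Completeness of closed embedded submanifolds -/

section Completeness

variable {m n : ℕ} {M : Type*} [TopologicalSpace M] [ChartedSpace (EuclideanSpace ℝ (Fin m)) M]
  {f : M → SphR n}

theorem isClosedEmbedding_toAmb : IsClosedEmbedding (toAmb (n := n)) := by
  have h1 : IsClosedEmbedding (Prod.map Subtype.val id : SphR n → EuclideanSpace ℝ (Fin (n + 1)) × ℝ) :=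
    (Metric.isClosed_sphere.isClosedEmbedding_subtypeVal).prodMap IsClosedEmbedding.id
  exact ((WithLp.prodContinuousLinearEquiv 2 ℝ (EuclideanSpace ℝ (Fin (n + 1))) ℝ).symm
    |>.toHomeomorph.isClosedEmbedding).comp h1

/-- The chord distance is at most the induced distance. -/
theorem edist_toAmb_le_inducedEDist (hf : ContMDiff (𝓡 m) (modelSphR n) ∞ f) (p q : M) :
    edist (toAmb (f p)) (toAmb (f q)) ≤ inducedEDist m f p q := by
  refine le_iInf fun γ => le_iInf fun hγ => le_iInf fun h0 => le_iInf fun h1 => ?_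
  have hc : ContDiffOn ℝ 1 (fun s => toAmb (f (γ s))) (Icc 0 1) := by
    have h : ContMDiff (𝓡 m) 𝓘(ℝ, Amb n) 1 (fun p => toAmb (f p)) :=
      contMDiff_toAmb.comp (hf.of_le (by exact_mod_cast le_top))
    exact (h.comp_contMDiffOn hγ).contDiffOn
  have h := enorm_sub_le_lintegral_derivWithin_Icc_of_contDiffOn_Icc hc zero_le_one
  rw [h0, h1] at h
  rwa [edist_comm, edist_eq_enorm_sub]

theorem lintegral_derivWithin_segment_le {E H : Type*} [NormedAddCommGroup E] [NormedSpace ℝ E]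
    [NormedAddCommGroup H] [NormedSpace ℝ H] {F : E → H} {y u : E} {C : ℝ}
    (hF : ∀ t ∈ Icc (0 : ℝ) 1, DifferentiableAt ℝ F (y + t • u) ∧ ‖fderiv ℝ F (y + t • u)‖ ≤ C) :
    ∫⁻ t in Icc (0 : ℝ) 1, ‖derivWithin (fun s : ℝ => F (y + s • u)) (Icc 0 1) t‖ₑ ≤
      ENNReal.ofReal (C * ‖u‖) := by
  have hbound : ∀ t ∈ Icc (0 : ℝ) 1,
      ‖derivWithin (fun s : ℝ => F (y + s • u)) (Icc 0 1) t‖ₑ ≤ ENNReal.ofReal (C * ‖u‖) := by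
    intro t ht
    have hline : HasDerivAt (fun t : ℝ => y + t • u) u t := by
      simpa using ((hasDerivAt_id t).smul_const u).const_add y
    have hd : HasDerivAt (fun s : ℝ => F (y + s • u)) _ t :=
      (hF t ht).1.hasFDerivAt.comp_hasDerivAt t hline
    rw [hd.hasDerivWithinAt.derivWithin (uniqueDiffOn_Icc zero_lt_one t ht), ← ofReal_norm]
    exact ENNReal.ofReal_le_ofReal (ContinuousLinearMap.le_of_opNorm_le _ (hF t ht).2 _)
  refine (setLIntegral_mono measurable_const hbound).trans ?_
  rw [setLIntegral_const, Real.volume_Icc]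
  simp

variable [IsManifold (𝓡 m) ∞ M]

theorem tendsto_inducedEDist (hf : ContMDiff (𝓡 m) (modelSphR n) ∞ f) (p : M) :
    Tendsto (fun q => inducedEDist m f q p) (𝓝 p) (𝓝 0) := by
  set x₀ := extChartAt (𝓡 m) p p with hx₀
  set F := localRep m f p with hF
  have hFs : ∀ x ∈ (extChartAt (𝓡 m) p).target, ContDiffAt ℝ ∞ F x := fun x hx =>
    contDiffAt_chartRep (contMDiff_toAmb.comp hf) hx
  have hx₀t : x₀ ∈ (extChartAt (𝓡 m) p).target := mem_extChartAt_target p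
  set C := ‖fderiv ℝ F x₀‖ + 1 with hC
  have hC0 : 0 ≤ C := by positivity
  have hcont : ContinuousAt (fun x => ‖fderiv ℝ F x‖) x₀ :=
    ((hFs x₀ hx₀t).fderiv_right (m := ∞) (by simp)).continuousAt.norm
  have hev : ∀ᶠ x in 𝓝 x₀, x ∈ (extChartAt (𝓡 m) p).target ∧ ‖fderiv ℝ F x‖ ≤ C :=
    ((isOpen_extChartAt_target p).eventually_mem hx₀t).and
      (hcont.eventually_le_const (lt_add_one _))
  obtain ⟨ε, hε, hball⟩ := Metric.eventually_nhds_iff_ball.1 hev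
  have hle : ∀ᶠ q in 𝓝 p, inducedEDist m f q p ≤
      ENNReal.ofReal (C * ‖x₀ - extChartAt (𝓡 m) p q‖) := by
    have hq : ∀ᶠ q in 𝓝 p, extChartAt (𝓡 m) p q ∈ Metric.ball x₀ ε :=
      (continuousAt_extChartAt p).eventually_mem (Metric.ball_mem_nhds _ hε)
    filter_upwards [hq, (isOpen_extChartAt_source (I := 𝓡 m) p).mem_nhds
      (mem_extChartAt_source p)] with q hqb hqs
    set y := extChartAt (𝓡 m) p q with hy
    have hseg : ∀ t ∈ Icc (0 : ℝ) 1, y + t • (x₀ - y) ∈ Metric.ball x₀ ε := fun t ht =>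
      (convex_ball x₀ ε).add_smul_sub_mem hqb (Metric.mem_ball_self hε) ht
    have hγ : ContMDiffOn 𝓘(ℝ, ℝ) (𝓡 m) 1
        (fun t : ℝ => (extChartAt (𝓡 m) p).symm (y + t • (x₀ - y))) (Icc 0 1) := by
      have h1 : ContMDiffOn 𝓘(ℝ, EuclideanSpace ℝ (Fin m)) (𝓡 m) 1 (extChartAt (𝓡 m) p).symm
          (extChartAt (𝓡 m) p).target :=
        (contMDiffOn_extChartAt_symm (n := ∞) p).of_le (by exact_mod_cast le_top)
      have h2 : ContDiff ℝ 1 (fun t : ℝ => y + t • (x₀ - y)) :=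
        contDiff_const.add (contDiff_id.smul contDiff_const)
      exact h1.comp h2.contMDiff.contMDiffOn fun t ht => (hball _ (hseg t ht)).1
    have h0 : (extChartAt (𝓡 m) p).symm (y + (0 : ℝ) • (x₀ - y)) = q := by
      rw [zero_smul, add_zero, hy, (extChartAt (𝓡 m) p).left_inv hqs]
    have h1 : (extChartAt (𝓡 m) p).symm (y + (1 : ℝ) • (x₀ - y)) = p := by
      rw [one_smul, add_sub_cancel, hx₀, extChartAt_to_inv]
    refine (iInf_le _ _).trans ((iInf_le _ hγ).trans ((iInf_le _ h0).trans ((iInf_le _ h1).trans ?_)))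
    exact lintegral_derivWithin_segment_le fun t ht =>
      ⟨(hFs _ (hball _ (hseg t ht)).1).differentiableAt (by simp), (hball _ (hseg t ht)).2⟩
  have hlim : Tendsto (fun q => ENNReal.ofReal (C * ‖x₀ - extChartAt (𝓡 m) p q‖)) (𝓝 p) (𝓝 0) := by
    have h1 : ContinuousAt (fun q => C * ‖x₀ - extChartAt (𝓡 m) p q‖) p :=
      continuousAt_const.mul (continuousAt_const.sub (continuousAt_extChartAt p)).norm
    have h2 := ENNReal.tendsto_ofReal h1
    beta_reduce at h2
    rwa [← hx₀, sub_self, norm_zero, mul_zero, ENNReal.ofReal_zero] at h2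
  exact tendsto_of_tendsto_of_tendsto_of_le_of_le' tendsto_const_nhds hlim
    (Eventually.of_forall fun _ => zero_le) hle

/-- A closed embedded submanifold is complete. -/
theorem isCompleteImmersion_of_isClosedEmbedding (hf : ContMDiff (𝓡 m) (modelSphR n) ∞ f)
    (hc : IsClosedEmbedding f) : IsCompleteImmersion m f := by
  intro u hu
  have hemb := isClosedEmbedding_toAmb.comp hc
  have hcauchy : CauchySeq fun k => toAmb (f (u k)) := by
    rw [EMetric.cauchySeq_iff]
    intro ε hε
    obtain ⟨N, hN⟩ := hu ε hε
    exact ⟨N, fun i hi j hj => (edist_toAmb_le_inducedEDist hf _ _).trans_lt (hN i j hi hj)⟩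
  obtain ⟨y, hy⟩ := cauchySeq_tendsto_of_complete hcauchy
  obtain ⟨p, rfl⟩ : y ∈ range (toAmb ∘ f) :=
    hemb.isClosed_range.mem_of_tendsto hy (Eventually.of_forall fun k => ⟨u k, rfl⟩)
  have hp : Tendsto u atTop (𝓝 p) := hemb.tendsto_nhds_iff.2 hy
  exact ⟨p, (tendsto_inducedEDist hf p).comp hp⟩

end Completeness

/-! ### Embeddings of the submanifolds `M_{r,h}` -/

section Embeddings

variable {m n : ℕ} {M : Type*} [TopologicalSpace M] [ChartedSpace (EuclideanSpace ℝ (Fin m)) M]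
  [IsManifold (𝓡 m) ∞ M]

theorem contMDiff_conformalInv {s : M → EuclideanSpace ℝ (Fin (n + 1))} (hne : ∀ p, s p ≠ 0)
    (hs : ContMDiff (𝓡 m) 𝓘(ℝ, EuclideanSpace ℝ (Fin (n + 1))) ∞ s) :
    ContMDiff (𝓡 m) (modelSphR n) ∞ (fun p => conformalInv (s p) (hne p)) := by
  have h1 : ContMDiff (𝓡 m) 𝓘(ℝ, EuclideanSpace ℝ (Fin (n + 1))) ∞
      (fun p => ‖s p‖⁻¹ • s p) := fun p =>
    (((contDiffAt_norm ℝ (hne p)).inv (norm_ne_zero_iff.2 (hne p))).smul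
      contDiffAt_id).contMDiffAt.comp p (hs p)
  have h2 : ContMDiff (𝓡 m) 𝓘(ℝ, ℝ) ∞ (fun p => Real.log ‖s p‖) := fun p =>
    ((contDiffAt_norm ℝ (hne p)).log (norm_ne_zero_iff.2 (hne p))).contMDiffAt.comp p (hs p)
  exact (h1.codRestrict_sphere fun p => by simp [norm_normalize (hne p)]).prodMk h2

variable {xbar : EuclideanSpace ℝ (Fin (m + 1))} {r h : ℝ}

theorem isClosed_MRH : IsClosed (MRH xbar r h) := by
  have : MRH xbar r h = {p | ‖initPart (conformalMap p) - xbar‖ = r} ∩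
      {p | conformalMap p (Fin.last (m + 1)) = h} := by
    ext p
    exact mem_MRH_iff
  rw [this]
  have hc := continuous_conformalMap (n := m + 1)
  refine (isClosed_eq ((initPart.continuous.comp hc).sub continuous_const).norm
    continuous_const).inter (isClosed_eq ?_ continuous_const)
  exact (EuclideanSpace.proj (𝕜 := ℝ) (Fin.last (m + 1))).continuous.comp hc

section Sphere

theorem chartRep_coe_sphere_fderiv (p : Sph m) :
    fderiv ℝ (chartRep m (Subtype.val : Sph m → EuclideanSpace ℝ (Fin (m + 1))) p)
      (extChartAt (𝓡 m) p p) = mfderiv (𝓡 m) 𝓘(ℝ, EuclideanSpace ℝ (Fin (m + 1)))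
        (Subtype.val : Sph m → EuclideanSpace ℝ (Fin (m + 1))) p := by
  rw [((contMDiff_coe_sphere (m := 1)).mdifferentiable (by simp) p).mfderiv,
    ModelWithCorners.range_eq_univ, fderivWithin_univ]
  rfl

theorem injective_fderiv_coe_sphere (p : Sph m) : Function.Injective
    (fderiv ℝ (chartRep m (Subtype.val : Sph m → EuclideanSpace ℝ (Fin (m + 1))) p)
      (extChartAt (𝓡 m) p p)) := by
  rw [chartRep_coe_sphere_fderiv]
  exact mfderiv_coe_sphere_injective p

theorem exists_second_deriv_coe_sphere (p : Sph m) (v w : EuclideanSpace ℝ (Fin m)) :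
    ∃ z, fderiv ℝ (fderiv ℝ (chartRep m (Subtype.val : Sph m → EuclideanSpace ℝ (Fin (m + 1))) p))
      (extChartAt (𝓡 m) p p) v w = fderiv ℝ (chartRep m Subtype.val p) (extChartAt (𝓡 m) p p) z -
      ⟪fderiv ℝ (chartRep m (Subtype.val : Sph m → EuclideanSpace ℝ (Fin (m + 1))) p)
        (extChartAt (𝓡 m) p p) v, fderiv ℝ (chartRep m Subtype.val p) (extChartAt (𝓡 m) p p) w⟫ •
      (p : EuclideanSpace ℝ (Fin (m + 1))) := by
  set X := chartRep m (Subtype.val : Sph m → EuclideanSpace ℝ (Fin (m + 1))) p with hX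
  have hXs : ContDiffAt ℝ ∞ X (extChartAt (𝓡 m) p p) :=
    contDiffAt_chartRep contMDiff_coe_sphere (mem_extChartAt_target p)
  have h1 := inner_second_deriv_sphere hXs (Eventually.of_forall fun y => norm_sph _) v w
  have hXp : X (extChartAt (𝓡 m) p p) = p := by rw [hX, chartRep, extChartAt_to_inv]
  rw [hXp] at h1
  have h2 : fderiv ℝ (fderiv ℝ X) (extChartAt (𝓡 m) p p) v w +
      ⟪fderiv ℝ X (extChartAt (𝓡 m) p p) v, fderiv ℝ X (extChartAt (𝓡 m) p p) w⟫ •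
        (p : EuclideanSpace ℝ (Fin (m + 1))) ∈
      (ℝ ∙ (p : EuclideanSpace ℝ (Fin (m + 1))))ᗮ := by
    rw [Submodule.mem_orthogonal_singleton_iff_inner_left, inner_add_left, h1,
      real_inner_smul_left, real_inner_self_eq_norm_sq, norm_sph]
    ring
  rw [← range_mfderiv_coe_sphere (n := m) p] at h2
  obtain ⟨z, hz⟩ := h2
  refine ⟨z, ?_⟩
  rw [eq_sub_iff_add_eq, ← hz, hX, chartRep_coe_sphere_fderiv]
  rfl

/-- The round parametrization of the sphere `𝕊_{r,h}`. -/
noncomputable def sphereParam (xbar : EuclideanSpace ℝ (Fin (m + 1))) (r h : ℝ) (x : Sph m) :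
    EuclideanSpace ℝ (Fin (m + 1 + 1)) :=
  zeroHeight (xbar + r • (x : EuclideanSpace ℝ (Fin (m + 1)))) + h • lastVec m

theorem sphereParam_ne_zero (hr : 0 < r) (hrh : (r, h) ≠ (‖xbar‖, 0)) (x : Sph m) :
    sphereParam xbar r h x ≠ 0 := by
  refine zeroHeight_add_ne_zero ?_
  by_contra! hcon
  obtain ⟨h1, h2⟩ := hcon
  refine hrh (Prod.ext ?_ h2)
  rw [eq_neg_of_add_eq_zero_left h1, norm_neg, norm_smul, norm_sph, mul_one, Real.norm_eq_abs,
    abs_of_pos hr]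

theorem chartRep_sphereParam (p : Sph m) : chartRep m (sphereParam xbar r h) p =
    fun y => (zeroHeight xbar + h • lastVec m) + (r • zeroHeight.toContinuousLinearMap)
      (chartRep m (Subtype.val : Sph m → EuclideanSpace ℝ (Fin (m + 1))) p y) := by
  funext y
  rw [chartRep, sphereParam, map_add, map_smul _ r]
  simp only [smul_apply, LinearIsometry.coe_toContinuousLinearMap]
  rw [chartRep]
  abel

theorem contMDiff_sphereParam : ContMDiff (𝓡 m) 𝓘(ℝ, EuclideanSpace ℝ (Fin (m + 1 + 1))) ∞
    (sphereParam xbar r h) := by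
  have h1 : ContDiff ℝ ∞ fun x : EuclideanSpace ℝ (Fin (m + 1)) =>
      zeroHeight (xbar + r • x) + h • lastVec m :=
    (zeroHeight.toContinuousLinearMap.contDiff.comp (contDiff_const.add
      (contDiff_id.const_smul r))).add contDiff_const
  exact h1.contMDiff.comp contMDiff_coe_sphere

theorem fderiv_chartRep_sphereParam (p : Sph m) (v : EuclideanSpace ℝ (Fin m)) :
    fderiv ℝ (chartRep m (sphereParam xbar r h) p) (extChartAt (𝓡 m) p p) v =
      r • zeroHeight (fderiv ℝ (chartRep m (Subtype.val : Sph m → EuclideanSpace ℝ (Fin (m + 1))) p)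
        (extChartAt (𝓡 m) p p) v) := by
  rw [chartRep_sphereParam, fderiv_const_add, fderiv_comp_of_smooth _
    (contDiffAt_chartRep contMDiff_coe_sphere (mem_extChartAt_target p))]
  rfl

theorem second_deriv_chartRep_sphereParam (p : Sph m) (v w : EuclideanSpace ℝ (Fin m)) :
    fderiv ℝ (fderiv ℝ (chartRep m (sphereParam xbar r h) p)) (extChartAt (𝓡 m) p p) v w =
      r • zeroHeight (fderiv ℝ (fderiv ℝ
        (chartRep m (Subtype.val : Sph m → EuclideanSpace ℝ (Fin (m + 1))) p))
        (extChartAt (𝓡 m) p p) v w) := by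
  have h0 : fderiv ℝ (chartRep m (sphereParam xbar r h) p) =
      fderiv ℝ (fun y => (r • zeroHeight.toContinuousLinearMap)
      (chartRep m (Subtype.val : Sph m → EuclideanSpace ℝ (Fin (m + 1))) p y)) := by
    funext y
    rw [chartRep_sphereParam, fderiv_const_add]
  rw [h0, second_deriv_comp_of_clm _
    (contDiffAt_chartRep contMDiff_coe_sphere (mem_extChartAt_target p))]
  rfl

/-- `M_{r,h}` is a complete umbilical sphere if the origin is not in `𝕊_{r,h}`. -/
theorem exists_sphere_embedding (hr : 0 < r) (hrh : (r, h) ≠ (‖xbar‖, 0)) :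
    ∃ f : Sph m → SphR (m + 1), IsSmoothEmbeddingOnto m f (MRH xbar r h) ∧ IsUmbilical m f ∧
      IsCompleteImmersion m f := by
  have hne := sphereParam_ne_zero (m := m) hr hrh
  set f : Sph m → SphR (m + 1) := fun x => conformalInv (sphereParam xbar r h x) (hne x) with hf
  have hfs : ContMDiff (𝓡 m) (modelSphR (m + 1)) ∞ f := contMDiff_conformalInv hne
    contMDiff_sphereParam
  have hconf : (fun x => conformalMap (f x)) = sphereParam xbar r h := by
    funext x
    exact conformalMap_conformalInv _ _
  have hinj : ∀ p, Function.Injective (fderiv ℝ (chartRep m (sphereParam xbar r h) p)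
      (extChartAt (𝓡 m) p p)) := by
    intro p v w hvw
    rw [fderiv_chartRep_sphereParam, fderiv_chartRep_sphereParam] at hvw
    exact injective_fderiv_coe_sphere p (zeroHeight.injective (smul_right_injective _ hr.ne' hvw))
  have himm : IsSmoothImmersion m f := isSmoothImmersion_of_injective_dImm hfs fun p =>
    injective_dImm_of_conformalMap hfs (by rw [hconf]; exact hinj p)
  have hrange : range f = MRH xbar r h := by
    ext p
    constructor
    · rintro ⟨x, rfl⟩
      rw [mem_MRH_iff, hf, conformalMap_conformalInv, sphereParam]
      simp [norm_smul, abs_of_pos hr]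
    · intro hp
      obtain ⟨h1, h2⟩ := mem_MRH_iff.1 hp
      refine ⟨⟨r⁻¹ • (initPart (conformalMap p) - xbar), ?_⟩, conformalMap_injective ?_⟩
      · rw [mem_sphere_zero_iff_norm, norm_smul, h1, norm_inv, Real.norm_eq_abs, abs_of_pos hr,
          inv_mul_cancel₀ hr.ne']
      · rw [hf, conformalMap_conformalInv, sphereParam, smul_inv_smul₀ hr.ne', add_sub_cancel, ← h2]
        exact (eq_zeroHeight_initPart_add _).symm
  have hfinj : Function.Injective f := by
    intro x y hxy
    have h1 : sphereParam xbar r h x = sphereParam xbar r h y := by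
      rw [← hconf]
      exact congrArg conformalMap hxy
    exact Subtype.ext (smul_right_injective _ hr.ne'
      (add_right_injective xbar (zeroHeight.injective (add_left_injective _ h1))))
  have hclosed : IsClosedEmbedding f := hfs.continuous.isClosedEmbedding hfinj
  refine ⟨f, ⟨himm, hclosed.isEmbedding, hrange⟩, isUmbilical_of_conformalMap hfs fun p => ?_,
    isCompleteImmersion_of_isClosedEmbedding hfs hclosed⟩
  rw [hconf]
  refine ⟨-(r⁻¹ • zeroHeight (p : EuclideanSpace ℝ (Fin (m + 1)))), fun v w => ?_⟩
  obtain ⟨z, hz⟩ := exists_second_deriv_coe_sphere p v w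
  refine ⟨z, ?_⟩
  rw [second_deriv_chartRep_sphereParam, fderiv_chartRep_sphereParam, fderiv_chartRep_sphereParam,
    fderiv_chartRep_sphereParam, hz, real_inner_smul_left, real_inner_smul_right,
    zeroHeight.inner_map_map, map_sub, map_smul, smul_sub, smul_neg, smul_smul, smul_smul,
    ← sub_eq_add_neg]
  congr 2
  field_simp

end Sphere

end Embeddings

/-! ### The submanifold `M_{d,0}` -/

section Plane

variable {m n : ℕ}

/-- The reflection of `ℝⁿ⁺¹ × ℝ` in `ℝⁿ⁺¹ × {0}`. -/
noncomputable def ambReflect : Amb n →ₗᵢ[ℝ] Amb n where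
  toFun z := WithLp.toLp 2 (z.fst, -z.snd)
  map_add' z w := WithLp.ofLp_injective 2 (Prod.ext (by simp) (by simp [add_comm]))
  map_smul' c z := WithLp.ofLp_injective 2 (Prod.ext (by simp) (by simp))
  norm_map' z := by
    rw [← sq_eq_sq₀ (norm_nonneg _) (norm_nonneg _)]
    simp [WithLp.prod_norm_sq_eq_of_L2]

theorem ambReflect_nuAmb (p : SphR n) : ambReflect (nuAmb p) = nuAmb (timeReflect p) :=
  WithLp.ofLp_injective 2 (Prod.ext rfl (by simp [ambReflect, nuAmb]))

theorem IsUmbilical.timeReflect_comp {M : Type*} [TopologicalSpace M]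
    [ChartedSpace (EuclideanSpace ℝ (Fin m)) M] [IsManifold (𝓡 m) ∞ M] {f : M → SphR n}
    (hf : ContMDiff (𝓡 m) (modelSphR n) ∞ f) (hu : IsUmbilical m f) :
    IsUmbilical m (fun p => timeReflect (f p)) := by
  refine isUmbilical_iff.2 fun p => ?_
  obtain ⟨η, hη⟩ := isUmbilical_iff.1 hu p
  have hF := contDiffAt_localRep hf p
  have hrep : localRep m (fun p => timeReflect (f p)) p =
      fun y => (ambReflect (n := n)).toContinuousLinearMap (localRep m f p y) := rfl
  refine ⟨ambReflect η, fun v w => ?_⟩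
  obtain ⟨_, ⟨z, rfl⟩, b, hb, he⟩ := Submodule.mem_sup.1 (hη v w)
  obtain ⟨a, rfl⟩ := Submodule.mem_span_singleton.1 hb
  rw [hrep, second_deriv_comp_of_clm _ hF, fderiv_comp_of_smooth _ hF]
  refine Submodule.mem_sup.2 ⟨_, ⟨z, rfl⟩, a • nuAmb (timeReflect (f p)),
    Submodule.smul_mem _ _ (Submodule.mem_span_singleton_self _), ?_⟩
  have h1 := congrArg ambReflect he
  rw [map_add, map_smul, ambReflect_nuAmb, map_sub, map_smul] at h1
  refine h1.trans ?_
  simp only [ContinuousLinearMap.comp_apply, LinearIsometry.coe_toContinuousLinearMap,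
    LinearIsometry.inner_map_map]

variable {xbar : EuclideanSpace ℝ (Fin (m + 1))}

theorem exists_isometry_orthogonal (hx : xbar ≠ 0) :
    ∃ ι : EuclideanSpace ℝ (Fin m) →ₗᵢ[ℝ] EuclideanSpace ℝ (Fin (m + 1)),
      ∀ z, ⟪z, xbar⟫ = 0 ↔ ∃ u, ι u = z := by
  have hfin : finrank ℝ (ℝ ∙ xbar)ᗮ = m := by
    have h1 := Submodule.finrank_add_finrank_orthogonal (ℝ ∙ xbar)
    rw [finrank_span_singleton hx, finrank_euclideanSpace_fin] at h1
    omega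
  set B : (ℝ ∙ xbar)ᗮ ≃ₗᵢ[ℝ] EuclideanSpace ℝ (Fin m) :=
    ((stdOrthonormalBasis ℝ (ℝ ∙ xbar)ᗮ).reindex (finCongr hfin)).repr
  refine ⟨(ℝ ∙ xbar)ᗮ.subtypeₗᵢ.comp B.symm.toLinearIsometry, fun z => ?_⟩
  rw [← Submodule.mem_orthogonal_singleton_iff_inner_left]
  constructor
  · intro hz
    exact ⟨B ⟨z, hz⟩, by simp⟩
  · rintro ⟨u, rfl⟩
    exact (B.symm u).2

theorem inner_add_smul_self (hx : xbar ≠ 0) {z : EuclideanSpace ℝ (Fin (m + 1))}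
    (hz : ⟪z, xbar⟫ = 0) : ⟪(2 * ‖xbar‖ ^ 2)⁻¹ • xbar + z, xbar⟫ = 2⁻¹ := by
  have : ‖xbar‖ ≠ 0 := norm_ne_zero_iff.2 hx
  rw [inner_add_left, hz, real_inner_smul_left, real_inner_self_eq_norm_sq, add_zero]
  field_simp

/-- The inversion of a plane is a sphere through the origin. -/
theorem norm_inversion_sub {a : EuclideanSpace ℝ (Fin (m + 1))} (ha0 : a ≠ 0) :
    ‖(‖a‖ ^ 2)⁻¹ • a - xbar‖ = ‖xbar‖ ↔ ⟪a, xbar⟫ = 2⁻¹ := by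
  have : ‖a‖ ≠ 0 := norm_ne_zero_iff.2 ha0
  rw [← sq_eq_sq₀ (norm_nonneg _) (norm_nonneg _), norm_sub_sq_real, norm_smul, norm_inv, norm_pow,
    norm_norm, real_inner_smul_left]
  field_simp
  constructor <;> intro h <;> linarith

/-- `M_{d,0}` is a complete umbilical submanifold diffeomorphic to `ℝᵐ`. -/
theorem exists_plane_embedding (hx : xbar ≠ 0) :
    ∃ f : EuclideanSpace ℝ (Fin m) → SphR (m + 1), IsSmoothEmbeddingOnto m f (MRH xbar ‖xbar‖ 0) ∧
      IsUmbilical m f ∧ IsCompleteImmersion m f := by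
  obtain ⟨ι, hι⟩ := exists_isometry_orthogonal hx
  set a : EuclideanSpace ℝ (Fin m) → EuclideanSpace ℝ (Fin (m + 1)) :=
    fun u => (2 * ‖xbar‖ ^ 2)⁻¹ • xbar + ι u with ha
  have hinner : ∀ u, ⟪a u, xbar⟫ = 2⁻¹ := fun u => inner_add_smul_self hx ((hι _).2 ⟨u, rfl⟩)
  have ha0 : ∀ u, a u ≠ 0 := fun u h0 => by
    have := hinner u
    rw [h0, inner_zero_left] at this
    norm_num at this
  have hs0 : ∀ u, zeroHeight (a u) ≠ 0 := fun u h0 =>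
    ha0 u (zeroHeight.injective (h0.trans (map_zero _).symm))
  set L : EuclideanSpace ℝ (Fin m) →L[ℝ] EuclideanSpace ℝ (Fin (m + 1 + 1)) :=
    (zeroHeight.comp ι).toContinuousLinearMap
  have hsL : (fun u => zeroHeight (a u)) =
      fun u => zeroHeight ((2 * ‖xbar‖ ^ 2)⁻¹ • xbar) + L u := by
    funext u
    exact map_add _ _ _
  have hss : ContMDiff (𝓡 m) 𝓘(ℝ, EuclideanSpace ℝ (Fin (m + 1 + 1))) ∞
      (fun u => zeroHeight (a u)) := by
    rw [hsL]
    exact (contDiff_const.add L.contDiff).contMDiff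
  set g : EuclideanSpace ℝ (Fin m) → SphR (m + 1) := fun u => conformalInv _ (hs0 u) with hg
  have hgs : ContMDiff (𝓡 m) (modelSphR (m + 1)) ∞ g := contMDiff_conformalInv hs0 hss
  have hconf : (fun u => conformalMap (g u)) = fun u => zeroHeight (a u) := by
    funext u
    exact conformalMap_conformalInv _ _
  have hchart : ∀ p, chartRep m (fun u => conformalMap (g u)) p =
      fun u => zeroHeight ((2 * ‖xbar‖ ^ 2)⁻¹ • xbar) + L u := by
    intro p
    rw [hconf, hsL]
    funext y
    rw [chartRep, extChartAt_model_space_eq_id]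
    rfl
  have hfd : fderiv ℝ (fun u => zeroHeight ((2 * ‖xbar‖ ^ 2)⁻¹ • xbar) + L u) = fun _ => L := by
    funext y
    rw [fderiv_const_add, ContinuousLinearMap.fderiv]
  have hgi : IsSmoothImmersion m g := isSmoothImmersion_of_injective_dImm hgs fun p =>
    injective_dImm_of_conformalMap hgs (by
      rw [hchart, hfd]
      exact (zeroHeight.comp ι).injective)
  have hgu : IsUmbilical m g := isUmbilical_of_conformalMap hgs fun p =>
    ⟨0, fun v w => ⟨0, by rw [hchart, hfd]; simp⟩⟩
  have hfi := hgi.timeReflect_comp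
  have hemb : IsEmbedding (fun u => timeReflect (g u)) := by
    have hiso : Isometry fun u => zeroHeight (a u) := zeroHeight.isometry.comp
      (Isometry.comp (isometry_add_left _) ι.isometry)
    have hcomp : (fun q : SphR (m + 1) => conformalMap (timeReflect q)) ∘
        (fun u => timeReflect (g u)) = fun u => zeroHeight (a u) := by
      rw [← hconf]
      funext u
      exact congrArg conformalMap (timeReflect.left_inv (g u))
    refine IsEmbedding.of_comp hfi.contMDiff.continuous
      (continuous_conformalMap.comp (contMDiff_timeReflect (k := 0)).continuous) ?_
    change IsEmbedding ((fun q : SphR (m + 1) => conformalMap (timeReflect q)) ∘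
        (fun u => timeReflect (g u)))
    rw [hcomp]
    exact hiso.isEmbedding
  have hrange : range (fun u => timeReflect (g u)) = MRH xbar ‖xbar‖ 0 := by
    ext p
    constructor
    · rintro ⟨u, rfl⟩
      rw [mem_MRH_iff, conformalMap_timeReflect, hg, conformalMap_conformalInv]
      simp only [LinearIsometry.norm_map, map_smul, initPart_zeroHeight]
      refine ⟨(norm_inversion_sub (ha0 u)).2 (hinner u), ?_⟩
      simp
    · intro hp
      obtain ⟨h1, h2⟩ := mem_MRH_iff.1 hp
      set y := initPart (conformalMap p) with hy
      have hpy : conformalMap p = zeroHeight y := by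
        rw [eq_zeroHeight_initPart_add (conformalMap p), h2, zero_smul, add_zero]
      have hy0 : y ≠ 0 := fun h0 => conformalMap_ne_zero p (by rw [hpy, h0, map_zero])
      have hyn : ‖y‖ ≠ 0 := norm_ne_zero_iff.2 hy0
      set b := (‖y‖ ^ 2)⁻¹ • y with hb
      have hb0 : b ≠ 0 := smul_ne_zero (by positivity) hy0
      have hyb : (‖b‖ ^ 2)⁻¹ • b = y := by
        rw [hb, norm_smul, norm_inv, norm_pow, norm_norm, smul_smul]
        have : (((‖y‖ ^ 2)⁻¹ * ‖y‖) ^ 2)⁻¹ * (‖y‖ ^ 2)⁻¹ = 1 := by field_simp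
        rw [this, one_smul]
      have hbx : ⟪b, xbar⟫ = 2⁻¹ := (norm_inversion_sub hb0).1 (by rw [hyb, h1])
      obtain ⟨u, hu⟩ := (hι (b - (2 * ‖xbar‖ ^ 2)⁻¹ • xbar)).1 (by
        have h3 := inner_add_smul_self hx (z := 0) (inner_zero_left _)
        rw [add_zero] at h3
        rw [inner_sub_left, hbx, h3, sub_self])
      refine ⟨u, ?_⟩
      have hau : a u = b := by rw [ha]; simp [hu]
      have : g u = timeReflect p := by
        refine conformalMap_injective ?_
        rw [hg, conformalMap_conformalInv, hau, conformalMap_timeReflect, hpy, zeroHeight.norm_map,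
          ← map_smul _ (‖y‖ ^ 2)⁻¹]
      change timeReflect (g u) = p
      rw [this]
      exact timeReflect.left_inv p
  exact ⟨_, ⟨hfi, hemb, hrange⟩, hgu.timeReflect_comp hgs,
    isCompleteImmersion_of_isClosedEmbedding hfi.contMDiff
      ⟨hemb, by rw [hrange]; exact isClosed_MRH⟩⟩

end Plane

theorem theorem1 (m : ℕ) (hm : 2 ≤ m)
    (xbar : EuclideanSpace ℝ (Fin (m + 1))) (hx : xbar ≠ 0) :
    -- each `M^m_{r,h}` is a complete umbilical submanifold: type, reduction of codimension, rotational
    (∀ r h : ℝ, 0 < r → 0 ≤ h →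
      ((r, h) ≠ (‖xbar‖, 0) → ∃ f : Sph m → SphR (m + 1),
        IsSmoothEmbeddingOnto m f (MRH xbar r h) ∧ IsUmbilical m f ∧ IsCompleteImmersion m f) ∧
      ((r, h) = (‖xbar‖, 0) → ∃ f : EuclideanSpace ℝ (Fin m) → SphR (m + 1),
        IsSmoothEmbeddingOnto m f (MRH xbar r h) ∧ IsUmbilical m f ∧ IsCompleteImmersion m f) ∧
      ((∃ W : Submodule ℝ (EuclideanSpace ℝ (Fin (m + 1 + 1))),
        Module.finrank ℝ W = m + 1 ∧ MRH xbar r h ⊆ totGeodCyl W) ↔ h = 0) ∧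
      (h ≠ 0 → IsRotational m 2 (MRH xbar r h)) ∧
      (h = 0 → IsRotational m 1 (MRH xbar r h))) ∧
    -- homology class of `M^m_{r,0}` in the totally geodesic hypersurface that contains it
    (∀ r : ℝ, 0 < r → ∀ W : Submodule ℝ (EuclideanSpace ℝ (Fin (m + 1 + 1))),
      Module.finrank ℝ W = m + 1 → ∀ hW : MRH xbar r 0 ⊆ totGeodCyl W,
        (r < ‖xbar‖ → IsNullHomologous m hW) ∧ (‖xbar‖ < r → ¬ IsNullHomologous m hW)) ∧
    -- the submanifolds are pairwise noncongruent
    (∀ r h r' h' : ℝ, 0 < r → 0 ≤ h → 0 < r' → 0 ≤ h' → (r, h) ≠ (r', h') →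
      ¬ AreCongruent (MRH xbar r h) (MRH xbar r' h')) ∧
    -- classification of the umbilical submanifolds that are not totally geodesic
    (∀ (n : ℕ) (M : Type*) [TopologicalSpace M] [ChartedSpace (EuclideanSpace ℝ (Fin m)) M]
      [IsManifold (𝓡 m) ∞ M] [ConnectedSpace M] (f : M → SphR n),
      IsSmoothImmersion m f → IsUmbilical m f → ¬ IsTotallyGeodesic m f →
      ∃ Ψ : SphR n ≃ SphR n, IsAmbientIsometry Ψ ∧
        ((∃ S : Set (SphR n), IsSmallSphere m S ∧ IsOpenSubsetOf (Ψ '' range f) S) ∨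
         (n = m ∧ ∃ r : ℝ, 0 < r ∧ IsOpenSubsetOf (Ψ '' range f) (inSphR n (MRH xbar r 0))) ∨
         (m + 1 ≤ n ∧ ∃ r h : ℝ, 0 < r ∧ 0 ≤ h ∧
           IsOpenSubsetOf (Ψ '' range f) (inSphR n (MRH xbar r h))))) := by
  have hm0 : m ≠ 0 := by omega
  refine ⟨fun r h hr hh => ⟨fun hrh => exists_sphere_embedding hr hrh, fun hrh => ?_,
    exists_totGeodCyl_iff hx hr, fun hh0 => isRotational_two_MRH hm0 hx hr, fun h0 => ?_⟩,
    fun r hr W hWm hW => ⟨fun hd => isNullHomologous_MRH hm0 hr hd hW,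
      fun hd => not_isNullHomologous_MRH hm0 hr hd hWm hW⟩,
    fun r h r' h' hr hh hr' hh' hne => not_areCongruent_MRH hm0 hx hr hh hr' hh' hne, ?_⟩
  · obtain ⟨rfl, rfl⟩ := Prod.mk.inj hrh
    exact exists_plane_embedding hx
  · subst h0
    exact isRotational_one_MRH hm0 hx hr
  · intro n M _ _ _ _ f hf hu hng
    exact hu.classification hm hx hf hng
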